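/- **Theorem (Multiparameter radial projection theorem).** Let $\ell\ge 1$, let $d_1,\dots,d_\ell$ and $k_1,\dots,k_\ell$ be integers with $2\le k_i\le d_i$ for all $i$, and put $d=d_1+\cdots+d_\ell$. Write $x=(x_1,\dots,x_\ell)\in\mathbb R^d=\mathbb R^{d_1}\times\cdots\times\mathbb R^{d_\ell}$ and let $\pi_i:\mathbb R^d\to\mathbb R^{d_i}$, $\pi_i(x)=x_i$. Let $G(n,m)$ be the Grassmannian of $m$-dimensional linear subspaces of $\mathbb R^n$, with its rotation invariant Borel probability measure $\gamma_{n,m}$; let $G=\prod_{i=1}^\ell G(d_i,k_i)$ and $\gamma=\prod_{i=1}^\ell\gamma_{d_i,k_i}$. For $V=(V_1,\dots,V_\ell)\in G$ let $\pi_{V_i}:\mathbb R^{d_i}\to V_i$ be the orthogonal projection and $\pi_V=\pi_{V_1}\times\cdots\times\pi_{V_\ell}:\mathbb R^d\to V_1\times\cdots\times V_\ell$; let $S^{k_i-1}$ be the unit sphere of $V_i$, with its surface measure; and for $w\in V_1\times\cdots\times V_\ell$ let $$P^{(\ell)}_w(z)=\Big(\frac{z_1-w_1}{|z_1-w_1|},\dots,\frac{z_\ell-w_\ell}{|z_\ell-w_\ell|}\Big)\in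 S^{k_1-1}\times\cdots\times S^{k_\ell-1}\qquad (z\in V_1\times\cdots\times V_\ell,\ z_i\ne w_i\text{ for all } i).$$ For a measure $\mu$, $\pi_V\mu$ and $P^{(\ell)}_w\pi_V\mu$ denote push-forwards. The $L^p$ norm of a measure on $S^{k_1-1}\times\cdots\times S^{k_\ell-1}$ is the $L^p$ norm of its density with respect to the product of the surface measures, and is $\infty$ if the measure is not absolutely continuous. Let $M=\max_{1\le i\le\ell}(d-d_i+k_i-1)$, and let $\alpha,\beta\in\mathbb R$ satisfy $\alpha>M$, $\beta>2M-\alpha$, and $\beta>M-(k_i-1)$ for all $i=1,\dots,\ell$. Then there is $p>1$, depending only on $\alpha$, $\beta$ and the integers $d_i$, $k_i$, such that the following holds. Let $\mu,\nu$ be compactly supported Radon measures on $\mathbb R^d$ and let $C_\alpha(\mu),C_\beta(\nu)\in[0,\infty)$ be constants such that 1. $\pi_i(\operatorname{supp}\mu)\cap\pi_i(\operatorname{supp}\nu)=\varnothing$ for all $i=1,\dots,\ell$; 2. $\mu(B(x,r))\le C_\alpha(\mu)\,r^\alpha$ and $\nu(B(x,r))\le C_\beta(\nu)\,r^\beta$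 for all $x\in\mathbb R^d$ and $r>0$. Let $G'$ be the set of all $V\in G$ with $\pi_{V_i}(\pi_i(\operatorname{supp}\mu))\cap\pi_{V_i}(\pi_i(\operatorname{supp}\nu))=\varnothing$ for all $i$. Then $$\int_{G'}\Big(\int_{V_1\times\cdots\times V_\ell}\big\|P^{(\ell)}_w\pi_V\mu\big\|_{L^p(S^{k_1-1}\times\cdots\times S^{k_\ell-1})}^p\,d\pi_V\nu(w)\Big)^{1/p}d\gamma(V)\ \le\ C\,C_\alpha(\mu)\,C_\beta(\nu)^{1/p},$$ where the constant $C<\infty$ depends only on $d$ and on the diameter of $\operatorname{supp}\mu\cup\operatorname{supp}\nu$. -/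

import Mathlib

open MeasureTheory Metric
open scoped ENNReal NNReal

noncomputable section

/-! ### The Grassmannian `G(n, k)` and its rotation invariant probability measure -/

/-- The orthogonal group `O(n)`, as the group of unitary operators of the real Hilbert space
`ℝⁿ`, with the topology of the operator norm. -/
abbrev OrthGroup (n : ℕ) : Type :=
  unitary (EuclideanSpace ℝ (Fin n) →L[ℝ] EuclideanSpace ℝ (Fin n))

instance OrthGroup.instContinuousStar (n : ℕ) :
    ContinuousStar (EuclideanSpace ℝ (Fin n) →L[ℝ] EuclideanSpace ℝ (Fin n)) :=
  @NormedStarGroup.to_continuousStar _ _ _ CStarRing.to_normedStarGroup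

instance OrthGroup.instCompactSpace (n : ℕ) : CompactSpace (OrthGroup n) := by
  refine isCompact_iff_compactSpace.mp (Metric.isCompact_of_isClosed_isBounded ?_ ?_)
  · exact isClosed_unitary
  · refine (Metric.isBounded_iff_subset_closedBall 0).2 ⟨1, fun u hu => ?_⟩
    rw [mem_closedBall_zero_iff]
    refine ContinuousLinearMap.opNorm_le_bound _ zero_le_one fun x => ?_
    rw [one_mul]
    exact ((Unitary.linearIsometryEquiv ⟨u, hu⟩).norm_map x).le

/-- The Grassmannian `G(n, k)`: the `k`-dimensional linear subspaces of `ℝⁿ`. -/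
def RealGrassmannian (n k : ℕ) : Type :=
  {V : Submodule ℝ (EuclideanSpace ℝ (Fin n)) // Module.finrank ℝ V = k}

/-- The usual topology of `G(n, k)`, given by the metric `‖P_V - P_W‖`, where `P_V` is the
orthogonal projection onto `V`, seen as an endomorphism of `ℝⁿ`. -/
instance RealGrassmannian.instTopologicalSpace (n k : ℕ) :
    TopologicalSpace (RealGrassmannian n k) :=
  TopologicalSpace.induced (fun V => V.1.starProjection) inferInstance

instance RealGrassmannian.instMeasurableSpace (n k : ℕ) :
    MeasurableSpace (RealGrassmannian n k) :=
  borel _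

instance RealGrassmannian.instBorelSpace (n k : ℕ) : BorelSpace (RealGrassmannian n k) :=
  ⟨rfl⟩

/-- The image `g V` of a `k`-dimensional subspace `V` under `g ∈ O(n)`. -/
def RealGrassmannian.rotate {n k : ℕ} (V : RealGrassmannian n k) (g : OrthGroup n) :
    RealGrassmannian n k :=
  ⟨V.1.map (Unitary.linearIsometryEquiv g).toLinearEquiv.toLinearMap, by
    rw [LinearEquiv.finrank_map_eq]; exact V.2⟩

theorem RealGrassmannian.continuous_rotate {n k : ℕ} (V : RealGrassmannian n k) :
    Continuous V.rotate := by
  rw [continuous_induced_rng]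
  have h : (fun W : RealGrassmannian n k => W.1.starProjection) ∘ V.rotate =
      fun g : OrthGroup n => (g : EuclideanSpace ℝ (Fin n) →L[ℝ] EuclideanSpace ℝ (Fin n)) *
        V.1.starProjection * star (g : EuclideanSpace ℝ (Fin n) →L[ℝ] _) := by
    funext g
    ext1 x
    have := Submodule.starProjection_map_apply (Unitary.linearIsometryEquiv g) V.1 x
    exact this
  rw [h]
  fun_prop

/-- The subspace of `ℝⁿ` spanned by the first `k` vectors of the standard basis. -/
def RealGrassmannian.std {n k : ℕ} (h : k ≤ n) : RealGrassmannian n k :=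
  ⟨Submodule.span ℝ (Set.range fun j : Fin k =>
      EuclideanSpace.single (Fin.castLE h j) (1 : ℝ)), by
    have hli : LinearIndependent ℝ fun j : Fin k =>
        EuclideanSpace.single (Fin.castLE h j) (1 : ℝ) := by
      have := (EuclideanSpace.basisFun (Fin n) ℝ).toBasis.linearIndependent.comp _
        (Fin.castLE_injective h)
      simpa [Function.comp_def] using this
    simpa using finrank_span_eq_card hli⟩

/-- The Haar probability measure of the compact group `O(n)`. -/
def orthHaar (n : ℕ) : Measure (OrthGroup n) := Measure.haarMeasure ⊤

/-- The measure `γ_{n,k}` on `G(n, k)`: the law of `g V₀`, where `g ∈ O(n)` is distributed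
according to the Haar probability measure and `V₀` is a fixed `k`-dimensional subspace. -/
def grassmannMeasure {n k : ℕ} (h : k ≤ n) : Measure (RealGrassmannian n k) :=
  (orthHaar n).map (RealGrassmannian.std h).rotate

instance grassmannMeasure.instIsProbabilityMeasure {n k : ℕ} (h : k ≤ n) :
    IsProbabilityMeasure (grassmannMeasure h) := by
  have : IsProbabilityMeasure (orthHaar n) := ⟨by
    have := Measure.haarMeasure_self (K₀ := (⊤ : TopologicalSpace.PositiveCompacts (OrthGroup n)))
    simpa [orthHaar] using this⟩
  exact Measure.isProbabilityMeasure_map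
    (RealGrassmannian.std h).continuous_rotate.measurable.aemeasurable

/-! ### Multiparameter radial projections -/

/-- The `Lᵖ(σ)` norm of a measure `ρ`: the `Lᵖ(σ)` norm of its density if `ρ` is absolutely
continuous with respect to `σ`, and `∞` otherwise. -/
def measureLpNorm {X : Type*} [MeasurableSpace X] (p : ℝ) (ρ σ : Measure X) : ℝ≥0∞ :=
  open Classical in if ρ ≪ σ then (∫⁻ x, (ρ.rnDeriv σ x) ^ p ∂σ) ^ (1 / p) else ∞

section Radial

variable {ι : Type*} [Fintype ι] (F : ι → Type*)
  [∀ i, NormedAddCommGroup (F i)] [∀ i, InnerProductSpace ℝ (F i)]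
  [∀ i, FiniteDimensional ℝ (F i)] [∀ i, MeasurableSpace (F i)] [∀ i, BorelSpace (F i)]

/-- The product over `i` of the surface measures of the unit spheres of the Euclidean spaces
`F i`. -/
def prodSurface : Measure (∀ i, sphere (0 : F i) 1) :=
  Measure.pi fun i => (volume : Measure (F i)).toSphere

variable {F}

/-- The multiparameter radial projection `z ↦ ((z i - w i) / |z i - w i|)_i` centred at `w`,
on the set of all `z` with `z i ≠ w i` for every `i`. -/
def radialProj (w : ∀ i, F i) (z : {z : ∀ i, F i // ∀ i, z i ≠ w i}) :
    ∀ i, sphere (0 : F i) 1 :=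
  fun i => ⟨‖z.1 i - w i‖⁻¹ • (z.1 i - w i), by
    rw [mem_sphere_zero_iff_norm, norm_smul, norm_inv, norm_norm,
      inv_mul_cancel₀ (norm_ne_zero_iff.mpr (sub_ne_zero.mpr (z.2 i)))]⟩

/-- The push-forward of `μ` (restricted to the domain of the map) under the radial projection
centred at `w`. -/
def radialPush (w : ∀ i, F i) (μ : Measure (∀ i, F i)) : Measure (∀ i, sphere (0 : F i) 1) :=
  (μ.comap Subtype.val).map (radialProj w)

end Radial

/-! ### Multiparameter orthogonal projections -/

/-- `ℝ^{d₁} × ⋯ × ℝ^{d_ℓ}` with the Euclidean norm. -/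
abbrev MultiSpace {ℓ : ℕ} (dv : Fin ℓ → ℕ) : Type :=
  PiLp 2 fun i => EuclideanSpace ℝ (Fin (dv i))

/-- `G(d₁, k₁) × ⋯ × G(d_ℓ, k_ℓ)`. -/
abbrev MultiGrassmannian {ℓ : ℕ} (dv kv : Fin ℓ → ℕ) : Type :=
  ∀ i, RealGrassmannian (dv i) (kv i)

/-- The map `π_{V₁} × ⋯ × π_{V_ℓ}` from `ℝ^{d₁} × ⋯ × ℝ^{d_ℓ}` to `V₁ × ⋯ × V_ℓ`. -/
def multiProj {ℓ : ℕ} {dv kv : Fin ℓ → ℕ} (V : MultiGrassmannian dv kv) (x : MultiSpace dv) :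
    ∀ i, (V i).1 :=
  fun i => (V i).1.orthogonalProjectionOnto (x i)

/-- The tuples `V` such that, for every `i`, the sets `π_{V_i} ∘ π_i (A)` and
`π_{V_i} ∘ π_i (B)` are disjoint. -/
def separatingSubspaces {ℓ : ℕ} {dv : Fin ℓ → ℕ} (kv : Fin ℓ → ℕ) (A B : Set (MultiSpace dv)) :
    Set (MultiGrassmannian dv kv) :=
  {V | ∀ i, Disjoint ((fun x => multiProj V x i) '' A) ((fun x => multiProj V x i) '' B)}

end

open MeasureTheory Metric
open scoped ENNReal NNReal

set_option linter.unusedSectionVars false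

noncomputable section

/-! Linearise the radial projection. Seen from `w`, the points whose direction in each block is
close to `θ i` lie in a thin tube around the line through `w` in that direction. So the density at
`θ` of the radial projection of `π_V μ` is dominated, up to a power of the diameter, by the density
at the image of `w` of the orthogonal projection of `π_V μ` onto the product of the hyperplanes `(θ
i)ᗮ` of `V i` (`radialPush_isOpen_le`, `exists_coneDensity_eq_maximalDensity`). For fixed `θ` and
random `V` the composite is a random orthogonal projection in each block, now of rank `k_i - 1`. It
suffices to bound, uniformly in `θ`, the density of such projections of `μ` in `L^p` of the
projection of `ν`, averaged over rotations; integrating over `θ` costs only the total surface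
measure.

The density is replaced by `maximalDensity`, the supremum of Gaussian mollifications at dyadic
scales, which telescopes into increments between the scales `√s` and `√(2s)`. To estimate an
increment in `L¹(ν)`, multiply by its sign `σ` and pass to Fourier transforms. Cauchy–Schwarz
separates a Sobolev energy of `μ` of positive order `g + 4ε` from one of `σ ν` of negative order
`-g`, and the difference of the two Gaussians gains `s ^ ε`. Energies of negative order are double
integrals against nonnegative kernels, so `σ` can be dropped
(`lintegral_rpow_gaussian_transform_le`). Interpolation with the trivial sup bound `s ^ (-m / 2)`
keeps geometric decay in `L^p` for `p` slightly above 1.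

The energies are averaged over linear maps `B` for which `B x` is Gaussian with covariance `|x i|²`
in block `i`. The mean of `|ξ| ^ τ |(Bϖ)^(ξ)|²`, integrated over `ξ`, is a double integral dominated
by that of the kernel `∏ |x i| ^ (-m i) (min |x i|) ^ (-τ)` (`exists_lintegral_weight_le`). A
measure of Frostman exponent `a` has bounded potentials for it once `τ < a - M`
(`exists_setLIntegral_rieszKernel_le`). An admissible `g` must satisfy `M - β < g < α - M` and `0 <
g < k_i - 1`: these are the hypotheses on `α` and `β`.

Gaussian maps are compared with rotations through `x ↦ |z| g x`, where `g` is Haar distributed and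
`z` is standard Gaussian. Its value at each single `x` is Gaussian, and when `|z| ≤ 1` it only
brings points closer together than `g` does, which increases mollifications. So the rotation average
is at most the Gaussian average divided by the probability that all `|z i| ≤ 1`.

Finally `C` may depend on `d` and the diameter only, while `p` may depend on everything. The bound
for an exponent `q` is interpolated with total mass, with weight so small that all other constants,
absorbed into a power of `2R`, contribute at most one factor `2R`. -/

/-- Tonelli's theorem for products of functions of one coordinate each. -/
theorem lintegral_fin_prod_eq_prod {n : ℕ} {E : Fin n → Type*}
    {mE : ∀ i, MeasurableSpace (E i)} {μ : (i : Fin n) → Measure (E i)} [∀ i, SigmaFinite (μ i)]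
    (f : (i : Fin n) → E i → ℝ≥0∞) (hf : ∀ i, Measurable (f i)) :
    ∫⁻ x : (i : Fin n) → E i, ∏ i, f i (x i) ∂(Measure.pi μ) = ∏ i, ∫⁻ x, f i x ∂(μ i) := by
  induction n with
  | zero => simp
  | succ n n_ih =>
      calc
        _ = ∫⁻ x : E 0 × ((i : Fin n) → E (Fin.succ i)),
            f 0 x.1 * ∏ i : Fin n, f (Fin.succ i) (x.2 i)
            ∂((μ 0).prod (Measure.pi (fun i ↦ μ i.succ))) := by
          refine (((measurePreserving_piFinSuccAbove μ 0).symm).lintegral_comp_emb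
            (MeasurableEquiv.measurableEmbedding _) (fun x => ∏ i, f i (x i))).symm.trans
            (lintegral_congr fun x => ?_)
          rw [Fin.prod_univ_succ]
          rfl
        _ = (∫⁻ x, f 0 x ∂μ 0)
            * ∏ i : Fin n, ∫⁻ (x : E (Fin.succ i)), f (Fin.succ i) x ∂(μ i.succ) := by
          rw [← n_ih _ fun i => hf i.succ]
          exact lintegral_prod_mul (μ := μ 0) (ν := Measure.pi fun i : Fin n => μ i.succ) (f := f 0)
            (g := fun x : ∀ i : Fin n, E i.succ => ∏ i, f i.succ (x i)) (hf 0).aemeasurable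
            (Finset.measurable_prod _ fun i _ =>
              (hf i.succ).comp (measurable_pi_apply i)).aemeasurable
        _ = ∏ i, ∫⁻ x, f i x ∂(μ i) := by rw [Fin.prod_univ_succ]

theorem lintegral_pi_prod_eq_prod {ι : Type*} [Fintype ι] {E : ι → Type*}
    {mE : ∀ i, MeasurableSpace (E i)} {μ : (i : ι) → Measure (E i)} [∀ i, SigmaFinite (μ i)]
    (f : (i : ι) → E i → ℝ≥0∞) (hf : ∀ i, Measurable (f i)) :
    ∫⁻ x : (i : ι) → E i, ∏ i, f i (x i) ∂(Measure.pi μ) = ∏ i, ∫⁻ x, f i x ∂(μ i) := by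
  let e := (Fintype.equivFin ι).symm
  rw [← (measurePreserving_piCongrLeft _ e).lintegral_comp_emb
    (MeasurableEquiv.measurableEmbedding _)]
  simp_rw [← e.prod_comp, MeasurableEquiv.coe_piCongrLeft, Equiv.piCongrLeft_apply_apply]
  exact lintegral_fin_prod_eq_prod _ fun i => hf _

/-! ### Singular integrals and averaging over balls. -/

section Energy

variable {E : Type*} [NormedAddCommGroup E] [InnerProductSpace ℝ E] [FiniteDimensional ℝ E]
  [MeasurableSpace E] [BorelSpace E]

theorem lintegral_ball_enorm_rpow_lt_top {s R : ℝ} (hd : 1 ≤ Module.finrank ℝ E)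
    (hs : s < Module.finrank ℝ E) :
    ∫⁻ x : E in ball 0 R, ENNReal.ofReal (‖x‖ ^ (-s)) < ∞ := by
  have h := integrableOn_ball_of_norm_le_rpow (μ := (volume : Measure E)) (r := R)
    (f := fun x : E => ‖x‖ ^ (-s)) (C := 1) hd hs (Filter.Eventually.of_forall fun x => by
      rw [one_mul, Real.norm_of_nonneg (by positivity)])
    ((measurable_norm.pow_const _).aestronglyMeasurable)
  exact h.lintegral_lt_top

theorem lintegral_comp_smul_eq (f : E → ℝ≥0∞) {r : ℝ} (hr : 0 < r) :
    ∫⁻ x, f (r • x) = ENNReal.ofReal (r ^ (-(Module.finrank ℝ E : ℝ))) * ∫⁻ x, f x := by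
  have h := Measure.map_addHaar_smul (volume : Measure E) hr.ne'
  have h2 : ∫⁻ x, f (r • x) = ∫⁻ x, f x ∂((volume : Measure E).map (r • ·)) :=
    ((Homeomorph.smulOfNeZero r hr.ne').measurableEmbedding.lintegral_map f).symm
  rw [h2, h, lintegral_smul_measure, abs_of_pos (by positivity), Real.rpow_neg hr.le,
    Real.rpow_natCast, smul_eq_mul]

/-- The integral of `‖x‖ ^ (-s)` over a ball of radius `R ≥ 1` is at most a constant times
`R ^ dim E`. -/
theorem exists_lintegral_ball_rpow_le {s : ℝ} (hd : 1 ≤ Module.finrank ℝ E) (hs0 : 0 ≤ s)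
    (hs : s < Module.finrank ℝ E) :
    ∃ c : ℝ≥0, ∀ R : ℝ, 1 ≤ R → ∫⁻ x : E in ball 0 R, ENNReal.ofReal (‖x‖ ^ (-s)) ≤
      c * ENNReal.ofReal (R ^ (Module.finrank ℝ E : ℝ)) := by
  have hfin := lintegral_ball_enorm_rpow_lt_top (E := E) (R := 1) hd hs
  refine ⟨(∫⁻ x : E in ball 0 1, ENNReal.ofReal (‖x‖ ^ (-s))).toNNReal, fun R hR => ?_⟩
  rw [ENNReal.coe_toNNReal hfin.ne]
  have hR0 : 0 < R := by linarith
  -- Rescaling to the unit ball produces a factor `R ^ (-s) ≤ 1`, which is discarded; the cruder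
  -- power of `R` is enough.
  have h := lintegral_comp_smul_eq (E := E)
    ((ball 0 R).indicator fun x => ENNReal.ofReal (‖x‖ ^ (-s))) hR0
  rw [lintegral_indicator measurableSet_ball] at h
  have h2 : ∀ x : E, ((ball 0 R).indicator fun x => ENNReal.ofReal (‖x‖ ^ (-s))) (R • x) ≤
      (ball (0 : E) 1).indicator (fun x => ENNReal.ofReal (‖x‖ ^ (-s))) x := by
    intro x
    by_cases hx : x ∈ ball (0 : E) 1
    · rw [Set.indicator_of_mem hx]
      refine (Set.indicator_le_self _ _ _).trans (ENNReal.ofReal_le_ofReal ?_)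
      rw [norm_smul, Real.norm_of_nonneg hR0.le, Real.mul_rpow hR0.le (norm_nonneg _)]
      exact mul_le_of_le_one_left (by positivity)
        (Real.rpow_le_one_of_one_le_of_nonpos hR (by linarith))
    · rw [Set.indicator_of_notMem]
      · exact zero_le
      · rw [mem_ball_zero_iff, norm_smul, Real.norm_of_nonneg hR0.le]
        rw [mem_ball_zero_iff] at hx
        intro h3
        exact hx (by nlinarith [norm_nonneg x])
  have h3 := (lintegral_mono (μ := volume) h2).trans_eq (lintegral_indicator measurableSet_ball _)
  rw [h] at h3
  have h4 : ENNReal.ofReal (R ^ (Module.finrank ℝ E : ℝ)) *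
      ENNReal.ofReal (R ^ (-(Module.finrank ℝ E : ℝ))) = 1 := by
    rw [← ENNReal.ofReal_mul (by positivity), ← Real.rpow_add hR0]
    simp
  calc ∫⁻ x : E in ball 0 R, ENNReal.ofReal (‖x‖ ^ (-s))
      = ENNReal.ofReal (R ^ (Module.finrank ℝ E : ℝ)) *
        (ENNReal.ofReal (R ^ (-(Module.finrank ℝ E : ℝ))) *
          ∫⁻ x : E in ball 0 R, ENNReal.ofReal (‖x‖ ^ (-s))) := by
        rw [← mul_assoc, h4, one_mul]
    _ ≤ _ := by rw [mul_comm (lintegral _ _)]; gcongr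

/-- Averaging the measure of balls over a neighbourhood of `S`. -/
theorem measure_mul_volume_ball_le {X : Type*} [NormedAddCommGroup X] [MeasurableSpace X]
    [BorelSpace X] [SecondCountableTopology X] (lam : Measure X) [lam.IsAddLeftInvariant]
    [SFinite lam] (ϖ : Measure X) [SFinite ϖ] {S : Set X} (hS : MeasurableSet S) {r : ℝ}
    {c : ℝ≥0∞} (hc : ∀ x, ϖ (ball x r) ≤ c) :
    ϖ S * lam (ball 0 r) ≤ c * lam (thickening r S) := by
  have hm : Measurable (Function.uncurry fun x z : X =>
      (ball x r).indicator (fun _ => S.indicator (fun _ => (1 : ℝ≥0∞)) x) z) := by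
    have : (Function.uncurry fun x z : X =>
        (ball x r).indicator (fun _ => S.indicator (fun _ => (1 : ℝ≥0∞)) x) z) =
        ({p : X × X | dist p.2 p.1 < r} ∩ Prod.fst ⁻¹' S).indicator fun _ => 1 := by
      ext ⟨x, z⟩
      by_cases h1 : dist z x < r <;> by_cases h2 : x ∈ S <;> simp [Set.indicator, h1, h2]
    rw [this]
    refine measurable_const.indicator (MeasurableSet.inter ?_ (measurable_fst hS))
    exact measurableSet_lt (by fun_prop) measurable_const
  -- The left side is the product measure of the pairs `(x, z)` with `x ∈ S` and `|x - z| < r`,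
  -- fibred over `x`; the bound comes from fibring over `z`.
  calc ϖ S * lam (ball 0 r)
      = ∫⁻ x, ∫⁻ z, (ball x r).indicator
          (fun _ => S.indicator (fun _ => (1 : ℝ≥0∞)) x) z ∂lam ∂ϖ := by
        have : ∀ x : X, ∫⁻ z, (ball x r).indicator
            (fun _ => S.indicator (fun _ => (1 : ℝ≥0∞)) x) z ∂lam =
            S.indicator (fun _ => lam (ball 0 r)) x := by
          intro x
          rw [lintegral_indicator_const measurableSet_ball]
          have hb : lam (ball x r) = lam (ball 0 r) := by
            have := measure_preimage_add lam (-x) (ball 0 r)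
            rw [← this]
            congr 1
            ext z
            simp [dist_eq_norm, add_comm, sub_eq_add_neg]
          rw [hb]
          by_cases h2 : x ∈ S <;> simp [h2]
        simp_rw [this]
        rw [lintegral_indicator_const hS, mul_comm]
    _ = ∫⁻ z, ∫⁻ x, (ball x r).indicator
          (fun _ => S.indicator (fun _ => (1 : ℝ≥0∞)) x) z ∂ϖ ∂lam :=
        lintegral_lintegral_swap hm.aemeasurable
    _ ≤ ∫⁻ z, (thickening r S).indicator (fun _ => c) z ∂lam := by
        refine lintegral_mono fun z => ?_
        by_cases hz : z ∈ thickening r S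
        · rw [Set.indicator_of_mem hz]
          refine le_trans ?_ (hc z)
          rw [← lintegral_indicator_one measurableSet_ball]
          refine lintegral_mono fun x => ?_
          by_cases h1 : dist z x < r <;> by_cases h2 : x ∈ S <;>
            simp [Set.indicator, h1, h2, dist_comm x z]
        · rw [Set.indicator_of_notMem hz]
          refine le_of_eq (lintegral_eq_zero_of_ae_eq_zero (ae_of_all _ fun x => ?_))
          by_cases h2 : x ∈ S
          · have : ¬ dist z x < r := fun h => hz (mem_thickening_iff.2 ⟨x, h2, h⟩)
            simp [Set.indicator, this]
          · simp [Set.indicator, h2]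
    _ = _ := lintegral_indicator_const isOpen_thickening.measurableSet c

end Energy

/-! ### Mass and slices of Frostman measures on a product. -/

section ProductEnergy

variable {ι : Type*} [Fintype ι] {E : ι → Type*}
  [∀ i, NormedAddCommGroup (E i)] [∀ i, InnerProductSpace ℝ (E i)]
  [∀ i, FiniteDimensional ℝ (E i)] [∀ i, MeasurableSpace (E i)] [∀ i, BorelSpace (E i)]

/-- A measure of diameter at most `R` whose balls satisfy `ϖ (ball x r) ≤ c` has total mass at
most `c ((R + r) / r) ^ d`. -/
theorem measure_univ_le_of_ball_le (ϖ : Measure (∀ i, E i)) [SFinite ϖ] {r R : ℝ} (hr : 0 < r)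
    (hR : 0 ≤ R) {c : ℝ≥0∞} (hc : ∀ x, ϖ (ball x r) ≤ c) (y : ∀ i, E i)
    (hy : ∀ᵐ x ∂ϖ, ∀ i, ‖x i - y i‖ ≤ R) :
    ϖ Set.univ ≤ c * ENNReal.ofReal (((R + r) / r) ^ Module.finrank ℝ (∀ i, E i)) := by
  have hS : MeasurableSet (closedBall y R) := measurableSet_closedBall
  have h := measure_mul_volume_ball_le volume ϖ hS (r := r) hc
  have hu : ϖ Set.univ ≤ ϖ (closedBall y R) := by
    refine measure_mono_ae ?_
    filter_upwards [hy] with x hx _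
    change x ∈ closedBall y R
    rw [mem_closedBall, dist_pi_le_iff hR]
    exact fun i => by rw [dist_eq_norm]; exact hx i
  have h2 : thickening r (closedBall y R) ⊆ ball y (R + r) := by
    intro z hz
    obtain ⟨x, hx, hzx⟩ := mem_thickening_iff.1 hz
    rw [mem_ball]
    rw [mem_closedBall] at hx
    linarith [dist_triangle z x y]
  have h3 := h.trans (mul_le_mul_right (measure_mono h2) _)
  -- The volume of the unit ball cancels. This leaves an explicit constant, so that the final bound
  -- depends on `d` and the diameter alone.
  rw [Measure.addHaar_ball_of_pos _ _ hr, Measure.addHaar_ball_of_pos _ _ (by linarith : 0 < R + r),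
    ← mul_assoc, ← mul_assoc, ENNReal.mul_le_mul_iff_left
      (measure_ball_pos _ _ one_pos).ne' measure_ball_lt_top.ne] at h3
  have h4 : ENNReal.ofReal (((R + r) / r) ^ Module.finrank ℝ (∀ i, E i)) *
      ENNReal.ofReal (r ^ Module.finrank ℝ (∀ i, E i)) =
      ENNReal.ofReal ((R + r) ^ Module.finrank ℝ (∀ i, E i)) := by
    rw [← ENNReal.ofReal_mul (by positivity), ← mul_pow, div_mul_cancel₀ _ hr.ne']
  rw [← h4, ← mul_assoc, ENNReal.mul_le_mul_iff_left (by simp; positivity) (by simp)] at h3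
  exact hu.trans h3

/-- Frostman measures do not charge the slices `x i = y i`. -/
theorem measure_slice_eq_zero (ϖ : Measure (∀ i, E i)) [SFinite ϖ] {a R : ℝ} (hR : 0 ≤ R)
    {c : ℝ≥0} (hc : ∀ x r, 0 < r → ϖ (ball x r) ≤ c * ENNReal.ofReal (r ^ a)) (y : ∀ i, E i)
    (hy : ∀ᵐ x ∂ϖ, ∀ i, ‖x i - y i‖ ≤ R) (i : ι)
    (ha : (Module.finrank ℝ (∀ i, E i) : ℝ) - Module.finrank ℝ (E i) < a) :
    ϖ {x | x i = y i} = 0 := by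
  classical
  set D := Module.finrank ℝ (∀ i, E i)
  set S : Set (∀ i, E i) := {x | x i = y i} ∩ closedBall y R
  have hS : MeasurableSet S :=
    (measurableSet_eq_fun (measurable_pi_apply i) measurable_const).inter measurableSet_closedBall
  have hle : ϖ {x | x i = y i} ≤ ϖ S := by
    refine measure_mono_ae ?_
    filter_upwards [hy] with x hx hxi
    refine ⟨hxi, ?_⟩
    rw [mem_closedBall, dist_pi_le_iff hR]
    exact fun i => by rw [dist_eq_norm]; exact hx i
  set K : ℝ≥0∞ := ∏ j ∈ Finset.univ.erase i, volume (ball (y j) (R + 1))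
  have hK : K ≠ ∞ := ENNReal.prod_ne_top fun j _ => measure_ball_lt_top.ne
  set v := volume (ball (0 : ∀ i, E i) 1)
  -- The `r`-neighbourhood of the slice has volume of order `r ^ dim (E i)`, so averaging over balls
  -- gives `ϖ S * r ^ D ≲ r ^ a * r ^ dim (E i)`. The resulting power of `r` is positive, and `r →
  -- 0` kills `ϖ S`.
  have hmain : ∀ r : ℝ, 0 < r → r ≤ 1 → ϖ S * v ≤
      c * K * volume (ball (0 : E i) 1) *
        ENNReal.ofReal (r ^ (a - (D - Module.finrank ℝ (E i)))) := by
    intro r hr hr1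
    have h := measure_mul_volume_ball_le volume ϖ hS (r := r) fun x => hc x r hr
    have hsub : thickening r S ⊆
        Set.univ.pi fun j => ball (y j) (if j = i then r else R + 1) := by
      intro z hz j _
      obtain ⟨x, ⟨hxi, hx⟩, hzx⟩ := mem_thickening_iff.1 hz
      have h1 := (dist_le_pi_dist z x j).trans_lt hzx
      rw [mem_closedBall, dist_pi_le_iff hR] at hx
      rw [mem_ball]
      split_ifs with hj
      · subst hj
        rw [← show x j = y j from hxi]
        exact h1
      · linarith [dist_triangle (z j) (x j) (y j), hx j]
    have hvol : volume (thickening r S) ≤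
        ENNReal.ofReal (r ^ Module.finrank ℝ (E i)) * volume (ball (0 : E i) 1) * K := by
      refine (measure_mono hsub).trans (le_of_eq ?_)
      rw [volume_pi_pi, ← Finset.mul_prod_erase _ _ (Finset.mem_univ i), if_pos rfl,
        Measure.addHaar_ball_of_pos _ _ hr]
      congr 1
      refine Finset.prod_congr rfl fun j hj => ?_
      rw [if_neg (Finset.ne_of_mem_erase hj)]
    have h3 := h.trans (mul_le_mul_right hvol _)
    rw [Measure.addHaar_ball_of_pos _ _ hr] at h3
    have e1 : ENNReal.ofReal (r ^ (-(D : ℝ))) * ENNReal.ofReal (r ^ D) = 1 := by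
      rw [← ENNReal.ofReal_mul (by positivity), ← Real.rpow_natCast, ← Real.rpow_add hr]
      simp
    have e2 : ENNReal.ofReal (r ^ (a - (D - Module.finrank ℝ (E i)))) =
        ENNReal.ofReal (r ^ (-(D : ℝ))) * (ENNReal.ofReal (r ^ a) *
          ENNReal.ofReal (r ^ Module.finrank ℝ (E i))) := by
      rw [← ENNReal.ofReal_mul (by positivity), ← ENNReal.ofReal_mul (by positivity),
        ← Real.rpow_natCast r (Module.finrank ℝ (E i)), ← Real.rpow_add hr, ← Real.rpow_add hr]
      congr 2
      ring
    calc ϖ S * v = ENNReal.ofReal (r ^ (-(D : ℝ))) *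
          (ϖ S * (ENNReal.ofReal (r ^ D) * v)) := by
          rw [← mul_assoc, ← mul_assoc, mul_comm _ (ϖ S), mul_assoc (ϖ S), e1, mul_one]
      _ ≤ _ := mul_le_mul_right h3 _
      _ = _ := by rw [e2]; ring
  have hlim : Filter.Tendsto (fun r : ℝ => c * K * volume (ball (0 : E i) 1) *
      ENNReal.ofReal (r ^ (a - (D - Module.finrank ℝ (E i))))) (nhdsWithin 0 (Set.Ioi 0))
      (nhds (c * K * volume (ball (0 : E i) 1) * ENNReal.ofReal 0)) := by
    refine ENNReal.Tendsto.const_mul (ENNReal.tendsto_ofReal ?_) (Or.inr ?_)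
    · have : Filter.Tendsto (fun r : ℝ => r ^ (a - (D - Module.finrank ℝ (E i)))) (nhds 0)
          (nhds (0 ^ (a - (D - Module.finrank ℝ (E i))))) :=
        (Real.continuous_rpow_const (by linarith)).tendsto 0
      rw [Real.zero_rpow (by linarith)] at this
      exact this.mono_left nhdsWithin_le_nhds
    · exact ENNReal.mul_ne_top (ENNReal.mul_ne_top (by simp) hK) measure_ball_lt_top.ne
  rw [ENNReal.ofReal_zero, mul_zero] at hlim
  have h0 : ϖ S * v ≤ 0 := by
    refine ge_of_tendsto hlim ?_
    have : Set.Ioc (0 : ℝ) 1 ∈ nhdsWithin (0 : ℝ) (Set.Ioi 0) :=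
      Ioc_mem_nhdsGT one_pos
    filter_upwards [this] with r hr using hmain r hr.1 hr.2
  have hv : v ≠ 0 := (measure_ball_pos _ _ one_pos).ne'
  have := (mul_eq_zero.1 (le_antisymm h0 zero_le)).resolve_right hv
  exact le_antisymm (hle.trans this.le) zero_le

end ProductEnergy

/-! ### The product Riesz kernel and potentials of Frostman measures. -/

section RieszKernel

variable {ι : Type*} [Fintype ι] [Nonempty ι] {E : ι → Type*}
  [∀ i, NormedAddCommGroup (E i)]

/-- The smallest norm of a component of `x`. -/
def minNorm (x : ∀ i, E i) : ℝ := Finset.univ.inf' Finset.univ_nonempty fun i => ‖x i‖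

theorem minNorm_le (x : ∀ i, E i) (i : ι) : minNorm x ≤ ‖x i‖ :=
  Finset.inf'_le _ (Finset.mem_univ i)

theorem exists_minNorm_eq (x : ∀ i, E i) : ∃ i, minNorm x = ‖x i‖ := by
  obtain ⟨i, _, h⟩ := Finset.exists_mem_eq_inf' Finset.univ_nonempty fun i => ‖x i‖
  exact ⟨i, h⟩

theorem minNorm_nonneg (x : ∀ i, E i) : 0 ≤ minNorm x := by
  obtain ⟨i, h⟩ := exists_minNorm_eq x
  rw [h]; positivity

theorem minNorm_pos_iff (x : ∀ i, E i) : 0 < minNorm x ↔ ∀ i, x i ≠ 0 := by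
  constructor
  · exact fun h i => norm_pos_iff.1 (h.trans_le (minNorm_le x i))
  · intro h
    obtain ⟨i, hi⟩ := exists_minNorm_eq x
    rw [hi]; exact norm_pos_iff.2 (h i)

theorem continuous_minNorm : Continuous (minNorm : (∀ i, E i) → ℝ) :=
  Continuous.finset_inf'_apply _ fun i _ => (continuous_apply i).norm

/-- The kernel `∏ j, |x j| ^ (-m j)` times `(min j, |x j|) ^ (-τ)`. -/
def rieszKernel (m : ι → ℝ) (τ : ℝ) (x : ∀ i, E i) : ℝ :=
  (∏ j, ‖x j‖ ^ (-m j)) * minNorm x ^ (-τ)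

theorem rieszKernel_nonneg (m : ι → ℝ) (τ : ℝ) (x : ∀ i, E i) : 0 ≤ rieszKernel m τ x :=
  mul_nonneg (Finset.prod_nonneg fun _ _ => by positivity)
    (Real.rpow_nonneg (minNorm_nonneg x) _)

theorem measurable_rieszKernel [∀ i, MeasurableSpace (E i)] [∀ i, BorelSpace (E i)]
    [∀ i, SecondCountableTopology (E i)] (m : ι → ℝ) (τ : ℝ) :
    Measurable (rieszKernel m τ : (∀ i, E i) → ℝ) := by
  refine Measurable.mul (Finset.measurable_prod _ fun j _ => ?_)
    (continuous_minNorm.measurable.pow_const _)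
  exact (measurable_norm.comp (measurable_pi_apply j)).pow_const _

theorem rpow_le_of_comparable {s t e : ℝ} (hs : 0 < s) (h1 : s ≤ 2 * t) (h2 : t ≤ 2 * s) :
    s ^ e ≤ 2 ^ |e| * t ^ e := by
  have ht : 0 < t := by linarith
  rcases le_total 0 e with he | he
  · rw [abs_of_nonneg he, ← Real.mul_rpow (by norm_num) ht.le]
    exact Real.rpow_le_rpow hs.le h1 he
  · rw [abs_of_nonpos he]
    have : s ^ e = 2 ^ (-e) * (2 * s) ^ e := by
      rw [Real.mul_rpow (by norm_num) hs.le, ← mul_assoc, ← Real.rpow_add (by norm_num)]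
      simp
    rw [this]
    exact mul_le_mul_of_nonneg_left (Real.rpow_le_rpow_of_nonpos ht h2 he) (by positivity)

theorem abs_minNorm_sub_le {x z : ∀ i, E i} {r : ℝ} (h : ∀ i, ‖x i - z i‖ ≤ r) :
    minNorm x ≤ minNorm z + r := by
  obtain ⟨i, hi⟩ := exists_minNorm_eq z
  rw [hi]
  have h1 := minNorm_le x i
  have h2 : ‖x i‖ ≤ ‖x i - z i‖ + ‖z i‖ := by simpa using norm_add_le (x i - z i) (z i)
  linarith [h i]

/-- The kernel is slowly varying at the scale `minNorm`. -/
theorem rieszKernel_le_of_close (m : ι → ℝ) (τ : ℝ) {x z : ∀ i, E i}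
    (hx : 0 < minNorm x) (h : ∀ i, ‖x i - z i‖ ≤ minNorm x / 2) :
    rieszKernel m τ x ≤ (∏ j, 2 ^ |m j|) * 2 ^ |τ| * rieszKernel m τ z := by
  have hz : ∀ i, ‖x i‖ ≤ 2 * ‖z i‖ ∧ ‖z i‖ ≤ 2 * ‖x i‖ := by
    intro i
    have h1 := minNorm_le x i
    have h2 : ‖x i‖ ≤ ‖x i - z i‖ + ‖z i‖ := by simpa using norm_add_le (x i - z i) (z i)
    have h3 : ‖z i‖ ≤ ‖x i - z i‖ + ‖x i‖ := by
      rw [norm_sub_rev]; simpa using norm_add_le (z i - x i) (x i)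
    constructor <;> linarith [h i]
  have hq1 := abs_minNorm_sub_le h
  have hq2 : minNorm z ≤ minNorm x + minNorm x / 2 :=
    abs_minNorm_sub_le fun i => by rw [norm_sub_rev]; exact h i
  have e1 : ∏ j, ‖x j‖ ^ (-m j) ≤ (∏ j, 2 ^ |m j|) * ∏ j, ‖z j‖ ^ (-m j) := by
    rw [← Finset.prod_mul_distrib]
    refine Finset.prod_le_prod (fun _ _ => by positivity) fun j _ => ?_
    rw [← abs_neg]
    exact rpow_le_of_comparable (hx.trans_le (minNorm_le x j)) (hz j).1 (hz j).2
  have e2 : minNorm x ^ (-τ) ≤ 2 ^ |τ| * minNorm z ^ (-τ) := by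
    rw [← abs_neg]
    exact rpow_le_of_comparable hx (by linarith) (by linarith)
  calc rieszKernel m τ x ≤ ((∏ j, 2 ^ |m j|) * ∏ j, ‖z j‖ ^ (-m j)) *
        (2 ^ |τ| * minNorm z ^ (-τ)) :=
        mul_le_mul e1 e2 (Real.rpow_nonneg hx.le _) (by positivity)
    _ = _ := by rw [rieszKernel]; ring

variable [∀ i, InnerProductSpace ℝ (E i)]
  [∀ i, FiniteDimensional ℝ (E i)] [∀ i, MeasurableSpace (E i)] [∀ i, BorelSpace (E i)]

/-- Local integrability of the kernel with respect to Lebesgue measure. -/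
theorem exists_lintegral_rieszKernel_le (m : ι → ℝ) (hm : ∀ i, 0 ≤ m i) {e : ℝ}
    (hmd : ∀ i, m i < Module.finrank ℝ (E i))
    (he : ∀ i, m i - Module.finrank ℝ (E i) < e) :
    ∃ (c : ℝ≥0) (F : ℝ), 0 ≤ F ∧ ∀ R : ℝ, 1 ≤ R →
      ∫⁻ x : ∀ i, E i in ball 0 R ∩ {x | 0 < minNorm x}, ENNReal.ofReal (rieszKernel m (-e) x) ≤
        c * ENNReal.ofReal (R ^ F) := by
  classical
  -- A positive exponent of the minimum is lowered to `e₀ ≤ 0` at the cost of `R ^ (e - e₀)`. Then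
  -- the singularities `m j - e₀` are nonnegative and still below the dimension.
  obtain ⟨e₀, he₀, he₀e, he₀0⟩ : ∃ e₀ : ℝ, (∀ i, m i - Module.finrank ℝ (E i) < e₀) ∧
      e₀ ≤ e ∧ e₀ ≤ 0 := by
    set w := Finset.univ.sup' Finset.univ_nonempty fun i => m i - Module.finrank ℝ (E i)
    refine ⟨min e 0, fun i => lt_min (he i) (by linarith [hmd i]), min_le_left _ _,
      min_le_right _ _⟩
  have hc : ∀ i j, ∃ c : ℝ≥0, ∀ R : ℝ, 1 ≤ R → ∫⁻ x : E j in ball 0 R,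
      ENNReal.ofReal (‖x‖ ^ (-(m j - if j = i then e₀ else 0))) ≤
      c * ENNReal.ofReal (R ^ (Module.finrank ℝ (E j) : ℝ)) := by
    intro i j
    refine exists_lintegral_ball_rpow_le ?_ ?_ ?_
    · have := (hm j).trans_lt (hmd j)
      exact_mod_cast this
    · split_ifs <;> linarith [hm j]
    · split_ifs <;> linarith [he₀ j, hmd j]
  choose c hc using hc
  set D : ℝ := ∑ j, (Module.finrank ℝ (E j) : ℝ)
  refine ⟨∑ i, ∏ j, c i j, D + (e - e₀), ?_, fun R hR => ?_⟩
  · have : 0 ≤ D := Finset.sum_nonneg fun _ _ => Nat.cast_nonneg _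
    linarith
  have hR0 : 0 < R := by linarith
  -- The minimum is attained in some block `i`, where the kernel becomes a pure product. Summing
  -- over `i` gives a majorant to which Tonelli applies factor by factor.
  have hpt : ∀ x : ∀ i, E i, x ∈ ball 0 R ∩ {x : ∀ i, E i | 0 < minNorm x} →
      ENNReal.ofReal (rieszKernel m (-e) x) ≤ ENNReal.ofReal (R ^ (e - e₀)) *
        ∑ i, ∏ j, ENNReal.ofReal (‖x j‖ ^ (-(m j - if j = i then e₀ else 0))) := by
    rintro x ⟨hxR, hx⟩
    have hx' : 0 < minNorm x := hx
    obtain ⟨i, hi⟩ := exists_minNorm_eq x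
    have hxi : ‖x i‖ ≤ R := (norm_le_pi_norm x i).trans (mem_ball_zero_iff.1 hxR).le
    have h1 : rieszKernel m (-e) x ≤ R ^ (e - e₀) *
        ∏ j, ‖x j‖ ^ (-(m j - if j = i then e₀ else 0)) := by
      have hprod : ∏ j, ‖x j‖ ^ (-(m j - if j = i then e₀ else 0)) =
          (∏ j, ‖x j‖ ^ (-m j)) * ‖x i‖ ^ e₀ := by
        have : ∀ j, ‖x j‖ ^ (-(m j - if j = i then e₀ else 0)) =
            ‖x j‖ ^ (-m j) * (if j = i then ‖x i‖ ^ e₀ else 1) := by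
          intro j
          split_ifs with hj
          · subst hj
            rw [← Real.rpow_add (hx'.trans_le (minNorm_le x j))]; congr 1; ring
          · simp
        simp_rw [this, Finset.prod_mul_distrib]
        simp
      rw [hprod, rieszKernel, neg_neg, hi]
      have h2 : ‖x i‖ ^ e ≤ R ^ (e - e₀) * ‖x i‖ ^ e₀ := by
        have hpos : 0 < ‖x i‖ := hi ▸ hx'
        calc ‖x i‖ ^ e = ‖x i‖ ^ (e - e₀) * ‖x i‖ ^ e₀ := by
              rw [← Real.rpow_add hpos]; congr 1; ring
          _ ≤ _ := by gcongr
      calc _ ≤ (∏ j, ‖x j‖ ^ (-m j)) * (R ^ (e - e₀) * ‖x i‖ ^ e₀) := by gcongr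
        _ = _ := by ring
    refine (ENNReal.ofReal_le_ofReal h1).trans ?_
    rw [ENNReal.ofReal_mul (by positivity), ENNReal.ofReal_prod_of_nonneg
      fun _ _ => by positivity]
    gcongr
    exact Finset.single_le_sum (f := fun i => ∏ j,
      ENNReal.ofReal (‖x j‖ ^ (-(m j - if j = i then e₀ else 0))))
      (fun _ _ => zero_le) (Finset.mem_univ i)
  have hball : ball (0 : ∀ i, E i) R = Set.univ.pi fun i => ball (0 : E i) R :=
    ball_pi _ hR0
  have hms : MeasurableSet (ball (0 : ∀ i, E i) R ∩ {x : ∀ i, E i | 0 < minNorm x}) :=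
    measurableSet_ball.inter (measurableSet_lt measurable_const continuous_minNorm.measurable)
  have hmeas : ∀ i j, Measurable fun u : E j =>
      ENNReal.ofReal (‖u‖ ^ (-(m j - if j = i then e₀ else 0))) := fun i j =>
    (measurable_norm.pow_const _).ennreal_ofReal
  calc _ ≤ ∫⁻ x : ∀ i, E i in ball 0 R ∩ {x | 0 < minNorm x}, ENNReal.ofReal (R ^ (e - e₀)) *
        ∑ i, ∏ j, ENNReal.ofReal (‖x j‖ ^ (-(m j - if j = i then e₀ else 0))) :=
        setLIntegral_mono' hms hpt
    _ ≤ ∫⁻ x : ∀ i, E i in ball 0 R, ENNReal.ofReal (R ^ (e - e₀)) *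
        ∑ i, ∏ j, ENNReal.ofReal (‖x j‖ ^ (-(m j - if j = i then e₀ else 0))) :=
        lintegral_mono_set Set.inter_subset_left
    _ = ENNReal.ofReal (R ^ (e - e₀)) * ∑ i, ∏ j, ∫⁻ u : E j in ball 0 R,
        ENNReal.ofReal (‖u‖ ^ (-(m j - if j = i then e₀ else 0))) := by
        have hP : ∀ i, Measurable fun x : ∀ i, E i =>
            ∏ j, ENNReal.ofReal (‖x j‖ ^ (-(m j - if j = i then e₀ else 0))) := fun i =>
          Finset.measurable_prod _ fun j _ => (hmeas i j).comp (measurable_pi_apply j)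
        rw [lintegral_const_mul _ (Finset.measurable_sum _ fun i _ => hP i),
          lintegral_finsetSum _ fun i _ => hP i]
        congr 1
        refine Finset.sum_congr rfl fun i _ => ?_
        rw [hball, volume_pi, Measure.restrict_pi_pi]
        exact lintegral_pi_prod_eq_prod (fun j (u : E j) =>
          ENNReal.ofReal (‖u‖ ^ (-(m j - if j = i then e₀ else 0)))) (hmeas i)
    _ ≤ ENNReal.ofReal (R ^ (e - e₀)) * ∑ i, ∏ j, (c i j *
          ENNReal.ofReal (R ^ (Module.finrank ℝ (E j) : ℝ))) := by
        gcongr with i _ j _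
        exact hc i j R hR
    _ = _ := by
        simp_rw [Finset.prod_mul_distrib]
        rw [← Finset.sum_mul, ← ENNReal.ofReal_prod_of_nonneg fun _ _ => by positivity,
          ← Real.rpow_sum_of_pos hR0, Real.rpow_add hR0, ENNReal.ofReal_mul (by positivity)]
        push_cast
        ring

/-- Energy estimate: a Frostman measure of dimension `a` has bounded potential with respect to
the kernel `rieszKernel m τ`. -/
theorem exists_setLIntegral_rieszKernel_le (m : ι → ℝ) (hm : ∀ i, 0 ≤ m i) {a τ M : ℝ}
    (hmd : ∀ i, m i < Module.finrank ℝ (E i))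
    (hM : ∀ i, (Module.finrank ℝ (∀ i, E i) : ℝ) - Module.finrank ℝ (E i) + m i ≤ M)
    (hτ : τ < a - M) :
    ∃ (c : ℝ≥0) (F : ℝ), 0 ≤ F ∧ ∀ (R : ℝ) (C : ℝ≥0), 1 ≤ R →
      ∀ (ϖ : Measure (∀ i, E i)) [SFinite ϖ],
      (∀ x r, 0 < r → ϖ (ball x r) ≤ C * ENNReal.ofReal (r ^ a)) →
      ∀ y, (∀ᵐ x ∂ϖ, ∀ i, ‖x i - y i‖ ≤ R) →
      ∫⁻ x in {x | 0 < minNorm (x - y)}, ENNReal.ofReal (rieszKernel m τ (x - y)) ∂ϖ ≤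
        c * ENNReal.ofReal (R ^ F) * C := by
  set D := Module.finrank ℝ (∀ i, E i)
  -- The local integrability condition for `e = a - D - τ` reads `τ < a - (D - dim (E i) + m i)`,
  -- which follows from `τ < a - M`.
  obtain ⟨c₁, F, hF, hc₁⟩ := exists_lintegral_rieszKernel_le (E := E) m hm (e := a - D - τ) hmd
    fun i => by linarith [hM i]
  set v := volume (ball (0 : ∀ i, E i) 1)
  have hv0 : v ≠ 0 := (measure_ball_pos _ _ one_pos).ne'
  have hvt : v ≠ ∞ := measure_ball_lt_top.ne
  set C₂ : ℝ := (∏ j, 2 ^ |m j|) * 2 ^ |τ| * 3 ^ D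
  have hC₂ : 0 < C₂ := by positivity
  set c₂ : ℝ≥0∞ := ENNReal.ofReal C₂ * v⁻¹
  have hc₂ : c₂ ≠ ∞ := ENNReal.mul_ne_top (by simp) (ENNReal.inv_ne_top.2 hv0)
  refine ⟨c₂.toNNReal * c₁ * Real.toNNReal (2 ^ F), F, hF, fun R C hR ϖ _ hϖ y hy => ?_⟩
  rw [ENNReal.coe_mul, ENNReal.coe_mul, ENNReal.coe_toNNReal hc₂]
  have hR0 : 0 < R := by linarith
  set T : Set (∀ i, E i) := ball 0 (2 * R) ∩ {x | 0 < minNorm x}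
  have hT : MeasurableSet T :=
    measurableSet_ball.inter (measurableSet_lt measurable_const continuous_minNorm.measurable)
  -- With `q = minNorm (x - y)`, the kernel at `x - y` is replaced by its average over `z ∈ ball x
  -- (q / 2)`, where it is comparable. After exchanging integrals, the ball of radius `minNorm (z -
  -- y)` about `z` has mass at most `C * minNorm (z - y) ^ a`, while the normalising volume gives
  -- the power `-D`. What remains is a Lebesgue integral of the kernel of index `τ + D - a`.
  set Φ : (∀ i, E i) → ℝ≥0∞ := fun z => T.indicator
    (fun z => c₂ * ENNReal.ofReal (rieszKernel m τ z * minNorm z ^ (-(D : ℝ)))) (z - y)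
  have hΦ : Measurable Φ := by
    refine Measurable.comp (Measurable.indicator ?_ hT) (measurable_id.sub_const y)
    exact (((measurable_rieszKernel m τ).mul
      (continuous_minNorm.measurable.pow_const _)).ennreal_ofReal).const_mul _
  have hpt : ∀ᵐ x ∂ϖ, x ∈ {x | 0 < minNorm (x - y)} →
      ENNReal.ofReal (rieszKernel m τ (x - y)) ≤
      ∫⁻ z, {z | dist x z < minNorm (z - y)}.indicator Φ z := by
    filter_upwards [hy] with x hxR hx
    set q := minNorm (x - y)
    have hq : 0 < q := hx
    have hqR : q ≤ R := by
      obtain ⟨i, hi⟩ := exists_minNorm_eq (x - y)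
      rw [show q = _ from hi]; exact hxR i
    have hin : ∀ z ∈ ball x (q / 2), ENNReal.ofReal (rieszKernel m τ (x - y)) *
        (ENNReal.ofReal ((q / 2) ^ D) * v)⁻¹ ≤
        {z | dist x z < minNorm (z - y)}.indicator Φ z := by
      intro z hz
      have hz' : ∀ i, ‖(x - y) i - (z - y) i‖ ≤ q / 2 := by
        intro i
        have := dist_le_pi_dist x z i
        rw [mem_ball, dist_comm] at hz
        rw [Pi.sub_apply, Pi.sub_apply, sub_sub_sub_cancel_right, ← dist_eq_norm]
        linarith
      have h1 := abs_minNorm_sub_le hz'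
      have h2 : minNorm (z - y) ≤ q + q / 2 :=
        abs_minNorm_sub_le fun i => by rw [norm_sub_rev]; exact hz' i
      have hzq : 0 < minNorm (z - y) := by linarith
      have hzd : dist x z < minNorm (z - y) := by
        rw [mem_ball, dist_comm] at hz; linarith
      have hzT : z - y ∈ T := by
        refine ⟨?_, hzq⟩
        rw [mem_ball_zero_iff, pi_norm_lt_iff (by linarith)]
        intro i
        have h3 : ‖(z - y) i‖ ≤ ‖(x - y) i - (z - y) i‖ + ‖(x - y) i‖ := by
          rw [norm_sub_rev]; simpa using norm_add_le ((z - y) i - (x - y) i) ((x - y) i)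
        have h4 : ‖(x - y) i‖ ≤ R := hxR i
        linarith [hz' i]
      rw [Set.indicator_of_mem (by exact hzd)]
      simp only [Φ]
      rw [Set.indicator_of_mem hzT]
      have h5 := rieszKernel_le_of_close m τ hq hz'
      -- The factor `3 ^ D` comes from `minNorm (z - y) ≤ 3 * (q / 2)`.
      have h6 : ((q / 2) ^ D)⁻¹ ≤ 3 ^ D * minNorm (z - y) ^ (-(D : ℝ)) := by
        rw [Real.rpow_neg hzq.le, Real.rpow_natCast, ← inv_pow, ← inv_pow, ← mul_pow]
        gcongr
        rw [← div_eq_mul_inv, inv_le_comm₀ (by positivity) (by positivity), inv_div,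
          div_le_iff₀ (by norm_num)]
        linarith
      rw [ENNReal.mul_inv (Or.inr hvt) (Or.inl (by simp)), ← mul_assoc,
        ← ENNReal.ofReal_inv_of_pos (by positivity),
        ← ENNReal.ofReal_mul (rieszKernel_nonneg _ _ _)]
      rw [show c₂ = ENNReal.ofReal C₂ * v⁻¹ from rfl, mul_right_comm (ENNReal.ofReal C₂),
        ← ENNReal.ofReal_mul hC₂.le]
      refine mul_le_mul_left (ENNReal.ofReal_le_ofReal ?_) _
      calc rieszKernel m τ (x - y) * ((q / 2) ^ D)⁻¹
          ≤ ((∏ j, 2 ^ |m j|) * 2 ^ |τ| * rieszKernel m τ (z - y)) *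
            (3 ^ D * minNorm (z - y) ^ (-(D : ℝ))) :=
            mul_le_mul h5 h6 (by positivity)
              (mul_nonneg (by positivity) (rieszKernel_nonneg _ _ _))
        _ = _ := by simp only [C₂]; ring
    calc ENNReal.ofReal (rieszKernel m τ (x - y))
        = ∫⁻ z in ball x (q / 2), ENNReal.ofReal (rieszKernel m τ (x - y)) *
          (ENNReal.ofReal ((q / 2) ^ D) * v)⁻¹ := by
          rw [setLIntegral_const, Measure.addHaar_ball_of_pos _ _ (by positivity), mul_assoc,
            ENNReal.inv_mul_cancel, mul_one]
          · simp [hv0]; positivity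
          · exact ENNReal.mul_ne_top (by simp) hvt
      _ ≤ ∫⁻ z in ball x (q / 2), {z | dist x z < minNorm (z - y)}.indicator Φ z :=
          setLIntegral_mono' measurableSet_ball hin
      _ ≤ _ := setLIntegral_le_lintegral _ _
  have hmu : Measurable (Function.uncurry fun x z : ∀ i, E i =>
      {z | dist x z < minNorm (z - y)}.indicator Φ z) := by
    have : (Function.uncurry fun x z : ∀ i, E i =>
        {z | dist x z < minNorm (z - y)}.indicator Φ z) =
        {p : (∀ i, E i) × (∀ i, E i) | dist p.1 p.2 < minNorm (p.2 - y)}.indicator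
          fun p => Φ p.2 := by
      ext ⟨x, z⟩
      by_cases h : dist x z < minNorm (z - y) <;> simp [Set.indicator, h]
    rw [this]
    refine (hΦ.comp measurable_snd).indicator (measurableSet_lt (by fun_prop) ?_)
    exact continuous_minNorm.measurable.comp (measurable_snd.sub_const y)
  calc ∫⁻ x in {x | 0 < minNorm (x - y)}, ENNReal.ofReal (rieszKernel m τ (x - y)) ∂ϖ
      ≤ ∫⁻ x in {x | 0 < minNorm (x - y)},
        ∫⁻ z, {z | dist x z < minNorm (z - y)}.indicator Φ z ∂volume ∂ϖ := by
        refine setLIntegral_mono_ae' ?_ hpt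
        exact measurableSet_lt measurable_const
          (continuous_minNorm.measurable.comp (measurable_id.sub_const y))
    _ ≤ ∫⁻ x, ∫⁻ z, {z | dist x z < minNorm (z - y)}.indicator Φ z ∂volume ∂ϖ :=
        setLIntegral_le_lintegral _ _
    _ = ∫⁻ z, ∫⁻ x, {z | dist x z < minNorm (z - y)}.indicator Φ z ∂ϖ ∂volume :=
        lintegral_lintegral_swap hmu.aemeasurable
    _ ≤ ∫⁻ z, T.indicator (fun z => c₂ * C *
          ENNReal.ofReal (rieszKernel m (-(a - D - τ)) z)) (z - y) := by
        refine lintegral_mono fun z => ?_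
        by_cases hz : z - y ∈ T
        · have hzq : 0 < minNorm (z - y) := hz.2
          have h1 : ∀ x, {z | dist x z < minNorm (z - y)}.indicator Φ z =
              (ball z (minNorm (z - y))).indicator (fun _ => Φ z) x := by
            intro x
            by_cases h : dist x z < minNorm (z - y) <;> simp [Set.indicator, h]
          simp_rw [h1]
          rw [lintegral_indicator_const measurableSet_ball, Set.indicator_of_mem hz]
          refine (mul_le_mul_right (hϖ z _ hzq) _).trans (le_of_eq ?_)
          simp only [Φ]
          rw [Set.indicator_of_mem hz]
          have h2 : rieszKernel m (-(a - D - τ)) (z - y) =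
              rieszKernel m τ (z - y) * minNorm (z - y) ^ (-(D : ℝ)) * minNorm (z - y) ^ a := by
            rw [rieszKernel, rieszKernel, mul_assoc, mul_assoc, ← Real.rpow_add hzq,
              ← Real.rpow_add hzq]
            congr 2
            ring
          rw [h2, ENNReal.ofReal_mul (mul_nonneg (rieszKernel_nonneg _ _ _) (by positivity))]
          ring
        · have : Φ z = 0 := Set.indicator_of_notMem hz _
          simp [Set.indicator, this]
    _ = c₂ * C * ∫⁻ z in T, ENNReal.ofReal (rieszKernel m (-(a - D - τ)) z) := by
        rw [lintegral_sub_right_eq_self (μ := (volume : Measure (∀ i, E i)))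
          (T.indicator fun z => c₂ * C * ENNReal.ofReal (rieszKernel m (-(a - D - τ)) z)),
          lintegral_indicator hT, lintegral_const_mul]
        exact (measurable_rieszKernel m _).ennreal_ofReal
    _ ≤ c₂ * C * (c₁ * ENNReal.ofReal ((2 * R) ^ F)) := by
        gcongr
        exact hc₁ (2 * R) (by linarith)
    _ = _ := by
        rw [Real.mul_rpow (by norm_num) hR0.le, ENNReal.ofReal_mul (by positivity)]
        simp only [ENNReal.ofReal]
        ring

end RieszKernel

/-! ### Gaussian integrals of powers of the frequency. -/

section Weights

variable {E : Type*} [NormedAddCommGroup E] [InnerProductSpace ℝ E] [FiniteDimensional ℝ E]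
  [MeasurableSpace E] [BorelSpace E]

/-- The substitution `u ↦ r u` yields the power of `r`. In polar coordinates `σ > -dim E` is the
condition for convergence at the origin. -/
theorem exists_lintegral_rpow_mul_gaussian_eq {σ : ℝ} (hd : 1 ≤ Module.finrank ℝ E)
    (hσ : -(Module.finrank ℝ E : ℝ) < σ) :
    ∃ c : ℝ≥0, ∀ r : ℝ, 0 < r →
      ∫⁻ u : E, ENNReal.ofReal (‖u‖ ^ σ * Real.exp (-(r ^ 2 * ‖u‖ ^ 2 / 2))) =
        c * ENNReal.ofReal (r ^ (-(Module.finrank ℝ E : ℝ) - σ)) := by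
  have : Nontrivial E := Module.nontrivial_of_finrank_pos (R := ℝ) hd
  have hint : Integrable (fun u : E => ‖u‖ ^ σ * Real.exp (-(‖u‖ ^ 2 / 2))) := by
    rw [integrable_fun_norm_addHaar (volume : Measure E)
      (f := fun y => y ^ σ * Real.exp (-(y ^ 2 / 2)))]
    have h := integrableOn_rpow_mul_exp_neg_mul_sq (b := 1 / 2) (by norm_num)
      (s := (Module.finrank ℝ E : ℝ) - 1 + σ) (by linarith)
    refine h.congr_fun (fun y hy => ?_) measurableSet_Ioi
    have hy0 : (0 : ℝ) < y := hy
    simp only [smul_eq_mul]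
    rw [← mul_assoc, ← Real.rpow_natCast y (Module.finrank ℝ E - 1), ← Real.rpow_add hy0, Nat.cast_sub hd]
    push_cast
    congr 2
    ring
  refine ⟨(∫⁻ u : E, ENNReal.ofReal (‖u‖ ^ σ * Real.exp (-(‖u‖ ^ 2 / 2)))).toNNReal,
    fun r hr => ?_⟩
  rw [ENNReal.coe_toNNReal hint.lintegral_lt_top.ne]
  have h := lintegral_comp_smul_eq
    (fun u : E => ENNReal.ofReal (‖u‖ ^ σ * Real.exp (-(‖u‖ ^ 2 / 2)))) hr
  have h2 : ∀ u : E, ENNReal.ofReal (‖r • u‖ ^ σ * Real.exp (-(‖r • u‖ ^ 2 / 2))) =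
      ENNReal.ofReal (r ^ σ) *
        ENNReal.ofReal (‖u‖ ^ σ * Real.exp (-(r ^ 2 * ‖u‖ ^ 2 / 2))) := by
    intro u
    rw [norm_smul, Real.norm_of_nonneg hr.le, Real.mul_rpow hr.le (norm_nonneg _),
      ← ENNReal.ofReal_mul (by positivity), mul_pow, mul_assoc]
  simp_rw [h2] at h
  rw [lintegral_const_mul] at h
  · rw [sub_eq_add_neg, Real.rpow_add hr, ENNReal.ofReal_mul (by positivity), ← mul_assoc,
      mul_comm (lintegral _ _) (ENNReal.ofReal _), ← h, mul_comm, ← mul_assoc,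
      ← ENNReal.ofReal_mul (by positivity), ← Real.rpow_add hr]
    simp
  · have : Measurable fun u : E => ‖u‖ ^ σ := measurable_norm.pow_const _
    fun_prop

end Weights

section GaussianWeights

variable {ι : Type*} [Fintype ι] {W : ι → Type*}
  [∀ i, NormedAddCommGroup (W i)]

/-- The square of the Euclidean norm on a product. -/
def sqNorm (ξ : ∀ i, W i) : ℝ := ∑ i, ‖ξ i‖ ^ 2

theorem sqNorm_nonneg (ξ : ∀ i, W i) : 0 ≤ sqNorm ξ := Finset.sum_nonneg fun _ _ => by positivity

theorem continuous_sqNorm : Continuous (sqNorm : (∀ i, W i) → ℝ) := by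
  unfold sqNorm; fun_prop

theorem norm_sq_le_sqNorm (ξ : ∀ i, W i) (i : ι) : ‖ξ i‖ ^ 2 ≤ sqNorm ξ :=
  Finset.single_le_sum (f := fun i => ‖ξ i‖ ^ 2) (fun _ _ => by positivity) (Finset.mem_univ i)

theorem sqNorm_rpow_le [Nonempty ι] {τ : ℝ} (hτ : 0 ≤ τ) (ξ : ∀ i, W i) :
    sqNorm ξ ^ (τ / 2) ≤ (Fintype.card ι : ℝ) ^ (τ / 2) * ∑ i, ‖ξ i‖ ^ τ := by
  obtain ⟨i, hi⟩ := Finite.exists_max fun i => ‖ξ i‖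
  have h1 : sqNorm ξ ≤ Fintype.card ι * ‖ξ i‖ ^ 2 := by
    calc sqNorm ξ ≤ ∑ _j : ι, ‖ξ i‖ ^ 2 := Finset.sum_le_sum fun j _ => by
          gcongr; exact hi j
      _ = _ := by simp
  calc sqNorm ξ ^ (τ / 2) ≤ (Fintype.card ι * ‖ξ i‖ ^ 2) ^ (τ / 2) :=
        Real.rpow_le_rpow (sqNorm_nonneg _) h1 (by positivity)
    _ = (Fintype.card ι : ℝ) ^ (τ / 2) * ‖ξ i‖ ^ τ := by
        rw [Real.mul_rpow (by positivity) (by positivity), ← Real.rpow_natCast,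
          ← Real.rpow_mul (norm_nonneg _)]
        congr 2
        push_cast; ring
    _ ≤ _ := by
        gcongr
        exact Finset.single_le_sum (f := fun i => ‖ξ i‖ ^ τ) (fun _ _ => by positivity)
          (Finset.mem_univ i)

variable [∀ i, InnerProductSpace ℝ (W i)]
  [∀ i, FiniteDimensional ℝ (W i)] [∀ i, MeasurableSpace (W i)] [∀ i, BorelSpace (W i)]
  {E : ι → Type*} [∀ i, NormedAddCommGroup (E i)]

/-- The squared `L²` norm of `ξ ↦ (‖x i‖ ‖ξ i‖)_i`. -/
def twistSq (x : ∀ i, E i) (ξ : ∀ i, W i) : ℝ := ∑ i, ‖x i‖ ^ 2 * ‖ξ i‖ ^ 2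

/-- The exponential factorises over the blocks: block `j` contributes `‖x j‖ ^ (-dim W j)`, and the
weight on block `i` an additional `‖x i‖ ^ (-τ)`. -/
theorem exists_lintegral_component_rpow_le [Nonempty ι] (hW : ∀ i, 1 ≤ Module.finrank ℝ (W i))
    {τ : ℝ} (i : ι) (hτ : -(Module.finrank ℝ (W i) : ℝ) < τ) :
    ∃ c : ℝ≥0, ∀ x : ∀ i, E i, 0 < minNorm x →
      ∫⁻ ξ : ∀ i, W i, ENNReal.ofReal (‖ξ i‖ ^ τ * Real.exp (-(twistSq x ξ / 2))) ≤
        c * ENNReal.ofReal ((∏ j, ‖x j‖ ^ (-(Module.finrank ℝ (W j) : ℝ))) * ‖x i‖ ^ (-τ)) := by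
  classical
  have h : ∀ j, ∃ c : ℝ≥0, ∀ r : ℝ, 0 < r →
      ∫⁻ u : W j, ENNReal.ofReal (‖u‖ ^ (if j = i then τ else 0) *
        Real.exp (-(r ^ 2 * ‖u‖ ^ 2 / 2))) =
        c * ENNReal.ofReal (r ^ (-(Module.finrank ℝ (W j) : ℝ) - (if j = i then τ else 0))) := by
    intro j
    refine exists_lintegral_rpow_mul_gaussian_eq (hW j) ?_
    split_ifs with hj
    · subst hj; exact hτ
    · have : (1 : ℝ) ≤ Module.finrank ℝ (W j) := by exact_mod_cast hW j
      linarith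
  choose c hc using h
  refine ⟨∏ j, c j, fun x hx => le_of_eq ?_⟩
  have hpos : ∀ j, 0 < ‖x j‖ := fun j => hx.trans_le (minNorm_le x j)
  have h1 : ∀ ξ : ∀ i, W i, ENNReal.ofReal (‖ξ i‖ ^ τ * Real.exp (-(twistSq x ξ / 2))) =
      ∏ j, ENNReal.ofReal (‖ξ j‖ ^ (if j = i then τ else 0) *
        Real.exp (-(‖x j‖ ^ 2 * ‖ξ j‖ ^ 2 / 2))) := by
    intro ξ
    rw [← ENNReal.ofReal_prod_of_nonneg fun _ _ => by positivity, Finset.prod_mul_distrib,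
      ← Real.exp_sum, Finset.sum_neg_distrib, ← Finset.sum_div]
    congr 2
    rw [← Finset.mul_prod_erase _ _ (Finset.mem_univ i), if_pos rfl,
      Finset.prod_eq_one, mul_one]
    intro j hj
    rw [if_neg (Finset.ne_of_mem_erase hj), Real.rpow_zero]
  simp_rw [h1]
  rw [volume_pi, lintegral_pi_prod_eq_prod (fun j (u : W j) =>
    ENNReal.ofReal (‖u‖ ^ (if j = i then τ else 0) * Real.exp (-(‖x j‖ ^ 2 * ‖u‖ ^ 2 / 2))))]
  · simp_rw [fun j => hc j _ (hpos j)]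
    rw [Finset.prod_mul_distrib, ← ENNReal.ofReal_prod_of_nonneg fun _ _ => by positivity]
    push_cast
    congr 2
    simp_rw [fun j => Real.rpow_sub (hpos j), Finset.prod_div_distrib, div_eq_mul_inv]
    congr 1
    rw [← Finset.mul_prod_erase _ _ (Finset.mem_univ i), if_pos rfl, Finset.prod_eq_one, mul_one,
      Real.rpow_neg (hpos i).le]
    intro j hj
    rw [if_neg (Finset.ne_of_mem_erase hj), Real.rpow_zero]
  · intro j
    have : Measurable fun u : W j => ‖u‖ ^ (if j = i then τ else 0) := measurable_norm.pow_const _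
    fun_prop

theorem measurable_twistSq (x : ∀ i, E i) : Measurable (twistSq x : (∀ i, W i) → ℝ) := by
  unfold twistSq
  exact Finset.measurable_sum _ fun i _ => by fun_prop

theorem measurable_twist_integrand (τ : ℝ) (x : ∀ i, E i) (i : ι) :
    Measurable fun ξ : ∀ i, W i =>
      ENNReal.ofReal (‖ξ i‖ ^ τ * Real.exp (-(twistSq x ξ / 2))) := by
  have h1 : Measurable fun ξ : ∀ i, W i => ‖ξ i‖ ^ τ :=
    (measurable_norm.comp (measurable_pi_apply i)).pow_const _
  have h2 := measurable_twistSq (W := W) x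
  fun_prop

/-- The Gaussian average of the weight `|ξ| ^ τ` is controlled by the Riesz-type kernel. -/
theorem exists_lintegral_weight_le [Nonempty ι] (hW : ∀ i, 1 ≤ Module.finrank ℝ (W i))
    {τ : ℝ} (hτ : ∀ i, -(Module.finrank ℝ (W i) : ℝ) < τ) :
    ∃ c : ℝ≥0, ∀ x : ∀ i, E i, 0 < minNorm x →
      ∫⁻ ξ : ∀ i, W i, ENNReal.ofReal (sqNorm ξ ^ (τ / 2) * Real.exp (-(twistSq x ξ / 2))) ≤
        c * ENNReal.ofReal (rieszKernel (fun i => (Module.finrank ℝ (W i) : ℝ)) τ x) := by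
  choose c hc using fun i => exists_lintegral_component_rpow_le (E := E) hW i (hτ i)
  -- For `τ ≥ 0` the weight is at most a multiple of the sum of the `‖ξ i‖ ^ τ`, and each `‖x i‖ ^
  -- (-τ)` is at most `minNorm x ^ (-τ)`. For `τ ≤ 0` the weight is at most `‖ξ i‖ ^ τ` for any
  -- single `i`, and the block where `‖x i‖` is minimal is the one to use.
  rcases le_total 0 τ with h0 | h0
  · refine ⟨Real.toNNReal ((Fintype.card ι : ℝ) ^ (τ / 2)) * ∑ i, c i, fun x hx => ?_⟩
    calc _ ≤ ∫⁻ ξ : ∀ i, W i, ENNReal.ofReal ((Fintype.card ι : ℝ) ^ (τ / 2)) *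
          ∑ i, ENNReal.ofReal (‖ξ i‖ ^ τ * Real.exp (-(twistSq x ξ / 2))) := by
          refine lintegral_mono fun ξ => ?_
          rw [← ENNReal.ofReal_sum_of_nonneg fun _ _ => by positivity,
            ← ENNReal.ofReal_mul (by positivity), ← Finset.sum_mul, ← mul_assoc]
          refine ENNReal.ofReal_le_ofReal ?_
          gcongr
          exact sqNorm_rpow_le h0 ξ
      _ = ENNReal.ofReal ((Fintype.card ι : ℝ) ^ (τ / 2)) * ∑ i, ∫⁻ ξ : ∀ i, W i,
          ENNReal.ofReal (‖ξ i‖ ^ τ * Real.exp (-(twistSq x ξ / 2))) := by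
          rw [lintegral_const_mul _ (Finset.measurable_sum _ fun i _ =>
            measurable_twist_integrand τ x i),
            lintegral_finsetSum _ fun i _ => measurable_twist_integrand τ x i]
      _ ≤ ENNReal.ofReal ((Fintype.card ι : ℝ) ^ (τ / 2)) * ∑ i, c i *
          ENNReal.ofReal (rieszKernel (fun i => (Module.finrank ℝ (W i) : ℝ)) τ x) := by
          gcongr with i _
          refine (hc i x hx).trans ?_
          gcongr
          refine mul_le_mul_of_nonneg_left ?_ (Finset.prod_nonneg fun _ _ => by positivity)
          exact Real.rpow_le_rpow_of_nonpos hx (minNorm_le x i) (by linarith)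
      _ = _ := by
          rw [← Finset.sum_mul, ENNReal.ofReal]
          push_cast
          ring
  · refine ⟨∑ i, c i, fun x hx => ?_⟩
    obtain ⟨i, hi⟩ := exists_minNorm_eq x
    have hWi : Nontrivial (W i) := Module.nontrivial_of_finrank_pos (R := ℝ) (hW i)
    have hae : ∀ᵐ ξ : ∀ i, W i, ξ i ≠ 0 := Measure.ae_eval_ne (μ := fun i => volume) i 0
    calc _ ≤ ∫⁻ ξ : ∀ i, W i, ENNReal.ofReal (‖ξ i‖ ^ τ * Real.exp (-(twistSq x ξ / 2))) := by
          refine lintegral_mono_ae ?_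
          filter_upwards [hae] with ξ hξ
          refine ENNReal.ofReal_le_ofReal ?_
          gcongr
          have h1 : 0 < ‖ξ i‖ := norm_pos_iff.2 hξ
          calc sqNorm ξ ^ (τ / 2) ≤ (‖ξ i‖ ^ 2) ^ (τ / 2) :=
                Real.rpow_le_rpow_of_nonpos (by positivity) (norm_sq_le_sqNorm ξ i) (by linarith)
            _ = _ := by
                rw [← Real.rpow_natCast, ← Real.rpow_mul h1.le]
                congr 1
                push_cast; ring
      _ ≤ c i * ENNReal.ofReal (rieszKernel (fun i => (Module.finrank ℝ (W i) : ℝ)) τ x) := by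
          rw [rieszKernel, hi]
          exact hc i x hx
      _ ≤ _ := by
          gcongr
          exact Finset.single_le_sum (f := c) (fun _ _ => zero_le) (Finset.mem_univ i)

variable [∀ i, InnerProductSpace ℝ (E i)]
  [∀ i, FiniteDimensional ℝ (E i)] [∀ i, MeasurableSpace (E i)] [∀ i, BorelSpace (E i)]

/-- The averaged Sobolev energy of a Frostman measure. -/
theorem exists_lintegral_energy_le [Nonempty ι] (hW : ∀ i, 1 ≤ Module.finrank ℝ (W i))
    (hWE : ∀ i, Module.finrank ℝ (W i) < Module.finrank ℝ (E i)) {a τ M : ℝ}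
    (hM : ∀ i, (Module.finrank ℝ (∀ i, E i) : ℝ) - Module.finrank ℝ (E i) +
      Module.finrank ℝ (W i) ≤ M)
    (haM : ∀ i, M - Module.finrank ℝ (W i) < a)
    (hτ : ∀ i, -(Module.finrank ℝ (W i) : ℝ) < τ) (hτa : τ < a - M) :
    ∃ (c : ℝ≥0) (F : ℝ), 0 ≤ F ∧ ∀ (R : ℝ) (C : ℝ≥0), 1 ≤ R →
      ∀ (ϖ : Measure (∀ i, E i)) [SFinite ϖ],
      (∀ x r, 0 < r → ϖ (ball x r) ≤ C * ENNReal.ofReal (r ^ a)) →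
      (∀ᵐ y ∂ϖ, ∀ᵐ x ∂ϖ, ∀ i, ‖x i - y i‖ ≤ R) →
      ∫⁻ y, ∫⁻ x, ∫⁻ ξ : ∀ i, W i, ENNReal.ofReal
        (sqNorm ξ ^ (τ / 2) * Real.exp (-(twistSq (x - y) ξ / 2))) ∂volume ∂ϖ ∂ϖ ≤
        c * ENNReal.ofReal (R ^ F) * C * ϖ Set.univ := by
  obtain ⟨c, hc⟩ := exists_lintegral_weight_le (E := E) hW hτ
  obtain ⟨c', F, hF, hc'⟩ := exists_setLIntegral_rieszKernel_le (E := E)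
    (fun i => (Module.finrank ℝ (W i) : ℝ)) (fun _ => by positivity) (a := a) (M := M) (τ := τ)
    (fun i => by exact_mod_cast hWE i) hM hτa
  refine ⟨c * c', F, hF, fun R C hR ϖ _ hϖ hy => ?_⟩
  rw [← lintegral_const]
  refine lintegral_mono_ae ?_
  filter_upwards [hy] with y hy
  -- The kernel bound says nothing where some `x i = y i`; that set is null since `D - dim (E i) ≤ M
  -- - dim (W i) < a`.
  have hnull : ∀ᵐ x ∂ϖ, 0 < minNorm (x - y) := by
    have : ∀ᵐ x ∂ϖ, ∀ i, ¬ x i = y i := by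
      rw [ae_all_iff]
      intro i
      have := measure_slice_eq_zero ϖ (by linarith) hϖ y hy i (by linarith [hM i, haM i])
      rw [ae_iff]
      simpa using this
    filter_upwards [this] with x hx
    rw [minNorm_pos_iff]
    exact fun i => sub_ne_zero.2 (hx i)
  have hms : MeasurableSet {x | 0 < minNorm (x - y)} :=
    measurableSet_lt measurable_const
      (continuous_minNorm.measurable.comp (measurable_id.sub_const y))
  calc _ = ∫⁻ x in {x | 0 < minNorm (x - y)}, ∫⁻ ξ : ∀ i, W i, ENNReal.ofReal
        (sqNorm ξ ^ (τ / 2) * Real.exp (-(twistSq (x - y) ξ / 2))) ∂volume ∂ϖ := by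
        rw [Measure.restrict_eq_self_of_ae_mem (s := {x | 0 < minNorm (x - y)}) hnull]
    _ ≤ ∫⁻ x in {x | 0 < minNorm (x - y)}, c * ENNReal.ofReal
        (rieszKernel (fun i => (Module.finrank ℝ (W i) : ℝ)) τ (x - y)) ∂ϖ :=
        setLIntegral_mono' hms fun x hx => hc _ hx
    _ = c * ∫⁻ x in {x | 0 < minNorm (x - y)}, ENNReal.ofReal
        (rieszKernel (fun i => (Module.finrank ℝ (W i) : ℝ)) τ (x - y)) ∂ϖ := by
        rw [lintegral_const_mul]
        exact ((measurable_rieszKernel _ τ).comp (measurable_id.sub_const y)).ennreal_ofReal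
    _ ≤ c * (c' * ENNReal.ofReal (R ^ F) * C) := by
        gcongr
        exact hc' R C hR ϖ hϖ y hy
    _ = _ := by push_cast; ring

end GaussianWeights

/-! ### Fourier transforms and Gaussian kernels. -/

open ComplexConjugate in
/-- Fubini for a sesquilinear expression in two oscillatory transforms. -/
theorem integral_mul_transform_mul_conj {Z X : Type*} [MeasurableSpace Z] [MeasurableSpace X]
    {lam : Measure Z} [SFinite lam] {μ ν : Measure X} [IsFiniteMeasure μ] [IsFiniteMeasure ν]
    {k : Z → ℝ} (hk : Integrable k lam) {φ : Z → X → ℂ} (hφ : Measurable (Function.uncurry φ))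
    (hφ1 : ∀ z x, ‖φ z x‖ ≤ 1) {f g : X → ℂ} (hf : Measurable f) (hg : Measurable g)
    (hf1 : ∀ x, ‖f x‖ ≤ 1) (hg1 : ∀ x, ‖g x‖ ≤ 1) :
    ∫ z, (k z : ℂ) * ((∫ x, f x * φ z x ∂μ) * conj (∫ y, g y * φ z y ∂ν)) ∂lam =
      ∫ p : X × X, f p.1 * conj (g p.2) * ∫ z, (k z : ℂ) * (φ z p.1 * conj (φ z p.2)) ∂lam
        ∂(μ.prod ν) := by
  have h1 : ∀ z, (∫ x, f x * φ z x ∂μ) * conj (∫ y, g y * φ z y ∂ν) =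
      ∫ p : X × X, (f p.1 * φ z p.1) * conj (g p.2 * φ z p.2) ∂(μ.prod ν) := by
    intro z
    rw [← integral_conj]
    exact (integral_prod_mul (fun x => f x * φ z x) fun y => conj (g y * φ z y)).symm
  simp_rw [h1, ← integral_const_mul]
  rw [integral_integral_swap]
  · refine integral_congr_ae (ae_of_all _ fun p => ?_)
    refine integral_congr_ae (ae_of_all _ fun z => ?_)
    simp only [map_mul]
    ring
  · have hk' : Integrable (fun q : Z × (X × X) => k q.1 * (1 : ℝ)) (lam.prod (μ.prod ν)) :=
      hk.mul_prod (integrable_const _)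
    refine hk'.mono ?_ (ae_of_all _ ?_)
    · have e1 : Measurable fun q : Z × (X × X) => φ q.1 q.2.1 :=
        hφ.comp (measurable_fst.prodMk (measurable_fst.comp measurable_snd))
      have e2 : Measurable fun q : Z × (X × X) => φ q.1 q.2.2 :=
        hφ.comp (measurable_fst.prodMk (measurable_snd.comp measurable_snd))
      have e3 : AEStronglyMeasurable (fun q : Z × (X × X) => (k q.1 : ℂ))
          (lam.prod (μ.prod ν)) :=
        (Complex.continuous_ofReal.comp_aestronglyMeasurable hk.1).comp_fst
      refine e3.mul (Measurable.aestronglyMeasurable ?_)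
      have e4 : Measurable fun q : Z × (X × X) => conj (g q.2.2 * φ q.1 q.2.2) :=
        Complex.continuous_conj.measurable.comp
          ((hg.comp (measurable_snd.comp measurable_snd)).mul e2)
      exact ((hf.comp (measurable_fst.comp measurable_snd)).mul e1).mul e4
    · rintro ⟨z, x, y⟩
      simp only [Function.uncurry, norm_mul, RCLike.norm_conj, mul_one, Complex.norm_real]
      refine mul_le_of_le_one_right (norm_nonneg _) ?_
      exact mul_le_one₀ (mul_le_one₀ (hf1 _) (norm_nonneg _) (hφ1 _ _)) (by positivity)
        (mul_le_one₀ (hg1 _) (norm_nonneg _) (hφ1 _ _))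

section Phase

variable {ι : Type*} [Fintype ι] {W : ι → Type*}
  [∀ i, NormedAddCommGroup (W i)] [∀ i, InnerProductSpace ℝ (W i)]

/-- The character `exp (i ⟨ξ, z⟩)`. -/
def phase (ξ z : ∀ i, W i) : ℂ := Complex.exp (((∑ i, inner ℝ (ξ i) (z i) : ℝ) : ℂ) * Complex.I)

theorem norm_phase (ξ z : ∀ i, W i) : ‖phase ξ z‖ = 1 := Complex.norm_exp_ofReal_mul_I _

open ComplexConjugate in
theorem phase_mul_conj (ξ z w : ∀ i, W i) : phase ξ z * conj (phase ξ w) = phase ξ (z - w) := by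
  unfold phase
  rw [← Complex.exp_conj, ← Complex.exp_add]
  congr 1
  simp only [map_mul, Complex.conj_ofReal, Complex.conj_I, Pi.sub_apply, inner_sub_right,
    Finset.sum_sub_distrib, Complex.ofReal_sub]
  ring

theorem continuous_phase : Continuous fun p : (∀ i, W i) × (∀ i, W i) => phase p.1 p.2 := by
  unfold phase; fun_prop

/-- The Gaussian `∫ exp (-t |ξ|² / 2) exp (i ⟨ξ, z⟩) dξ`. -/
def gaussKer (t : ℝ) (z : ∀ i, W i) : ℝ :=
  (2 * Real.pi / t) ^ ((∑ i, (Module.finrank ℝ (W i) : ℝ)) / 2) * Real.exp (-(sqNorm z / (2 * t)))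

theorem gaussKer_nonneg {t : ℝ} (ht : 0 < t) (z : ∀ i, W i) : 0 ≤ gaussKer t z := by
  unfold gaussKer; positivity

theorem gaussKer_le {t : ℝ} (ht : 0 < t) (z : ∀ i, W i) :
    gaussKer t z ≤ (2 * Real.pi / t) ^ ((∑ i, (Module.finrank ℝ (W i) : ℝ)) / 2) := by
  unfold gaussKer
  refine mul_le_of_le_one_right (by positivity) ?_
  rw [Real.exp_le_one_iff]
  have := sqNorm_nonneg z
  have : 0 ≤ sqNorm z / (2 * t) := by positivity
  linarith

theorem continuous_gaussKer (t : ℝ) : Continuous (gaussKer t : (∀ i, W i) → ℝ) := by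
  unfold gaussKer
  have := continuous_sqNorm (W := W)
  fun_prop

theorem gaussian_eq_prod (t : ℝ) (ξ : ∀ i, W i) :
    Real.exp (-(t * sqNorm ξ / 2)) = ∏ i, Real.exp (-(t / 2) * ‖ξ i‖ ^ 2) := by
  rw [← Real.exp_sum, ← Finset.mul_sum]
  congr 1
  unfold sqNorm
  ring

variable [∀ i, FiniteDimensional ℝ (W i)] [∀ i, MeasurableSpace (W i)] [∀ i, BorelSpace (W i)]

theorem integrable_gaussian {t : ℝ} (ht : 0 < t) :
    Integrable fun ξ : ∀ i, W i => Real.exp (-(t * sqNorm ξ / 2)) := by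
  simp_rw [gaussian_eq_prod t]
  refine Integrable.fintype_prod_dep (f := fun i (u : W i) => Real.exp (-(t / 2) * ‖u‖ ^ 2))
    fun i => ?_
  refine not_imp_comm.1 integral_undef ?_
  rw [GaussianFourier.integral_rexp_neg_mul_sq_norm (by positivity)]
  positivity

theorem integral_gaussian_mul_phase {t : ℝ} (ht : 0 < t) (z : ∀ i, W i) :
    ∫ ξ : ∀ i, W i, (Real.exp (-(t * sqNorm ξ / 2)) : ℂ) * phase ξ z = gaussKer t z := by
  have h1 : ∀ ξ : ∀ i, W i, (Real.exp (-(t * sqNorm ξ / 2)) : ℂ) * phase ξ z =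
      ∏ i, Complex.exp (-(t / 2 : ℂ) * ‖ξ i‖ ^ 2 + Complex.I * inner ℝ (z i) (ξ i)) := by
    intro ξ
    rw [gaussian_eq_prod, phase]
    push_cast
    rw [Finset.sum_mul, Complex.exp_sum, ← Finset.prod_mul_distrib]
    refine Finset.prod_congr rfl fun i _ => ?_
    rw [← Complex.exp_add, real_inner_comm, mul_comm Complex.I]
  simp_rw [h1]
  rw [volume_pi, integral_fintype_prod_eq_prod (fun i (u : W i) =>
    Complex.exp (-(t / 2 : ℂ) * ‖u‖ ^ 2 + Complex.I * inner ℝ (z i) u))]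
  have hb : 0 < ((t : ℂ) / 2).re := by
    have : ((t : ℂ) / 2).re = t / 2 := by norm_num
    rw [this]; positivity
  simp_rw [GaussianFourier.integral_cexp_neg_mul_sq_norm_add hb]
  have h2 : ∀ i, ((Real.pi : ℂ) / (t / 2)) ^ ((Module.finrank ℝ (W i) : ℂ) / 2) *
      Complex.exp (Complex.I ^ 2 * ‖z i‖ ^ 2 / (4 * (t / 2))) =
      (((2 * Real.pi / t) ^ ((Module.finrank ℝ (W i) : ℝ) / 2) *
        Real.exp (-(‖z i‖ ^ 2 / (2 * t))) : ℝ) : ℂ) := by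
    intro i
    rw [Complex.ofReal_mul, Complex.ofReal_cpow (by positivity), Complex.ofReal_exp]
    push_cast
    congr 2
    · field_simp
    · rw [Complex.I_sq]
      have : (t : ℂ) ≠ 0 := by exact_mod_cast ht.ne'
      field_simp
      norm_num
  simp_rw [h2]
  rw [← Complex.ofReal_prod, Finset.prod_mul_distrib, ← Real.rpow_sum_of_pos (by positivity),
    ← Real.exp_sum, gaussKer, sqNorm]
  congr 3
  · rw [Finset.sum_div]
  · rw [Finset.sum_neg_distrib, ← Finset.sum_div]

end Phase

/-! ### Fourier energies of image measures with signed densities. -/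

section Transform

variable {ι : Type*} [Fintype ι] {W : ι → Type*}
  [∀ i, NormedAddCommGroup (W i)] [∀ i, InnerProductSpace ℝ (W i)]
  {X : Type*} [MeasurableSpace X]

/-- The Fourier transform of the image of `σ ϖ` under `b`. -/
def transform (ϖ : Measure X) (b : X → ∀ i, W i) (σ : X → ℝ) (ξ : ∀ i, W i) : ℂ :=
  ∫ x, (σ x : ℂ) * phase ξ (b x) ∂ϖ

variable {ϖ μ ν : Measure X} [IsFiniteMeasure ϖ] [IsFiniteMeasure μ] [IsFiniteMeasure ν]
  {b : X → ∀ i, W i} {σ σ' : X → ℝ}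

theorem norm_transform_le (hσ : ∀ x, |σ x| ≤ 1) (ξ : ∀ i, W i) :
    ‖transform ϖ b σ ξ‖ ≤ ϖ.real Set.univ := by
  have := norm_integral_le_of_norm_le_const (μ := ϖ) (C := 1)
    (f := fun x => (σ x : ℂ) * phase ξ (b x)) (ae_of_all _ fun x => by
      rw [norm_mul, norm_phase, mul_one, Complex.norm_real]; exact hσ x)
  simpa [transform] using this

variable [∀ i, FiniteDimensional ℝ (W i)] [∀ i, MeasurableSpace (W i)] [∀ i, BorelSpace (W i)]

theorem measurable_phase_comp (hb : Measurable b) :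
    Measurable (Function.uncurry fun ξ x => phase ξ (b x)) :=
  (continuous_phase (W := W)).measurable.comp
    (measurable_fst.prodMk (hb.comp measurable_snd))

theorem measurable_transform (hb : Measurable b) (hσ : Measurable σ) :
    Measurable (transform ϖ b σ) := by
  have : StronglyMeasurable (Function.uncurry fun ξ x => (σ x : ℂ) * phase ξ (b x)) :=
    ((Complex.measurable_ofReal.comp (hσ.comp measurable_snd)).mul
      (measurable_phase_comp hb)).stronglyMeasurable
  exact this.integral_prod_right.measurable

open ComplexConjugate in
theorem integral_mul_transform_mul_conj_transform {k : (∀ i, W i) → ℝ} (hk : Integrable k)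
    (hb : Measurable b) (hσ : Measurable σ) (hσ1 : ∀ x, |σ x| ≤ 1) (hσ' : Measurable σ')
    (hσ1' : ∀ x, |σ' x| ≤ 1) :
    ∫ ξ, (k ξ : ℂ) * (transform μ b σ ξ * conj (transform ν b σ' ξ)) =
      ∫ p : X × X, (σ p.1 : ℂ) * σ' p.2 *
        (∫ ξ, (k ξ : ℂ) * phase ξ (b p.1 - b p.2)) ∂(μ.prod ν) := by
  have := integral_mul_transform_mul_conj (μ := μ) (ν := ν) hk (measurable_phase_comp hb)
    (fun ξ x => (norm_phase ξ (b x)).le) (Complex.measurable_ofReal.comp hσ)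
    (Complex.measurable_ofReal.comp hσ') (fun x => by simpa using hσ1 x)
    (fun x => by simpa using hσ1' x)
  simp only [phase_mul_conj, Function.comp_apply, Complex.conj_ofReal] at this
  exact this

theorem integral_gaussian_mul_norm_transform_sq {t : ℝ} (ht : 0 < t) (hb : Measurable b)
    (hσ : Measurable σ) (hσ1 : ∀ x, |σ x| ≤ 1) :
    ∫ ξ, Real.exp (-(t * sqNorm ξ / 2)) * ‖transform ϖ b σ ξ‖ ^ 2 =
      ∫ p : X × X, σ p.1 * σ p.2 * gaussKer t (b p.1 - b p.2) ∂(ϖ.prod ϖ) := by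
  have h := integral_mul_transform_mul_conj_transform (μ := ϖ) (ν := ϖ)
    (integrable_gaussian (W := W) ht) hb hσ hσ1 hσ hσ1
  simp_rw [integral_gaussian_mul_phase ht, Complex.mul_conj'] at h
  have h1 : ∀ p : X × X, (σ p.1 : ℂ) * σ p.2 * gaussKer t (b p.1 - b p.2) =
      ((σ p.1 * σ p.2 * gaussKer t (b p.1 - b p.2) : ℝ) : ℂ) := fun p => by push_cast; rfl
  have h2 : ∀ ξ, (Real.exp (-(t * sqNorm ξ / 2)) : ℂ) * (‖transform ϖ b σ ξ‖ : ℂ) ^ 2 =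
      ((Real.exp (-(t * sqNorm ξ / 2)) * ‖transform ϖ b σ ξ‖ ^ 2 : ℝ) : ℂ) :=
    fun ξ => by push_cast; rfl
  simp_rw [h1, h2] at h
  rw [integral_complex_ofReal, integral_complex_ofReal] at h
  exact_mod_cast h

theorem integrable_gaussian_mul_norm_transform_sq {t : ℝ} (ht : 0 < t) (hb : Measurable b)
    (hσ : Measurable σ) (hσ1 : ∀ x, |σ x| ≤ 1) :
    Integrable fun ξ => Real.exp (-(t * sqNorm ξ / 2)) * ‖transform ϖ b σ ξ‖ ^ 2 := by
  refine ((integrable_gaussian (W := W) ht).mul_const (ϖ.real Set.univ ^ 2)).mono' ?_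
    (ae_of_all _ fun ξ => ?_)
  · have := measurable_transform (ϖ := ϖ) hb hσ
    have := (continuous_sqNorm (W := W)).measurable
    fun_prop
  · rw [Real.norm_of_nonneg (by positivity)]
    gcongr
    exact norm_transform_le hσ1 ξ

/-- A bounded signed density does not increase Gaussian energies. -/
theorem lintegral_gaussian_transform_le {t : ℝ} (ht : 0 < t) (hb : Measurable b)
    (hσ : Measurable σ) (hσ1 : ∀ x, |σ x| ≤ 1) :
    ∫⁻ ξ, ENNReal.ofReal (Real.exp (-(t * sqNorm ξ / 2))) * ‖transform ϖ b σ ξ‖ₑ ^ 2 ≤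
      ∫⁻ ξ, ENNReal.ofReal (Real.exp (-(t * sqNorm ξ / 2))) *
        ‖transform ϖ b (fun _ => 1) ξ‖ₑ ^ 2 := by
  -- The energy is a double integral of `τ x * τ y` against the nonnegative kernel `gaussKer`, so
  -- replacing `τ` by `1` increases it pointwise.
  have key : ∀ τ : X → ℝ, Measurable τ → (∀ x, |τ x| ≤ 1) →
      ∫⁻ ξ, ENNReal.ofReal (Real.exp (-(t * sqNorm ξ / 2))) * ‖transform ϖ b τ ξ‖ₑ ^ 2 =
      ENNReal.ofReal (∫ p : X × X, τ p.1 * τ p.2 * gaussKer t (b p.1 - b p.2) ∂(ϖ.prod ϖ)) := by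
    intro τ hτ hτ1
    rw [← integral_gaussian_mul_norm_transform_sq ht hb hτ hτ1,
      ofReal_integral_eq_lintegral_ofReal
        (integrable_gaussian_mul_norm_transform_sq ht hb hτ hτ1)
        (ae_of_all _ fun ξ => by positivity)]
    refine lintegral_congr fun ξ => ?_
    rw [ENNReal.ofReal_mul (by positivity), ENNReal.ofReal_pow (norm_nonneg _), ofReal_norm]
  rw [key σ hσ hσ1, key _ measurable_const fun _ => by simp]
  refine ENNReal.ofReal_le_ofReal ?_
  have hint : ∀ τ : X → ℝ, Measurable τ → (∀ x, |τ x| ≤ 1) →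
      Integrable (fun p : X × X => τ p.1 * τ p.2 * gaussKer t (b p.1 - b p.2)) (ϖ.prod ϖ) := by
    intro τ hτ hτ1
    refine Integrable.mono' (integrable_const
      ((2 * Real.pi / t) ^ ((∑ i, (Module.finrank ℝ (W i) : ℝ)) / 2))) ?_
      (ae_of_all _ fun p => ?_)
    · have h1 : Measurable fun p : X × X => gaussKer t (b p.1 - b p.2) :=
        (continuous_gaussKer t).measurable.comp
          ((hb.comp measurable_fst).sub (hb.comp measurable_snd))
      exact (((hτ.comp measurable_fst).mul (hτ.comp measurable_snd)).mul h1).aestronglyMeasurable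
    · rw [norm_mul, norm_mul, Real.norm_of_nonneg (gaussKer_nonneg ht _)]
      refine (mul_le_of_le_one_left (gaussKer_nonneg ht _) ?_).trans (gaussKer_le ht _)
      exact mul_le_one₀ (hτ1 _) (norm_nonneg _) (hτ1 _)
  refine integral_mono (hint σ hσ hσ1) (hint _ measurable_const fun _ => by simp) fun p => ?_
  refine mul_le_mul_of_nonneg_right ?_ (gaussKer_nonneg ht _)
  rw [mul_one]
  refine (le_abs_self _).trans ?_
  rw [abs_mul]
  exact mul_le_one₀ (hσ1 _) (abs_nonneg _) (hσ1 _)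

/-- Subordination: by the Gamma integral a negative power is a positive superposition of the
Gaussians `exp (-(t q / 2))`, and the extra Gaussian shifts `t` to `s + t`. -/
theorem ofReal_rpow_mul_gaussian_eq {γ s q : ℝ} (hγ : 0 < γ) (hq : 0 < q) :
    ENNReal.ofReal (q ^ (-γ) * Real.exp (-(s * q / 2))) =
      ENNReal.ofReal ((2 ^ γ * Real.Gamma γ)⁻¹) * ∫⁻ t in Set.Ioi (0 : ℝ),
        ENNReal.ofReal (t ^ (γ - 1)) * ENNReal.ofReal (Real.exp (-((s + t) * q / 2))) := by
  have hG := Real.Gamma_pos_of_pos hγ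
  have h := Real.integral_rpow_mul_exp_neg_mul_Ioi hγ (r := q / 2) (by positivity)
  have hint : IntegrableOn (fun t : ℝ => t ^ (γ - 1) * Real.exp (-(q / 2 * t))) (Set.Ioi 0) := by
    refine not_imp_comm.1 integral_undef ?_
    rw [h]; positivity
  have h2 := ofReal_integral_eq_lintegral_ofReal hint
    ((ae_restrict_iff' measurableSet_Ioi).2 (ae_of_all _ fun t (ht : 0 < t) => by positivity))
  have h3 : ∫⁻ t in Set.Ioi (0 : ℝ),
      ENNReal.ofReal (t ^ (γ - 1)) * ENNReal.ofReal (Real.exp (-((s + t) * q / 2))) =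
      ENNReal.ofReal (Real.exp (-(s * q / 2))) * ENNReal.ofReal ((1 / (q / 2)) ^ γ *
        Real.Gamma γ) := by
    rw [← h, h2, ← lintegral_const_mul' _ _ (by simp)]
    refine setLIntegral_congr_fun measurableSet_Ioi fun t (ht : 0 < t) => ?_
    rw [← ENNReal.ofReal_mul (by positivity), ← ENNReal.ofReal_mul (by positivity),
      mul_left_comm, ← Real.exp_add]
    congr 3
    ring
  rw [h3, ← ENNReal.ofReal_mul (by positivity), ← ENNReal.ofReal_mul (by positivity)]
  congr 1
  rw [one_div, inv_div, Real.div_rpow (by norm_num) hq.le, Real.rpow_neg hq.le]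
  field_simp

/-- Negative powers are positive superpositions of Gaussians, so the domination passes from
`lintegral_gaussian_transform_le` to them. This is what makes it harmless to test increments against
their sign. The origin, where subordination fails, is null because the space is nontrivial. -/
theorem lintegral_rpow_gaussian_transform_le [Nontrivial (∀ i, W i)] {γ s : ℝ} (hγ : 0 < γ)
    (hs : 0 < s) (hb : Measurable b) (hσ : Measurable σ) (hσ1 : ∀ x, |σ x| ≤ 1) :
    ∫⁻ ξ, ENNReal.ofReal (sqNorm ξ ^ (-γ) * Real.exp (-(s * sqNorm ξ / 2))) *
        ‖transform ϖ b σ ξ‖ₑ ^ 2 ≤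
      ∫⁻ ξ, ENNReal.ofReal (sqNorm ξ ^ (-γ) * Real.exp (-(s * sqNorm ξ / 2))) *
        ‖transform ϖ b (fun _ => 1) ξ‖ₑ ^ 2 := by
  have hpos : ∀ᵐ ξ : ∀ i, W i, 0 < sqNorm ξ := by
    filter_upwards [Measure.ae_ne volume (0 : ∀ i, W i)] with ξ hξ
    obtain ⟨i, hi⟩ := Function.ne_iff.1 hξ
    have h1 : 0 < ‖ξ i‖ := norm_pos_iff.2 hi
    exact lt_of_lt_of_le (by positivity) (norm_sq_le_sqNorm ξ i)
  have key : ∀ τ : X → ℝ, Measurable τ →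
      ∫⁻ ξ, ENNReal.ofReal (sqNorm ξ ^ (-γ) * Real.exp (-(s * sqNorm ξ / 2))) *
        ‖transform ϖ b τ ξ‖ₑ ^ 2 =
      ENNReal.ofReal ((2 ^ γ * Real.Gamma γ)⁻¹) * ∫⁻ t in Set.Ioi (0 : ℝ),
        ENNReal.ofReal (t ^ (γ - 1)) * ∫⁻ ξ,
          ENNReal.ofReal (Real.exp (-((s + t) * sqNorm ξ / 2))) * ‖transform ϖ b τ ξ‖ₑ ^ 2 := by
    intro τ hτ
    have hmt : Measurable fun ξ => ‖transform ϖ b τ ξ‖ₑ ^ 2 :=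
      (measurable_transform hb hτ).enorm.pow_const 2
    have hmq := (continuous_sqNorm (W := W)).measurable
    have hm1 : Measurable fun t : ℝ => ENNReal.ofReal (t ^ (γ - 1)) :=
      (measurable_id.pow_const (γ - 1)).ennreal_ofReal
    have hm2 : Measurable fun p : (∀ i, W i) × ℝ => ENNReal.ofReal (p.2 ^ (γ - 1)) *
        (ENNReal.ofReal (Real.exp (-((s + p.2) * sqNorm p.1 / 2))) *
          ‖transform ϖ b τ p.1‖ₑ ^ 2) := by
      refine (hm1.comp measurable_snd).mul (Measurable.mul ?_ (hmt.comp measurable_fst))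
      have h : Measurable fun p : (∀ i, W i) × ℝ => sqNorm p.1 := hmq.comp measurable_fst
      fun_prop
    calc _ = ∫⁻ ξ, ENNReal.ofReal ((2 ^ γ * Real.Gamma γ)⁻¹) * ∫⁻ t in Set.Ioi (0 : ℝ),
          ENNReal.ofReal (t ^ (γ - 1)) * (ENNReal.ofReal (Real.exp (-((s + t) * sqNorm ξ / 2))) *
            ‖transform ϖ b τ ξ‖ₑ ^ 2) := by
          refine lintegral_congr_ae ?_
          filter_upwards [hpos] with ξ hξ
          rw [ofReal_rpow_mul_gaussian_eq hγ hξ, mul_assoc, ← lintegral_mul_const']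
          · simp_rw [mul_assoc]
          · simp
      _ = ENNReal.ofReal ((2 ^ γ * Real.Gamma γ)⁻¹) * ∫⁻ ξ, ∫⁻ t in Set.Ioi (0 : ℝ),
          ENNReal.ofReal (t ^ (γ - 1)) * (ENNReal.ofReal (Real.exp (-((s + t) * sqNorm ξ / 2))) *
            ‖transform ϖ b τ ξ‖ₑ ^ 2) := lintegral_const_mul' _ _ (by simp)
      _ = _ := by
          congr 1
          rw [lintegral_lintegral_swap hm2.aemeasurable]
          refine lintegral_congr fun t => ?_
          rw [lintegral_const_mul' _ _ (by simp)]
  rw [key σ hσ, key _ measurable_const]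
  refine mul_le_mul_right (setLIntegral_mono' measurableSet_Ioi fun t (ht : 0 < t) => ?_) _
  exact mul_le_mul_right (lintegral_gaussian_transform_le (by linarith) hb hσ hσ1) _

end Transform

/-! ### Increments between consecutive scales. -/

section Increment

variable {ι : Type*} [Fintype ι] {W : ι → Type*}
  [∀ i, NormedAddCommGroup (W i)] [∀ i, InnerProductSpace ℝ (W i)]
  [∀ i, FiniteDimensional ℝ (W i)] [∀ i, MeasurableSpace (W i)] [∀ i, BorelSpace (W i)]
  {X : Type*} [MeasurableSpace X] {Ω : Type*} [MeasurableSpace Ω]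

/-- The difference at `b y` of the mollifications of `b μ` at the scales `√s` and `√(2 s)`. -/
def increment (s : ℝ) (b : X → ∀ i, W i) (μ : Measure X) (y : X) : ℝ :=
  ∫ x, (gaussKer s (b x - b y) - gaussKer (2 * s) (b x - b y)) ∂μ

theorem measurable_transform_param {ϖ : Measure X} [SFinite ϖ] {B : Ω → X → ∀ i, W i}
    (hB : Measurable (Function.uncurry B)) {σ : Ω → X → ℝ} (hσ : Measurable (Function.uncurry σ)) :
    Measurable fun p : Ω × (∀ i, W i) => transform ϖ (B p.1) (σ p.1) p.2 := by
  have h1 : Measurable fun q : (Ω × (∀ i, W i)) × X => (q.1.1, q.2) :=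
    (measurable_fst.comp measurable_fst).prodMk measurable_snd
  have h2 : Measurable fun q : (Ω × (∀ i, W i)) × X => phase q.1.2 (B q.1.1 q.2) :=
    (continuous_phase (W := W)).measurable.comp
      ((measurable_snd.comp measurable_fst).prodMk (hB.comp h1))
  have h3 : Measurable fun q : (Ω × (∀ i, W i)) × X => (σ q.1.1 q.2 : ℂ) :=
    Complex.measurable_ofReal.comp (hσ.comp h1)
  have : StronglyMeasurable (Function.uncurry fun (p : Ω × (∀ i, W i)) (x : X) =>
      (σ p.1 x : ℂ) * phase p.2 (B p.1 x)) := (h3.mul h2).stronglyMeasurable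
  exact this.integral_prod_right.measurable

theorem measurable_increment {μ : Measure X} [SFinite μ] {B : Ω → X → ∀ i, W i}
    (hB : Measurable (Function.uncurry B)) (s : ℝ) :
    Measurable (Function.uncurry fun ω y => increment s (B ω) μ y) := by
  have h1 : Measurable fun q : (Ω × X) × X => B q.1.1 q.2 - B q.1.1 q.1.2 :=
    (hB.comp ((measurable_fst.comp measurable_fst).prodMk measurable_snd)).sub
      (hB.comp ((measurable_fst.comp measurable_fst).prodMk
        (measurable_snd.comp measurable_fst)))
  have : StronglyMeasurable (Function.uncurry fun (p : Ω × X) (x : X) =>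
      gaussKer s (B p.1 x - B p.1 p.2) - gaussKer (2 * s) (B p.1 x - B p.1 p.2)) :=
    (((continuous_gaussKer s).measurable.comp h1).sub
      ((continuous_gaussKer (2 * s)).measurable.comp h1)).stronglyMeasurable
  exact this.integral_prod_right.measurable

theorem integral_gaussian_sub_mul_phase {s : ℝ} (hs : 0 < s) (z : ∀ i, W i) :
    ∫ ξ : ∀ i, W i, ((Real.exp (-(s * sqNorm ξ / 2)) - Real.exp (-(2 * s * sqNorm ξ / 2)) : ℝ) : ℂ)
      * phase ξ z = ((gaussKer s z - gaussKer (2 * s) z : ℝ) : ℂ) := by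
  have hI : ∀ t : ℝ, 0 < t → Integrable fun ξ : ∀ i, W i =>
      (Real.exp (-(t * sqNorm ξ / 2)) : ℂ) * phase ξ z := by
    intro t ht
    have h0 : Integrable fun ξ : ∀ i, W i => (Real.exp (-(t * sqNorm ξ / 2)) : ℂ) :=
      (integrable_gaussian (W := W) ht).ofReal
    refine h0.mono ?_ (ae_of_all _ fun ξ => ?_)
    · refine (integrable_gaussian (W := W) ht).ofReal.1.mul ?_
      exact ((continuous_phase (W := W)).comp (continuous_id.prodMk
        continuous_const)).aestronglyMeasurable
    · rw [norm_mul, norm_phase, mul_one]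
  have hs2 : 0 < 2 * s := by linarith
  rw [Complex.ofReal_sub, ← integral_gaussian_mul_phase hs, ← integral_gaussian_mul_phase hs2,
    ← integral_sub (hI s hs) (hI _ hs2)]
  refine integral_congr_ae (ae_of_all _ fun ξ => ?_)
  simp only
  rw [Complex.ofReal_sub, sub_mul]

/-- Both values lie between `0` and the peak of the narrower kernel. -/
theorem abs_gaussKer_sub_le {s : ℝ} (hs : 0 < s) (z : ∀ i, W i) :
    |gaussKer s z - gaussKer (2 * s) z| ≤
      (2 * Real.pi / s) ^ ((∑ i, (Module.finrank ℝ (W i) : ℝ)) / 2) := by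
  have h2 : gaussKer (2 * s) z ≤ (2 * Real.pi / s) ^ ((∑ i, (Module.finrank ℝ (W i) : ℝ)) / 2) := by
    refine (gaussKer_le (by linarith) z).trans ?_
    refine Real.rpow_le_rpow (by positivity) ?_ (by positivity)
    gcongr
    linarith
  exact abs_sub_le_of_nonneg_of_le (gaussKer_nonneg hs z) (gaussKer_le hs z)
    (gaussKer_nonneg (by linarith) z) h2

theorem abs_increment_le {s : ℝ} (hs : 0 < s) (b : X → ∀ i, W i) (μ : Measure X)
    [IsFiniteMeasure μ] (y : X) :
    |increment s b μ y| ≤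
      (2 * Real.pi / s) ^ ((∑ i, (Module.finrank ℝ (W i) : ℝ)) / 2) * μ.real Set.univ := by
  have := norm_integral_le_of_norm_le_const (μ := μ)
    (f := fun x => gaussKer s (b x - b y) - gaussKer (2 * s) (b x - b y))
    (ae_of_all _ fun x => abs_gaussKer_sub_le hs _)
  simpa [increment] using this

open Classical in
/-- The sign of the increment, with values `±1`. -/
def incrementSign (s : ℝ) (b : X → ∀ i, W i) (μ : Measure X) (y : X) : ℝ :=
  if 0 ≤ increment s b μ y then 1 else -1

theorem abs_incrementSign (s : ℝ) (b : X → ∀ i, W i) (μ : Measure X) (y : X) :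
    |incrementSign s b μ y| ≤ 1 := by
  unfold incrementSign; split_ifs <;> simp

theorem measurable_incrementSign {μ : Measure X} [SFinite μ] {B : Ω → X → ∀ i, W i}
    (hB : Measurable (Function.uncurry B)) (s : ℝ) :
    Measurable (Function.uncurry fun ω y => incrementSign s (B ω) μ y) :=
  Measurable.ite (measurableSet_le measurable_const (measurable_increment hB s))
    measurable_const measurable_const

-- Writing the absolute value as the increment times its sign makes the left side bilinear in `μ`
-- and a signed measure. The multiplier on the right is the frequency profile of the difference of
-- the two Gaussian kernels, and the rest is Fubini.
open ComplexConjugate in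
theorem integral_abs_increment {μ ν : Measure X} [IsFiniteMeasure μ] [IsFiniteMeasure ν]
    {b : X → ∀ i, W i} (hb : Measurable b) {s : ℝ} (hs : 0 < s) :
    ((∫ y, |increment s b μ y| ∂ν : ℝ) : ℂ) =
      ∫ ξ : ∀ i, W i, ((Real.exp (-(s * sqNorm ξ / 2)) - Real.exp (-(2 * s * sqNorm ξ / 2)) : ℝ) : ℂ)
        * (transform μ b (fun _ => 1) ξ * conj (transform ν b (incrementSign s b μ) ξ)) := by
  have hBm : Measurable (Function.uncurry fun _ : Unit => b) := hb.comp measurable_snd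
  have hms : Measurable (incrementSign s b μ) :=
    (measurable_incrementSign (μ := μ) hBm s).of_uncurry_left (x := ())
  have hs2 : 0 < 2 * s := by linarith
  have hT := integral_mul_transform_mul_conj_transform (μ := μ) (ν := ν) (b := b)
    (k := fun ξ => Real.exp (-(s * sqNorm ξ / 2)) - Real.exp (-(2 * s * sqNorm ξ / 2)))
    (σ := fun _ => 1) (σ' := incrementSign s b μ)
    ((integrable_gaussian hs).sub (integrable_gaussian hs2)) hb measurable_const (by simp) hms
    (abs_incrementSign s b μ)
  refine Eq.trans ?_ hT.symm
  simp_rw [integral_gaussian_sub_mul_phase hs]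
  have e1 : ∀ p : X × X, ((1 : ℝ) : ℂ) * (incrementSign s b μ p.2 : ℂ) *
      ((gaussKer s (b p.1 - b p.2) - gaussKer (2 * s) (b p.1 - b p.2) : ℝ) : ℂ) =
      ((incrementSign s b μ p.2 *
        (gaussKer s (b p.1 - b p.2) - gaussKer (2 * s) (b p.1 - b p.2)) : ℝ) : ℂ) := by
    intro p; push_cast; ring
  simp_rw [e1]
  rw [integral_complex_ofReal]
  congr 1
  rw [integral_prod_symm]
  · refine integral_congr_ae (ae_of_all _ fun y => ?_)
    simp only
    rw [integral_const_mul]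
    change _ = _ * increment s b μ y
    unfold incrementSign
    split_ifs with h
    · rw [abs_of_nonneg h, one_mul]
    · rw [abs_of_neg (not_le.1 h), neg_one_mul]
  · refine Integrable.mono' (integrable_const
      ((2 * Real.pi / s) ^ ((∑ i, (Module.finrank ℝ (W i) : ℝ)) / 2)))
      (Measurable.aestronglyMeasurable ?_) (ae_of_all _ fun p => ?_)
    · have h1 : Measurable fun p : X × X => b p.1 - b p.2 :=
        (hb.comp measurable_fst).sub (hb.comp measurable_snd)
      exact (hms.comp measurable_snd).mul (((continuous_gaussKer s).measurable.comp h1).sub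
        ((continuous_gaussKer (2 * s)).measurable.comp h1))
    · rw [norm_mul]
      exact (mul_le_of_le_one_left (norm_nonneg _) (abs_incrementSign s b μ _)).trans
        (abs_gaussKer_sub_le hs _)

open ComplexConjugate in
theorem lintegral_increment_le {μ ν : Measure X} [IsFiniteMeasure μ] [IsFiniteMeasure ν]
    {b : X → ∀ i, W i} (hb : Measurable b) {s : ℝ} (hs : 0 < s) :
    ∫⁻ y, ‖increment s b μ y‖ₑ ∂ν ≤
      ∫⁻ ξ, ENNReal.ofReal (Real.exp (-(s * sqNorm ξ / 2)) - Real.exp (-(2 * s * sqNorm ξ / 2))) *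
        (‖transform μ b (fun _ => 1) ξ‖ₑ * ‖transform ν b (incrementSign s b μ) ξ‖ₑ) := by
  have hBm : Measurable (Function.uncurry fun _ : Unit => b) := hb.comp measurable_snd
  have hm : Measurable (increment s b μ) :=
    (measurable_increment (μ := μ) hBm s).of_uncurry_left (x := ())
  have hms : Measurable (incrementSign s b μ) :=
    (measurable_incrementSign (μ := μ) hBm s).of_uncurry_left (x := ())
  have hs2 : 0 < 2 * s := by linarith
  have hint : Integrable (increment s b μ) ν :=
    Integrable.mono' (integrable_const _) hm.aestronglyMeasurable
      (ae_of_all _ fun y => abs_increment_le hs b μ y)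
  have h1 := integral_abs_increment (μ := μ) (ν := ν) hb hs
  calc ∫⁻ y, ‖increment s b μ y‖ₑ ∂ν = ENNReal.ofReal (∫ y, |increment s b μ y| ∂ν) := by
        rw [ofReal_integral_eq_lintegral_ofReal hint.abs (ae_of_all _ fun _ => abs_nonneg _)]
        refine lintegral_congr fun y => ?_
        rw [← Real.norm_eq_abs, ofReal_norm]
    _ = ‖((∫ y, |increment s b μ y| ∂ν : ℝ) : ℂ)‖ₑ := by
        rw [← ofReal_norm, Complex.norm_real,
          Real.norm_of_nonneg (integral_nonneg fun _ => abs_nonneg _)]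
    _ ≤ _ := by
        rw [h1]
        refine (enorm_integral_le_lintegral_enorm _).trans (le_of_eq (lintegral_congr fun ξ => ?_))
        rw [enorm_mul, enorm_mul]
        congr 1
        · rw [← ofReal_norm, Complex.norm_real, Real.norm_of_nonneg]
          have := sqNorm_nonneg ξ
          rw [sub_nonneg, Real.exp_le_exp]
          nlinarith
        · rw [← ofReal_norm (conj _), RCLike.norm_conj, ofReal_norm]

theorem one_sub_exp_neg_le_rpow {x ε : ℝ} (hx : 0 < x) (h0 : 0 ≤ ε) (h1 : ε ≤ 1) :
    1 - Real.exp (-x) ≤ x ^ ε := by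
  rcases le_total 1 x with h | h
  · have := Real.one_le_rpow h h0
    linarith [Real.exp_pos (-x)]
  · have h2 := Real.rpow_le_rpow_of_exponent_ge hx h h1
    rw [Real.rpow_one] at h2
    linarith [Real.add_one_le_exp (-x)]

/-- This prepares Cauchy–Schwarz: the first factor goes to `μ`, the second to `ν`, and the gain `s ^
ε` comes from `1 - exp (-x) ≤ x ^ ε`. Half of the Gaussian exponent is kept, so that the square of
the second factor is `q ^ (-γ) * exp (-(s q / 2))`, the weight for which signs can be removed. -/
theorem gaussian_sub_le {q s γ ε : ℝ} (hq : 0 < q) (hs : 0 < s) (h0 : 0 ≤ ε) (h1 : ε ≤ 1) :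
    Real.exp (-(s * q / 2)) - Real.exp (-(2 * s * q / 2)) ≤
      ((s / 2) ^ ε * q ^ (γ / 2 + ε)) * (q ^ (-γ / 2) * Real.exp (-(s * q / 4))) := by
  have e1 : Real.exp (-(s * q / 2)) - Real.exp (-(2 * s * q / 2)) =
      Real.exp (-(s * q / 2)) * (1 - Real.exp (-(s * q / 2))) := by
    rw [mul_sub, mul_one, ← Real.exp_add]
    congr 2
    ring
  have e2 : ((s / 2) ^ ε * q ^ (γ / 2 + ε)) * (q ^ (-γ / 2) * Real.exp (-(s * q / 4))) =
      Real.exp (-(s * q / 4)) * (s * q / 2) ^ ε := by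
    rw [show s * q / 2 = s / 2 * q by ring, Real.mul_rpow (by positivity) hq.le,
      show γ / 2 + ε = ε - (-γ / 2) by ring, Real.rpow_sub hq]
    field_simp
  rw [e1, e2]
  have h3 := one_sub_exp_neg_le_rpow (x := s * q / 2) (by positivity) h0 h1
  have h4 : Real.exp (-(s * q / 2)) ≤ 1 := by
    rw [Real.exp_le_one_iff]
    have : 0 ≤ s * q / 2 := by positivity
    linarith
  refine mul_le_mul ?_ h3 (by linarith) (Real.exp_pos _).le
  rw [Real.exp_le_exp]
  have : 0 ≤ s * q := by positivity
  linarith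

end Increment

/-! ### Gaussian random maps and averaged energies. -/

section GaussianFamily

variable {ι : Type*} [Fintype ι] {W : ι → Type*}
  [∀ i, NormedAddCommGroup (W i)] [∀ i, InnerProductSpace ℝ (W i)]
  [∀ i, FiniteDimensional ℝ (W i)] [∀ i, MeasurableSpace (W i)] [∀ i, BorelSpace (W i)]
  {E : ι → Type*} [∀ i, NormedAddCommGroup (E i)] [∀ i, InnerProductSpace ℝ (E i)]
  [∀ i, FiniteDimensional ℝ (E i)] [∀ i, MeasurableSpace (E i)] [∀ i, BorelSpace (E i)]
  {Ω : Type*} [MeasurableSpace Ω]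

/-- A random additive map from `∏ E i` to `∏ W i` such that the image of each `x` has
independent centred Gaussian components with covariances `|x i|²`. -/
structure IsGaussianFamily (P : Measure Ω) (B : Ω → (∀ i, E i) → ∀ i, W i) : Prop where
  measurable : Measurable (Function.uncurry B)
  map_sub : ∀ ω x y, B ω (x - y) = B ω x - B ω y
  integral_phase : ∀ x ξ, ∫ ω, phase ξ (B ω x) ∂P = (Real.exp (-(twistSq x ξ / 2)) : ℂ)

variable {P : Measure Ω} [IsProbabilityMeasure P] {B : Ω → (∀ i, E i) → ∀ i, W i}

theorem measurable_twistSq_sub :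
    Measurable fun q : (∀ i, W i) × ((∀ i, E i) × (∀ i, E i)) =>
      twistSq (q.2.1 - q.2.2) q.1 := by
  refine Finset.measurable_sum _ fun i _ => ?_
  have h1 : Measurable fun q : (∀ i, W i) × ((∀ i, E i) × (∀ i, E i)) => ‖q.2.1 i - q.2.2 i‖ :=
    measurable_norm.comp (((measurable_pi_apply i).comp (measurable_fst.comp measurable_snd)).sub
      ((measurable_pi_apply i).comp (measurable_snd.comp measurable_snd)))
  have h2 : Measurable fun q : (∀ i, W i) × ((∀ i, E i) × (∀ i, E i)) => ‖q.1 i‖ :=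
    measurable_norm.comp ((measurable_pi_apply i).comp measurable_fst)
  exact (h1.pow_const 2).mul (h2.pow_const 2)

attribute [local irreducible] twistSq

theorem measurable_transform_one {B : Ω → (∀ i, E i) → ∀ i, W i}
    (hB : Measurable (Function.uncurry B)) (ϖ : Measure (∀ i, E i)) [SFinite ϖ] (ξ : ∀ i, W i) :
    Measurable fun ω => transform ϖ (B ω) (fun _ => 1) ξ := by
  have h0 := measurable_transform_param (ϖ := ϖ) hB (σ := fun _ _ => 1) measurable_const
  have h1 : Measurable fun ω : Ω => (ω, ξ) := measurable_prodMk_right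
  simpa only [Function.comp_def] using Measurable.comp h0 h1

-- Expanding the square produces `phase ξ (B x - B y) = phase ξ (B (x - y))`. By additivity only the
-- law of `B` at the single point `x - y` enters, never a joint law.
open ComplexConjugate in
theorem IsGaussianFamily.lintegral_enorm_transform_sq (hB : IsGaussianFamily P B)
    (ϖ : Measure (∀ i, E i)) [IsFiniteMeasure ϖ] (ξ : ∀ i, W i) :
    ∫⁻ ω, ‖transform ϖ (B ω) (fun _ => 1) ξ‖ₑ ^ 2 ∂P =
      ∫⁻ p : (∀ i, E i) × (∀ i, E i),
        ENNReal.ofReal (Real.exp (-(twistSq (p.1 - p.2) ξ / 2))) ∂(ϖ.prod ϖ) := by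
  have hφ : Measurable (Function.uncurry fun ω x => phase ξ (B ω x)) :=
    (continuous_phase (W := W)).measurable.comp (measurable_const.prodMk hB.measurable)
  have h := integral_mul_transform_mul_conj (lam := P) (μ := ϖ) (ν := ϖ) (k := fun _ => 1)
    (integrable_const _) hφ (fun ω x => (norm_phase _ _).le) (f := fun _ => 1) (g := fun _ => 1)
    measurable_const measurable_const (by simp) (by simp)
  simp only [Complex.ofReal_one, one_mul, map_one, phase_mul_conj, ← hB.map_sub,
    hB.integral_phase] at h
  have hT : ∀ ω, ∫ x, phase ξ (B ω x) ∂ϖ = transform ϖ (B ω) (fun _ => 1) ξ := by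
    intro ω; simp [transform]
  simp_rw [hT, Complex.mul_conj', ← Complex.ofReal_pow] at h
  rw [integral_complex_ofReal, integral_complex_ofReal, Complex.ofReal_inj] at h
  have hmT := measurable_transform_one hB.measurable ϖ ξ
  have hi1 : Integrable (fun ω => ‖transform ϖ (B ω) (fun _ => 1) ξ‖ ^ 2) P := by
    refine Integrable.mono' (integrable_const (ϖ.real Set.univ ^ 2))
      (hmT.norm.pow_const 2).aestronglyMeasurable (ae_of_all _ fun ω => ?_)
    rw [Real.norm_of_nonneg (by positivity)]
    gcongr
    exact norm_transform_le (by simp) ξ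
  have hi2 : Integrable (fun p : (∀ i, E i) × (∀ i, E i) =>
      Real.exp (-(twistSq (p.1 - p.2) ξ / 2))) (ϖ.prod ϖ) := by
    refine Integrable.mono' (integrable_const 1) (Measurable.aestronglyMeasurable ?_)
      (ae_of_all _ fun p => ?_)
    · have : Measurable fun p : (∀ i, E i) × (∀ i, E i) => twistSq (p.1 - p.2) ξ :=
        (measurable_twistSq_sub (W := W) (E := E)).comp measurable_prodMk_left
      fun_prop
    · rw [Real.norm_of_nonneg (Real.exp_pos _).le, Real.exp_le_one_iff]
      have : 0 ≤ twistSq (p.1 - p.2) ξ := by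
        rw [twistSq]
        exact Finset.sum_nonneg fun _ _ => by positivity
      linarith
  rw [← ofReal_integral_eq_lintegral_ofReal hi2 (ae_of_all _ fun _ => (Real.exp_pos _).le), ← h,
    ofReal_integral_eq_lintegral_ofReal hi1 (ae_of_all _ fun _ => by positivity)]
  refine lintegral_congr fun ω => ?_
  rw [ENNReal.ofReal_pow (norm_nonneg _), ofReal_norm]

theorem IsGaussianFamily.lintegral_energy (hB : IsGaussianFamily P B)
    (ϖ : Measure (∀ i, E i)) [IsFiniteMeasure ϖ] {w : (∀ i, W i) → ℝ} (hw : Measurable w)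
    (hw0 : ∀ ξ, 0 ≤ w ξ) :
    ∫⁻ ω, ∫⁻ ξ, ENNReal.ofReal (w ξ) * ‖transform ϖ (B ω) (fun _ => 1) ξ‖ₑ ^ 2 ∂volume ∂P =
      ∫⁻ y, ∫⁻ x, ∫⁻ ξ, ENNReal.ofReal (w ξ * Real.exp (-(twistSq (x - y) ξ / 2)))
        ∂volume ∂ϖ ∂ϖ := by
  have hm1 : Measurable fun p : Ω × (∀ i, W i) => ENNReal.ofReal (w p.2) *
      ‖transform ϖ (B p.1) (fun _ => 1) p.2‖ₑ ^ 2 :=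
    (hw.comp measurable_snd).ennreal_ofReal.mul ((measurable_transform_param (ϖ := ϖ)
      hB.measurable (σ := fun _ _ => 1) measurable_const).enorm.pow_const 2)
  have hm2 : Measurable fun q : (∀ i, W i) × ((∀ i, E i) × (∀ i, E i)) =>
      ENNReal.ofReal (w q.1 * Real.exp (-(twistSq (q.2.1 - q.2.2) q.1 / 2))) := by
    have h1 := measurable_twistSq_sub (W := W) (E := E)
    have h2 : Measurable fun q : (∀ i, W i) × ((∀ i, E i) × (∀ i, E i)) => w q.1 :=
      hw.comp measurable_fst
    exact (h2.mul (Real.measurable_exp.comp (h1.div_const 2).neg)).ennreal_ofReal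
  rw [lintegral_lintegral_swap hm1.aemeasurable]
  calc _ = ∫⁻ ξ, ∫⁻ p : (∀ i, E i) × (∀ i, E i),
        ENNReal.ofReal (w ξ * Real.exp (-(twistSq (p.1 - p.2) ξ / 2))) ∂(ϖ.prod ϖ) ∂volume := by
        refine lintegral_congr fun ξ => ?_
        rw [lintegral_const_mul' _ _ (by simp), hB.lintegral_enorm_transform_sq,
          ← lintegral_const_mul' _ _ (by simp)]
        refine lintegral_congr fun p => ?_
        rw [ENNReal.ofReal_mul (hw0 ξ)]
    _ = ∫⁻ p : (∀ i, E i) × (∀ i, E i), ∫⁻ ξ,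
        ENNReal.ofReal (w ξ * Real.exp (-(twistSq (p.1 - p.2) ξ / 2))) ∂volume ∂(ϖ.prod ϖ) :=
        lintegral_lintegral_swap hm2.aemeasurable
    _ = _ := by
        have hm3 : Measurable fun p : (∀ i, E i) × (∀ i, E i) => ∫⁻ ξ,
            ENNReal.ofReal (w ξ * Real.exp (-(twistSq (p.1 - p.2) ξ / 2))) ∂volume :=
          hm2.lintegral_prod_left'
        exact lintegral_prod_symm _ hm3.aemeasurable

end GaussianFamily

/-! ### Averaged `L¹` decay of the increments. -/

section IncrementEstimate

variable {ι : Type*} [Fintype ι] {W : ι → Type*}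
  [∀ i, NormedAddCommGroup (W i)] [∀ i, InnerProductSpace ℝ (W i)]
  [∀ i, FiniteDimensional ℝ (W i)] [∀ i, MeasurableSpace (W i)] [∀ i, BorelSpace (W i)]
  {E : ι → Type*} [∀ i, NormedAddCommGroup (E i)] [∀ i, InnerProductSpace ℝ (E i)]
  [∀ i, FiniteDimensional ℝ (E i)] [∀ i, MeasurableSpace (E i)] [∀ i, BorelSpace (E i)]
  {Ω : Type*} [MeasurableSpace Ω]
  {P : Measure Ω} [IsProbabilityMeasure P] {B : Ω → (∀ i, E i) → ∀ i, W i}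

attribute [local irreducible] twistSq transform

/-- The mass of a Frostman measure of diameter at most `R`. -/
theorem measure_univ_le_of_frostman {ϖ : Measure (∀ i, E i)} [SFinite ϖ] {R a : ℝ} {C : ℝ≥0}
    (hR : 1 ≤ R) (hϖ : ∀ x r, 0 < r → ϖ (ball x r) ≤ C * ENNReal.ofReal (r ^ a))
    (hy : ∀ᵐ y ∂ϖ, ∀ᵐ x ∂ϖ, ∀ i, ‖x i - y i‖ ≤ R) :
    ϖ Set.univ ≤ C * ENNReal.ofReal ((2 * R) ^ Module.finrank ℝ (∀ i, E i)) := by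
  rcases eq_or_ne ϖ 0 with rfl | h0
  · simp
  have : NeZero ϖ := ⟨h0⟩
  obtain ⟨y, hy⟩ := hy.exists
  have h := measure_univ_le_of_ball_le ϖ one_pos (by linarith : 0 ≤ R)
    (c := C) (fun x => by simpa using hϖ x 1 one_pos) y hy
  refine h.trans ?_
  gcongr
  linarith

variable (P) in
theorem exists_lintegral_transform_le [Nonempty ι]
    (hW : ∀ i, 1 ≤ Module.finrank ℝ (W i))
    (hWE : ∀ i, Module.finrank ℝ (W i) < Module.finrank ℝ (E i)) {a τ M : ℝ}
    (hM : ∀ i, (Module.finrank ℝ (∀ i, E i) : ℝ) - Module.finrank ℝ (E i) +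
      Module.finrank ℝ (W i) ≤ M)
    (haM : ∀ i, M - Module.finrank ℝ (W i) < a)
    (hτ : ∀ i, -(Module.finrank ℝ (W i) : ℝ) < τ) (hτa : τ < a - M) :
    ∃ (c : ℝ≥0) (F : ℝ), 0 ≤ F ∧
      ∀ B : Ω → (∀ i, E i) → ∀ i, W i, IsGaussianFamily P B → ∀ (R : ℝ) (C : ℝ≥0), 1 ≤ R →
      ∀ (ϖ : Measure (∀ i, E i)) [IsFiniteMeasure ϖ],
      (∀ x r, 0 < r → ϖ (ball x r) ≤ C * ENNReal.ofReal (r ^ a)) →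
      (∀ᵐ y ∂ϖ, ∀ᵐ x ∂ϖ, ∀ i, ‖x i - y i‖ ≤ R) →
      ∫⁻ ω, ∫⁻ ξ, ENNReal.ofReal (sqNorm ξ ^ (τ / 2)) *
        ‖transform ϖ (B ω) (fun _ => 1) ξ‖ₑ ^ 2 ∂volume ∂P ≤
        (c * ENNReal.ofReal (R ^ F) * C) ^ 2 := by
  obtain ⟨c, F, hF, h⟩ := exists_lintegral_energy_le hW hWE hM haM hτ hτa
  set D := Module.finrank ℝ (∀ i, E i)
  -- The energy is at most `C` times the mass, and the mass is at most `C * (2R) ^ D`, so the bound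
  -- is quadratic in `C`. Taking maxima with `1` makes the constants at most their squares, so that
  -- the whole bound is a perfect square ready for Cauchy–Schwarz.
  refine ⟨max 1 (c * 2 ^ D), max 1 (F + D), by positivity, fun B hB R C hR ϖ _ hϖ hy => ?_⟩
  have hmeas : Measurable fun ξ : ∀ i, W i => sqNorm ξ ^ (τ / 2) := by
    have : Measurable fun ξ : ∀ i, W i => sqNorm ξ :=
      Finset.measurable_sum _ fun i _ => ((measurable_pi_apply i).norm.pow_const 2)
    exact this.pow_const _
  rw [hB.lintegral_energy ϖ hmeas (fun ξ => Real.rpow_nonneg (sqNorm_nonneg ξ) _)]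
  refine (h R C hR ϖ hϖ hy).trans ?_
  have hR0 : 0 < R := by linarith
  have e1 : ENNReal.ofReal ((2 * R) ^ D) = (2 ^ D : ℝ≥0) * ENNReal.ofReal (R ^ (D : ℝ)) := by
    rw [mul_pow, ENNReal.ofReal_mul (by positivity), Real.rpow_natCast,
      ENNReal.ofReal_pow (by norm_num)]
    simp
  have e2 : ENNReal.ofReal (R ^ F) * ENNReal.ofReal (R ^ (D : ℝ)) ≤
      ENNReal.ofReal (R ^ max 1 (F + D)) ^ 2 := by
    rw [← ENNReal.ofReal_mul (by positivity), ← ENNReal.ofReal_pow (by positivity),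
      ← Real.rpow_add hR0, ← Real.rpow_natCast, ← Real.rpow_mul hR0.le]
    refine ENNReal.ofReal_le_ofReal (Real.rpow_le_rpow_of_exponent_le hR ?_)
    have := le_max_right 1 (F + D)
    have := le_max_left 1 (F + D)
    push_cast
    linarith
  have e3 : (c : ℝ≥0∞) * ((2 ^ D : ℝ≥0) : ℝ≥0∞) ≤ ((max 1 (c * 2 ^ D) : ℝ≥0) : ℝ≥0∞) ^ 2 := by
    rw [← ENNReal.coe_mul, ← ENNReal.coe_pow]
    exact ENNReal.coe_le_coe.2 ((le_max_right 1 _).trans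
      (le_self_pow (le_max_left 1 _) two_ne_zero))
  calc c * ENNReal.ofReal (R ^ F) * C * ϖ Set.univ
      ≤ c * ENNReal.ofReal (R ^ F) * C * (C * ENNReal.ofReal ((2 * R) ^ D)) := by
        gcongr
        exact measure_univ_le_of_frostman hR hϖ hy
    _ = (c * (2 ^ D : ℝ≥0)) * (ENNReal.ofReal (R ^ F) * ENNReal.ofReal (R ^ (D : ℝ))) *
          C ^ 2 := by rw [e1]; ring
    _ ≤ _ := by
        rw [mul_pow, mul_pow]
        gcongr

theorem gaussian_sub_enorm_le {s γ ε : ℝ} (hs : 0 < s) (h0 : 0 ≤ ε) (h1 : ε ≤ 1)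
    (ξ : ∀ i, W i) (a b : ℝ≥0∞) :
    ENNReal.ofReal (Real.exp (-(s * sqNorm ξ / 2)) - Real.exp (-(2 * s * sqNorm ξ / 2))) *
      (a * b) ≤
    (ENNReal.ofReal ((s / 2) ^ ε * sqNorm ξ ^ (γ / 2 + ε)) * a) *
      (ENNReal.ofReal (sqNorm ξ ^ (-γ / 2) * Real.exp (-(s * sqNorm ξ / 4))) * b) := by
  have hq := sqNorm_nonneg ξ
  rw [mul_mul_mul_comm, ← ENNReal.ofReal_mul (by positivity)]
  gcongr
  rcases hq.eq_or_lt with h | h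
  · rw [← h]
    simp only [mul_zero, zero_div, neg_zero, Real.exp_zero, sub_self]
    positivity
  · exact gaussian_sub_le h hs h0 h1

/-- Cauchy–Schwarz is applied on `Ω` times frequency space. The sign depends on `ω`, so it cannot be
averaged like a fixed density; it is removed for each fixed `ω` before the average over `P` is
taken. -/
theorem IsGaussianFamily.lintegral_increment_le (hB : IsGaussianFamily P B)
    [Nontrivial (∀ i, W i)] {μ ν : Measure (∀ i, E i)} [IsFiniteMeasure μ] [IsFiniteMeasure ν]
    {s γ ε : ℝ} (hs : 0 < s) (hγ : 0 < γ) (h0 : 0 ≤ ε) (h1 : ε ≤ 1) {A D : ℝ≥0∞}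
    (hA : ∫⁻ ω, ∫⁻ ξ, ENNReal.ofReal (sqNorm ξ ^ (γ + 2 * ε)) *
        ‖transform μ (B ω) (fun _ => 1) ξ‖ₑ ^ 2 ∂volume ∂P ≤ A ^ 2)
    (hD : ∫⁻ ω, ∫⁻ ξ, ENNReal.ofReal (sqNorm ξ ^ (-γ)) *
        ‖transform ν (B ω) (fun _ => 1) ξ‖ₑ ^ 2 ∂volume ∂P ≤ D ^ 2) :
    ∫⁻ ω, ∫⁻ y, ‖increment s (B ω) μ y‖ₑ ∂ν ∂P ≤ ENNReal.ofReal (s ^ ε) * A * D := by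
  have hBω : ∀ ω, Measurable (B ω) := fun ω => hB.measurable.of_uncurry_left
  have hq : Measurable fun p : Ω × (∀ i, W i) => sqNorm p.2 := by
    have : Measurable fun ξ : ∀ i, W i => sqNorm ξ :=
      Finset.measurable_sum _ fun i _ => ((measurable_pi_apply i).norm.pow_const 2)
    exact this.comp measurable_snd
  set U : Ω × (∀ i, W i) → ℝ≥0∞ := fun p =>
    ENNReal.ofReal ((s / 2) ^ ε * sqNorm p.2 ^ (γ / 2 + ε)) *
      ‖transform μ (B p.1) (fun _ => 1) p.2‖ₑ with hU
  set V : Ω × (∀ i, W i) → ℝ≥0∞ := fun p =>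
    ENNReal.ofReal (sqNorm p.2 ^ (-γ / 2) * Real.exp (-(s * sqNorm p.2 / 4))) *
      ‖transform ν (B p.1) (incrementSign s (B p.1) μ) p.2‖ₑ with hV
  have hUm : Measurable U := by
    refine Measurable.mul ((hq.pow_const _).const_mul _).ennreal_ofReal ?_
    exact (measurable_transform_param (ϖ := μ) hB.measurable (σ := fun _ _ => 1)
      measurable_const).enorm
  have hVm : Measurable V := by
    refine Measurable.mul ((hq.pow_const _).mul (Real.measurable_exp.comp
      ((hq.const_mul s).div_const 4).neg)).ennreal_ofReal ?_
    exact (measurable_transform_param (ϖ := ν) hB.measurable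
      (measurable_incrementSign (μ := μ) hB.measurable s)).enorm
  have hU2 : ∫⁻ p, U p ^ (2 : ℝ) ∂(P.prod volume) ≤ (ENNReal.ofReal ((s / 2) ^ ε) * A) ^ 2 := by
    rw [lintegral_prod _ (hUm.pow_const _).aemeasurable, mul_pow]
    refine le_trans (le_of_eq ?_) (mul_le_mul_right hA _)
    rw [← lintegral_const_mul' _ _ (by simp)]
    refine lintegral_congr fun ω => ?_
    rw [← lintegral_const_mul' _ _ (by simp)]
    refine lintegral_congr fun ξ => ?_
    have hqξ := sqNorm_nonneg ξ
    rw [hU, ENNReal.rpow_two, mul_pow, ENNReal.ofReal_mul (by positivity), mul_pow, mul_assoc,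
      ← ENNReal.ofReal_pow (by positivity : 0 ≤ sqNorm ξ ^ (γ / 2 + ε)), ← Real.rpow_natCast,
      ← Real.rpow_mul hqξ]
    congr 4
    push_cast
    ring
  have hV2 : ∫⁻ p, V p ^ (2 : ℝ) ∂(P.prod volume) ≤ D ^ 2 := by
    rw [lintegral_prod _ (hVm.pow_const _).aemeasurable]
    refine le_trans (lintegral_mono fun ω => ?_) hD
    have hms : Measurable (incrementSign s (B ω) μ) :=
      (measurable_incrementSign (μ := μ) hB.measurable s).of_uncurry_left
    calc ∫⁻ ξ, V (ω, ξ) ^ (2 : ℝ) ∂volume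
        = ∫⁻ ξ, ENNReal.ofReal (sqNorm ξ ^ (-γ) * Real.exp (-(s * sqNorm ξ / 2))) *
            ‖transform ν (B ω) (incrementSign s (B ω) μ) ξ‖ₑ ^ 2 := by
          refine lintegral_congr fun ξ => ?_
          have hqξ := sqNorm_nonneg ξ
          rw [hV, ENNReal.rpow_two, mul_pow, ← ENNReal.ofReal_pow (by positivity), mul_pow,
            ← Real.rpow_natCast, ← Real.rpow_mul hqξ, ← Real.exp_nat_mul]
          congr 4
          · push_cast; ring
          · push_cast; ring_nf
      _ ≤ _ := lintegral_rpow_gaussian_transform_le hγ hs (hBω ω) hms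
            (abs_incrementSign s (B ω) μ)
      _ ≤ _ := by
          refine lintegral_mono fun ξ => ?_
          have hqξ := sqNorm_nonneg ξ
          gcongr
          refine mul_le_of_le_one_right (by positivity) ?_
          rw [Real.exp_le_one_iff]
          have : 0 ≤ s * sqNorm ξ / 2 := by positivity
          linarith
  have hroot : ∀ x : ℝ≥0∞, (x ^ 2) ^ (1 / 2 : ℝ) = x := fun x => by
    rw [← ENNReal.rpow_two, ← ENNReal.rpow_mul]; norm_num
  calc ∫⁻ ω, ∫⁻ y, ‖increment s (B ω) μ y‖ₑ ∂ν ∂P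
      ≤ ∫⁻ ω, ∫⁻ ξ, U (ω, ξ) * V (ω, ξ) ∂volume ∂P := by
        refine lintegral_mono fun ω => (_root_.lintegral_increment_le (hBω ω) hs).trans ?_
        exact lintegral_mono fun ξ => gaussian_sub_enorm_le hs h0 h1 ξ _ _
    _ = ∫⁻ p, (U * V) p ∂(P.prod volume) := by
        rw [lintegral_prod _ (hUm.mul hVm).aemeasurable]; rfl
    _ ≤ (∫⁻ p, U p ^ (2 : ℝ) ∂(P.prod volume)) ^ (1 / 2 : ℝ) *
        (∫⁻ p, V p ^ (2 : ℝ) ∂(P.prod volume)) ^ (1 / 2 : ℝ) :=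
        ENNReal.lintegral_mul_le_Lp_mul_Lq _ Real.HolderConjugate.two_two hUm.aemeasurable
          hVm.aemeasurable
    _ ≤ ((ENNReal.ofReal ((s / 2) ^ ε) * A) ^ 2) ^ (1 / 2 : ℝ) * (D ^ 2) ^ (1 / 2 : ℝ) := by
        gcongr
    _ ≤ _ := by
        rw [hroot, hroot]
        gcongr
        linarith

variable (P) in
theorem exists_lintegral_increment_le [Nonempty ι]
    (hW : ∀ i, 1 ≤ Module.finrank ℝ (W i))
    (hWE : ∀ i, Module.finrank ℝ (W i) < Module.finrank ℝ (E i)) {α β M : ℝ}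
    (hM : ∀ i, (Module.finrank ℝ (∀ i, E i) : ℝ) - Module.finrank ℝ (E i) +
      Module.finrank ℝ (W i) ≤ M)
    (hα : M < α) (hαβ : 2 * M - α < β) (hβ : ∀ i, M - Module.finrank ℝ (W i) < β) :
    ∃ (ε : ℝ) (c : ℝ≥0) (F : ℝ), 0 < ε ∧ 0 ≤ F ∧
      ∀ B : Ω → (∀ i, E i) → ∀ i, W i, IsGaussianFamily P B → ∀ (R : ℝ) (Cμ Cν : ℝ≥0), 1 ≤ R →
      ∀ (μ ν : Measure (∀ i, E i)) [IsFiniteMeasure μ] [IsFiniteMeasure ν],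
      (∀ x r, 0 < r → μ (ball x r) ≤ Cμ * ENNReal.ofReal (r ^ α)) →
      (∀ x r, 0 < r → ν (ball x r) ≤ Cν * ENNReal.ofReal (r ^ β)) →
      (∀ᵐ y ∂μ, ∀ᵐ x ∂μ, ∀ i, ‖x i - y i‖ ≤ R) →
      (∀ᵐ y ∂ν, ∀ᵐ x ∂ν, ∀ i, ‖x i - y i‖ ≤ R) → ∀ s : ℝ, 0 < s →
      ∫⁻ ω, ∫⁻ y, ‖increment s (B ω) μ y‖ₑ ∂ν ∂P ≤
        c * ENNReal.ofReal (R ^ F) * ENNReal.ofReal (s ^ ε) * Cμ * Cν := by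
  have : ∀ i, Nontrivial (W i) := fun i =>
    Module.nontrivial_of_finrank_pos (R := ℝ) (by have := hW i; omega)
  have : Nontrivial (∀ i, W i) :=
    Pi.nontrivial_at (Classical.arbitrary ι)
  have hpos : ∀ i, (0 : ℝ) < Module.finrank ℝ (W i) := fun i => by exact_mod_cast hW i
  obtain ⟨i₀, hi₀⟩ := Finite.exists_min fun i => (Module.finrank ℝ (W i) : ℝ)
  -- The order `-g` of the energy of `ν` requires `M - β < g < dim (W i)`, and the order slightly
  -- above `g` for `μ` requires `g < α - M`. The hypotheses on `α` and `β` say that a positive `g`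
  -- of this kind exists.
  obtain ⟨g, hg1, hg2⟩ := exists_between (a₁ := max 0 (M - β))
    (a₂ := min (Module.finrank ℝ (W i₀) : ℝ) (α - M))
    (max_lt (lt_min (hpos _) (by linarith))
      (lt_min (by have := hβ i₀; linarith) (by linarith)))
  rw [max_lt_iff] at hg1
  rw [lt_min_iff] at hg2
  -- This keeps the order `g + 4ε` strictly below `α - M`, and `ε ≤ 1` as needed for `1 - exp (-x) ≤
  -- x ^ ε`.
  set ε := min 1 ((α - M - g) / 8)
  have hε : 0 < ε := lt_min one_pos (by linarith [hg2.2])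
  have hε1 : ε ≤ 1 := min_le_left _ _
  have hε8 : ε ≤ (α - M - g) / 8 := min_le_right _ _
  obtain ⟨c, F, hF, h⟩ := exists_lintegral_transform_le P hW hWE hM (a := α) (τ := g + 4 * ε)
    (fun i => by have := hpos i; linarith) (fun i => by have := hpos i; linarith) (by linarith)
  obtain ⟨c', F', hF', h'⟩ := exists_lintegral_transform_le P hW hWE hM (a := β) (τ := -g)
    hβ (fun i => by have := hi₀ i; linarith) (by linarith)
  refine ⟨ε, c * c', F + F', hε, by positivity, fun B hB R Cμ Cν hR μ ν _ _ hμ hν hμR hνR s hs => ?_⟩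
  refine (hB.lintegral_increment_le (μ := μ) (ν := ν) (γ := g / 2) (ε := ε) hs
    (by linarith) hε.le hε1
    (A := c * ENNReal.ofReal (R ^ F) * Cμ) (D := c' * ENNReal.ofReal (R ^ F') * Cν)
    ?_ ?_).trans (le_of_eq ?_)
  · have e : g / 2 + 2 * ε = (g + 4 * ε) / 2 := by ring
    rw [e]
    exact h B hB R Cμ hR μ hμ hμR
  · have e : -(g / 2) = -g / 2 := by ring
    rw [e]
    exact h' B hB R Cν hR ν hν hνR
  · rw [Real.rpow_add (by linarith), ENNReal.ofReal_mul (by positivity)]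
    push_cast
    ring

end IncrementEstimate

/-! ### The maximal function over dyadic scales. -/

/-- Geometric decay of `L^p` norms implies an `L^p` bound for the sum. -/
theorem lintegral_rpow_tsum_le {Y : Type*} [MeasurableSpace Y] (lam : Measure Y) {p : ℝ}
    (hp : 1 ≤ p) {q : ℝ≥0} (hq0 : 0 < q) (a : ℕ → Y → ℝ≥0∞) (ha : ∀ J, Measurable (a J))
    {K : ℝ≥0∞} (hK : ∀ J, ∫⁻ y, a J y ^ p ∂lam ≤ K * ((q : ℝ≥0∞) ^ 2) ^ J) :
    ∫⁻ y, (∑' J, a J y) ^ p ∂lam ≤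
      ((1 - (q : ℝ≥0∞) ^ (1 / p))⁻¹) ^ p * (1 - (q : ℝ≥0∞))⁻¹ * K := by
  have hp0 : 0 < p := by linarith
  have hqE : (q : ℝ≥0∞) ≠ 0 := by simpa using hq0.ne'
  set r : ℝ≥0∞ := (q : ℝ≥0∞) ^ (1 / p) with hr
  have hr0 : r ≠ 0 := by
    rw [hr, ne_eq, ENNReal.rpow_eq_zero_iff]; simp [hq0.ne']
  have hrt : r ≠ ∞ := ENNReal.rpow_ne_top_of_nonneg (by positivity) ENNReal.coe_ne_top
  have hrp : ∀ J : ℕ, (r ^ J) ^ p = (q : ℝ≥0∞) ^ J := by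
    intro J
    rw [hr, ← ENNReal.rpow_natCast, ← ENNReal.rpow_mul, ← ENNReal.rpow_mul, ← ENNReal.rpow_natCast]
    congr 1
    field_simp
  -- Half of the decay `q ^ (2J)` is spent on pointwise summability, through `a J ≤ r ^ J * S ^ (1 /
  -- p)` with `r ^ p = q`; the other half makes the weighted sum `S` integrable.
  have hpt : ∀ y, (∑' J, a J y) ^ p ≤
      ((1 - r)⁻¹) ^ p * ∑' J, a J y ^ p * ((q : ℝ≥0∞) ^ J)⁻¹ := by
    intro y
    set S := ∑' J, a J y ^ p * ((q : ℝ≥0∞) ^ J)⁻¹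
    have h1 : ∀ J, a J y ≤ r ^ J * S ^ (1 / p) := by
      intro J
      have h2 : a J y ^ p * ((q : ℝ≥0∞) ^ J)⁻¹ ≤ S := ENNReal.le_tsum J
      have hqJ : (q : ℝ≥0∞) ^ J ≠ 0 := pow_ne_zero _ hqE
      have hqJt : (q : ℝ≥0∞) ^ J ≠ ∞ := ENNReal.pow_ne_top ENNReal.coe_ne_top
      rw [← div_eq_mul_inv, ENNReal.div_le_iff hqJ hqJt] at h2
      have h3 := ENNReal.rpow_le_rpow h2 (by positivity : 0 ≤ 1 / p)
      rw [← ENNReal.rpow_mul, mul_one_div_cancel hp0.ne', ENNReal.rpow_one,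
        ENNReal.mul_rpow_of_nonneg _ _ (by positivity), ← hrp, ← ENNReal.rpow_mul,
        mul_one_div_cancel hp0.ne', ENNReal.rpow_one, mul_comm] at h3
      exact h3
    calc (∑' J, a J y) ^ p ≤ (∑' J, r ^ J * S ^ (1 / p)) ^ p :=
          ENNReal.rpow_le_rpow (ENNReal.tsum_le_tsum h1) hp0.le
      _ = ((1 - r)⁻¹) ^ p * S := by
          rw [ENNReal.tsum_mul_right, ENNReal.tsum_geometric,
            ENNReal.mul_rpow_of_nonneg _ _ hp0.le, ← ENNReal.rpow_mul, one_div_mul_cancel hp0.ne',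
            ENNReal.rpow_one]
  have hm : ∀ J, Measurable fun y => a J y ^ p * ((q : ℝ≥0∞) ^ J)⁻¹ := fun J =>
    ((ha J).pow_const p).mul_const _
  calc ∫⁻ y, (∑' J, a J y) ^ p ∂lam
      ≤ ∫⁻ y, ((1 - r)⁻¹) ^ p * ∑' J, a J y ^ p * ((q : ℝ≥0∞) ^ J)⁻¹ ∂lam := lintegral_mono hpt
    _ = ((1 - r)⁻¹) ^ p * ∑' J, (∫⁻ y, a J y ^ p ∂lam) * ((q : ℝ≥0∞) ^ J)⁻¹ := by
        rw [lintegral_const_mul _ (Measurable.tsum hm),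
          lintegral_tsum fun J => (hm J).aemeasurable]
        simp_rw [lintegral_mul_const _ ((ha _).pow_const p)]
    _ ≤ ((1 - r)⁻¹) ^ p * ∑' J, K * (q : ℝ≥0∞) ^ J := by
        refine mul_le_mul_right (ENNReal.tsum_le_tsum fun J => ?_) _
        refine (mul_le_mul_left (hK J) _).trans (le_of_eq ?_)
        rw [← pow_mul, mul_comm 2 J, pow_mul, sq, mul_assoc, mul_assoc,
          ENNReal.mul_inv_cancel (pow_ne_zero _ hqE) (ENNReal.pow_ne_top ENNReal.coe_ne_top),
          mul_one]
    _ = _ := by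
        rw [ENNReal.tsum_mul_left, ENNReal.tsum_geometric]
        ring

section MaximalFunction

variable {ι : Type*} [Fintype ι] {W : ι → Type*}
  [∀ i, NormedAddCommGroup (W i)] [∀ i, InnerProductSpace ℝ (W i)]
  [∀ i, FiniteDimensional ℝ (W i)] [∀ i, MeasurableSpace (W i)] [∀ i, BorelSpace (W i)]
  {X : Type*} [MeasurableSpace X] {Ω : Type*} [MeasurableSpace Ω]

/-- The mollification at scale `√t` of the image of `μ` under `b`, evaluated at `b y`. -/
def mollified (t : ℝ) (b : X → ∀ i, W i) (μ : Measure X) (y : X) : ℝ≥0∞ :=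
  ∫⁻ x, ENNReal.ofReal (gaussKer t (b x - b y)) ∂μ

/-- The supremum of the mollifications at the dyadic scales. -/
def maximalDensity (b : X → ∀ i, W i) (μ : Measure X) (y : X) : ℝ≥0∞ :=
  ⨆ J : ℕ, mollified ((1 / 2) ^ J) b μ y

theorem measurable_mollified {μ : Measure X} [SFinite μ] {B : Ω → X → ∀ i, W i}
    (hB : Measurable (Function.uncurry B)) (t : ℝ) :
    Measurable (Function.uncurry fun ω y => mollified t (B ω) μ y) := by
  have h1 : Measurable fun q : (Ω × X) × X => B q.1.1 q.2 - B q.1.1 q.1.2 :=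
    (hB.comp ((measurable_fst.comp measurable_fst).prodMk measurable_snd)).sub
      (hB.comp ((measurable_fst.comp measurable_fst).prodMk
        (measurable_snd.comp measurable_fst)))
  have : Measurable fun q : (Ω × X) × X =>
      ENNReal.ofReal (gaussKer t (B q.1.1 q.2 - B q.1.1 q.1.2)) :=
    ((continuous_gaussKer t).measurable.comp h1).ennreal_ofReal
  exact this.lintegral_prod_right'

theorem mollified_le {t : ℝ} (ht : 0 < t) (b : X → ∀ i, W i) (μ : Measure X) (y : X) :
    mollified t b μ y ≤
      ENNReal.ofReal ((2 * Real.pi / t) ^ ((∑ i, (Module.finrank ℝ (W i) : ℝ)) / 2)) *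
        μ Set.univ := by
  rw [← lintegral_const]
  exact lintegral_mono fun x => ENNReal.ofReal_le_ofReal (gaussKer_le ht _)

theorem enorm_increment_le {s : ℝ} (hs : 0 < s) (b : X → ∀ i, W i) (μ : Measure X)
    [IsFiniteMeasure μ] (y : X) :
    ‖increment s b μ y‖ₑ ≤
      ENNReal.ofReal ((2 * Real.pi / s) ^ ((∑ i, (Module.finrank ℝ (W i) : ℝ)) / 2)) *
        μ Set.univ := by
  rw [← ofReal_norm, Real.norm_eq_abs]
  refine (ENNReal.ofReal_le_ofReal (abs_increment_le hs b μ y)).trans (le_of_eq ?_)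
  rw [ENNReal.ofReal_mul (by positivity), ofReal_measureReal]

theorem mollified_le_add_increment {s : ℝ} (hs : 0 < s) {b : X → ∀ i, W i} (hb : Measurable b)
    (μ : Measure X) [IsFiniteMeasure μ] (y : X) :
    mollified s b μ y ≤ mollified (2 * s) b μ y + ‖increment s b μ y‖ₑ := by
  have hI : ∀ t : ℝ, 0 < t → Integrable (fun x => gaussKer t (b x - b y)) μ := by
    intro t ht
    refine Integrable.mono' (integrable_const
      ((2 * Real.pi / t) ^ ((∑ i, (Module.finrank ℝ (W i) : ℝ)) / 2)))
      ((continuous_gaussKer t).measurable.comp (hb.sub_const _)).aestronglyMeasurable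
      (ae_of_all _ fun x => ?_)
    rw [Real.norm_of_nonneg (gaussKer_nonneg ht _)]
    exact gaussKer_le ht _
  have e : ∀ t : ℝ, 0 < t →
      mollified t b μ y = ENNReal.ofReal (∫ x, gaussKer t (b x - b y) ∂μ) := fun t ht =>
    (ofReal_integral_eq_lintegral_ofReal (hI t ht)
      (ae_of_all _ fun x => gaussKer_nonneg ht _)).symm
  have h2 : 0 < 2 * s := by linarith
  rw [e s hs, e _ h2, increment, integral_sub (hI s hs) (hI _ h2), ← ofReal_norm,
    Real.norm_eq_abs, ← ENNReal.ofReal_add (integral_nonneg fun x => gaussKer_nonneg h2 _)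
      (abs_nonneg _)]
  refine ENNReal.ofReal_le_ofReal ?_
  linarith [le_abs_self (∫ x, gaussKer s (b x - b y) ∂μ - ∫ x, gaussKer (2 * s) (b x - b y) ∂μ)]

/-- The terms of the telescoping series dominating `maximalDensity`. -/
def maximalTerm (b : X → ∀ i, W i) (μ : Measure X) (y : X) : ℕ → ℝ≥0∞
  | 0 => mollified 1 b μ y
  | J + 1 => ‖increment ((1 / 2) ^ (J + 1)) b μ y‖ₑ

theorem maximalDensity_le_tsum {b : X → ∀ i, W i} (hb : Measurable b)
    (μ : Measure X) [IsFiniteMeasure μ] (y : X) :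
    maximalDensity b μ y ≤ ∑' J, maximalTerm b μ y J := by
  refine iSup_le fun J => le_trans ?_ (ENNReal.sum_le_tsum (Finset.range (J + 1)))
  induction J with
  | zero => simp [maximalTerm]
  | succ J ih =>
    rw [Finset.sum_range_succ]
    have h := mollified_le_add_increment (s := (1 / 2) ^ (J + 1)) (by positivity) hb μ y
    have e : (2 : ℝ) * (1 / 2) ^ (J + 1) = (1 / 2) ^ J := by rw [pow_succ]; ring
    rw [e] at h
    exact h.trans (add_le_add ih le_rfl)

theorem measurable_maximalTerm {μ : Measure X} [SFinite μ] {B : Ω → X → ∀ i, W i}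
    (hB : Measurable (Function.uncurry B)) (J : ℕ) :
    Measurable fun p : Ω × X => maximalTerm (B p.1) μ p.2 J := by
  cases J with
  | zero => exact measurable_mollified hB 1
  | succ J => exact (measurable_increment hB _).enorm

theorem measurable_maximalDensity {μ : Measure X} [SFinite μ] {B : Ω → X → ∀ i, W i}
    (hB : Measurable (Function.uncurry B)) :
    Measurable (Function.uncurry fun ω y => maximalDensity (B ω) μ y) :=
  Measurable.iSup fun _ => measurable_mollified hB _

end MaximalFunction

/-! ### The maximal density in `L^p` for Gaussian maps. -/

section MaximalEstimate

variable {ι : Type*} [Fintype ι] {W : ι → Type*}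
  [∀ i, NormedAddCommGroup (W i)] [∀ i, InnerProductSpace ℝ (W i)]
  [∀ i, FiniteDimensional ℝ (W i)] [∀ i, MeasurableSpace (W i)] [∀ i, BorelSpace (W i)]
  {E : ι → Type*} [∀ i, NormedAddCommGroup (E i)] [∀ i, InnerProductSpace ℝ (E i)]
  [∀ i, FiniteDimensional ℝ (E i)] [∀ i, MeasurableSpace (E i)] [∀ i, BorelSpace (E i)]
  {Ω : Type*} [MeasurableSpace Ω]
  {P : Measure Ω} [IsProbabilityMeasure P] {B : Ω → (∀ i, E i) → ∀ i, W i}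

variable (P) in
theorem exists_lintegral_maximalDensity_le [Nonempty ι]
    (hW : ∀ i, 1 ≤ Module.finrank ℝ (W i))
    (hWE : ∀ i, Module.finrank ℝ (W i) < Module.finrank ℝ (E i)) {α β M : ℝ}
    (hM : ∀ i, (Module.finrank ℝ (∀ i, E i) : ℝ) - Module.finrank ℝ (E i) +
      Module.finrank ℝ (W i) ≤ M)
    (hα : M < α) (hαβ : 2 * M - α < β) (hβ : ∀ i, M - Module.finrank ℝ (W i) < β) :
    ∃ (p : ℝ) (c : ℝ≥0∞) (F : ℝ), 1 < p ∧ c ≠ ∞ ∧ 0 ≤ F ∧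
      ∀ B : Ω → (∀ i, E i) → ∀ i, W i, IsGaussianFamily P B → ∀ (R : ℝ) (Cμ Cν : ℝ≥0), 1 ≤ R →
      ∀ (μ ν : Measure (∀ i, E i)) [IsFiniteMeasure μ] [IsFiniteMeasure ν],
      (∀ x r, 0 < r → μ (ball x r) ≤ Cμ * ENNReal.ofReal (r ^ α)) →
      (∀ x r, 0 < r → ν (ball x r) ≤ Cν * ENNReal.ofReal (r ^ β)) →
      (∀ᵐ y ∂μ, ∀ᵐ x ∂μ, ∀ i, ‖x i - y i‖ ≤ R) →
      (∀ᵐ y ∂ν, ∀ᵐ x ∂ν, ∀ i, ‖x i - y i‖ ≤ R) →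
      ∫⁻ ω, ∫⁻ y, maximalDensity (B ω) μ y ^ p ∂ν ∂P ≤
        c * ENNReal.ofReal (2 * R) ^ F * (Cμ : ℝ≥0∞) ^ p * Cν := by
  obtain ⟨ε, c, F, hε, hF, h⟩ := exists_lintegral_increment_le P hW hWE hM hα hαβ hβ
  set m : ℝ := ∑ i, (Module.finrank ℝ (W i) : ℝ) with hm
  have hm0 : 0 < m := Finset.sum_pos (fun i _ => by exact_mod_cast hW i) Finset.univ_nonempty
  -- An increment to the power `1 + κ` is at most its sup bound, of order `s ^ (-m / 2)`, to the
  -- power `κ` times the increment itself. With `κ = ε / m` the loss is `s ^ (-ε / 2)`, half of the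
  -- gain `s ^ ε`.
  set κ := ε / m with hκ
  have hκ0 : 0 < κ := by positivity
  set D := Module.finrank ℝ (∀ i, E i) with hD
  -- Chosen so that the remaining gain `s ^ (ε / 2)` at `s = (1 / 2) ^ (J + 1)` equals `(q ^ 2) ^ (J
  -- + 1)`.
  set q : ℝ≥0 := (1 / 2) ^ (ε / 4) with hq
  have hq0 : 0 < q := NNReal.rpow_pos (by norm_num)
  have hq1 : q < 1 := NNReal.rpow_lt_one (by norm_num) (by positivity)
  set c₀ : ℝ≥0∞ := ENNReal.ofReal ((2 * Real.pi) ^ (m / 2)) ^ (1 + κ) +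
    c * ENNReal.ofReal ((2 * Real.pi) ^ (ε / 2)) with hc₀
  refine ⟨1 + κ, ((1 - (q : ℝ≥0∞) ^ (1 / (1 + κ)))⁻¹) ^ (1 + κ) * (1 - (q : ℝ≥0∞))⁻¹ * c₀,
    F + D * (1 + κ) + D, by linarith, ?_, by positivity, ?_⟩
  · refine ENNReal.mul_ne_top (ENNReal.mul_ne_top ?_ ?_) ?_
    · refine ENNReal.rpow_ne_top_of_nonneg (by positivity) (ENNReal.inv_ne_top.2 ?_)
      rw [ne_eq, tsub_eq_zero_iff_le, not_le]
      exact ENNReal.rpow_lt_one (by exact_mod_cast hq1) (by positivity)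
    · rw [ENNReal.inv_ne_top, ne_eq, tsub_eq_zero_iff_le, not_le]
      exact_mod_cast hq1
    · rw [hc₀]
      exact ENNReal.add_ne_top.2 ⟨ENNReal.rpow_ne_top_of_nonneg (by positivity)
        ENNReal.ofReal_ne_top, ENNReal.mul_ne_top ENNReal.coe_ne_top ENNReal.ofReal_ne_top⟩
  intro B hB R Cμ Cν hR μ ν _ _ hμ hν hμR hνR
  set Q := ENNReal.ofReal (2 * R) with hQ
  have hQ1 : 1 ≤ Q := by rw [hQ, ENNReal.one_le_ofReal]; linarith
  have hmass : ∀ {C : ℝ≥0} {x : ℝ≥0∞}, x ≤ C * ENNReal.ofReal ((2 * R) ^ D) →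
      x ≤ C * Q ^ (D : ℝ) := by
    intro C x hx
    rwa [ENNReal.ofReal_pow (by linarith), ← ENNReal.rpow_natCast] at hx
  have hμ1 := hmass (measure_univ_le_of_frostman hR hμ hμR)
  have hν1 := hmass (measure_univ_le_of_frostman hR hν hνR)
  have hBω : ∀ ω, Measurable (B ω) := fun ω => hB.measurable.of_uncurry_left
  set K : ℝ≥0∞ := c₀ * Q ^ (F + D * (1 + κ) + D) * (Cμ : ℝ≥0∞) ^ (1 + κ) * Cν with hK
  have hterm : ∀ J, ∫⁻ z : Ω × (∀ i, E i), maximalTerm (B z.1) μ z.2 J ^ (1 + κ) ∂(P.prod ν) ≤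
      K * ((q : ℝ≥0∞) ^ 2) ^ J := by
    intro J
    rw [lintegral_prod _ ((measurable_maximalTerm hB.measurable J).pow_const _).aemeasurable]
    cases J with
    | zero =>
      simp only [maximalTerm, pow_zero, mul_one]
      calc ∫⁻ ω, ∫⁻ y, mollified 1 (B ω) μ y ^ (1 + κ) ∂ν ∂P
          ≤ ∫⁻ ω, ∫⁻ y, (ENNReal.ofReal ((2 * Real.pi) ^ (m / 2)) * μ Set.univ) ^ (1 + κ) ∂ν ∂P := by
            gcongr with ω y
            have := mollified_le one_pos (B ω) μ y
            rwa [div_one] at this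
        _ = (ENNReal.ofReal ((2 * Real.pi) ^ (m / 2)) * μ Set.univ) ^ (1 + κ) * ν Set.univ := by
            simp only [lintegral_const, measure_univ, mul_one]
        _ ≤ (ENNReal.ofReal ((2 * Real.pi) ^ (m / 2)) * (Cμ * Q ^ (D : ℝ))) ^ (1 + κ) *
              (Cν * Q ^ (D : ℝ)) := by gcongr
        _ = ENNReal.ofReal ((2 * Real.pi) ^ (m / 2)) ^ (1 + κ) * Q ^ (D * (1 + κ) + D) *
              (Cμ : ℝ≥0∞) ^ (1 + κ) * Cν := by
            rw [ENNReal.mul_rpow_of_nonneg _ _ (by positivity),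
              ENNReal.mul_rpow_of_nonneg _ _ (by positivity), ← ENNReal.rpow_mul,
              ENNReal.rpow_add_of_nonneg (D * (1 + κ)) D (by positivity) (by positivity)]
            ring
        _ ≤ K := by
            rw [hK, hc₀]
            have := ENNReal.rpow_le_rpow_of_exponent_le hQ1
              (by linarith : D * (1 + κ) + D ≤ F + D * (1 + κ) + D)
            gcongr
            exact le_self_add
    | succ J =>
      simp only [maximalTerm]
      set s : ℝ := (1 / 2) ^ (J + 1) with hs
      have hs0 : 0 < s := by positivity
      have hsq : ENNReal.ofReal (s ^ ε) * ENNReal.ofReal ((2 * Real.pi / s) ^ (m / 2)) ^ κ =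
          ENNReal.ofReal ((2 * Real.pi) ^ (ε / 2)) * ((q : ℝ≥0∞) ^ 2) ^ (J + 1) := by
        have e1 : ((q : ℝ≥0∞) ^ 2) ^ (J + 1) = ENNReal.ofReal (s ^ (ε / 2)) := by
          rw [← ENNReal.ofReal_coe_nnreal, ← ENNReal.ofReal_pow (NNReal.coe_nonneg q),
            ← ENNReal.ofReal_pow (by positivity), hq, hs]
          congr 1
          push_cast
          rw [← Real.rpow_natCast, ← Real.rpow_natCast, ← Real.rpow_natCast,
            ← Real.rpow_mul (by positivity), ← Real.rpow_mul (by positivity),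
            ← Real.rpow_mul (by positivity)]
          congr 1
          push_cast
          ring
        rw [e1, ENNReal.ofReal_rpow_of_nonneg (by positivity) hκ0.le,
          ← ENNReal.ofReal_mul (by positivity), ← ENNReal.ofReal_mul (by positivity),
          ← Real.rpow_mul (by positivity), Real.div_rpow (by positivity) hs0.le]
        have e2 : m / 2 * κ = ε / 2 := by rw [hκ]; field_simp
        have e3 : s ^ ε = s ^ (ε / 2) * s ^ (ε / 2) := by
          rw [← Real.rpow_add hs0]; ring_nf
        have : s ^ (ε / 2) ≠ 0 := (Real.rpow_pos_of_pos hs0 _).ne'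
        rw [e2, e3]
        congr 1
        field_simp
      calc ∫⁻ ω, ∫⁻ y, ‖increment s (B ω) μ y‖ₑ ^ (1 + κ) ∂ν ∂P
          ≤ ∫⁻ ω, ∫⁻ y, (ENNReal.ofReal ((2 * Real.pi / s) ^ (m / 2)) * μ Set.univ) ^ κ *
              ‖increment s (B ω) μ y‖ₑ ∂ν ∂P := by
            gcongr with ω y
            rw [ENNReal.rpow_add_of_nonneg _ _ (by positivity) (by positivity), ENNReal.rpow_one,
              mul_comm]
            gcongr
            exact enorm_increment_le hs0 (B ω) μ y
        _ = (ENNReal.ofReal ((2 * Real.pi / s) ^ (m / 2)) * μ Set.univ) ^ κ *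
              ∫⁻ ω, ∫⁻ y, ‖increment s (B ω) μ y‖ₑ ∂ν ∂P := by
            have ht : (ENNReal.ofReal ((2 * Real.pi / s) ^ (m / 2)) * μ Set.univ) ^ κ ≠ ∞ :=
              ENNReal.rpow_ne_top_of_nonneg (by positivity)
                (ENNReal.mul_ne_top ENNReal.ofReal_ne_top (measure_ne_top _ _))
            simp_rw [lintegral_const_mul' _ _ ht]
        _ ≤ (ENNReal.ofReal ((2 * Real.pi / s) ^ (m / 2)) * (Cμ * Q ^ (D : ℝ))) ^ κ *
              (c * ENNReal.ofReal (R ^ F) * ENNReal.ofReal (s ^ ε) * Cμ * Cν) := by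
            gcongr
            exact h B hB R Cμ Cν hR μ ν hμ hν hμR hνR s hs0
        _ = (c * ENNReal.ofReal ((2 * Real.pi) ^ (ε / 2))) *
              (ENNReal.ofReal (R ^ F) * Q ^ (D * κ)) * (Cμ : ℝ≥0∞) ^ (1 + κ) * Cν *
              ((q : ℝ≥0∞) ^ 2) ^ (J + 1) := by
            rw [ENNReal.mul_rpow_of_nonneg _ _ (by positivity),
              ENNReal.mul_rpow_of_nonneg _ _ (by positivity), ← ENNReal.rpow_mul,
              ENNReal.rpow_add_of_nonneg _ _ (by positivity) hκ0.le, ENNReal.rpow_one]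
            calc _ = (ENNReal.ofReal (s ^ ε) *
                    ENNReal.ofReal ((2 * Real.pi / s) ^ (m / 2)) ^ κ) *
                    (c * ENNReal.ofReal (R ^ F) * Q ^ (D * κ) * Cμ * (Cμ : ℝ≥0∞) ^ κ * Cν) := by
                  ring
              _ = _ := by rw [hsq]; ring
        _ ≤ K * ((q : ℝ≥0∞) ^ 2) ^ (J + 1) := by
            rw [hK]
            gcongr
            · rw [hc₀]; exact le_add_self
            · calc ENNReal.ofReal (R ^ F) * Q ^ (D * κ) ≤ Q ^ F * Q ^ (D * κ) := by
                    gcongr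
                    rw [hQ, ENNReal.ofReal_rpow_of_nonneg (by linarith) hF]
                    gcongr
                    linarith
                _ = Q ^ (F + D * κ) := by
                    rw [ENNReal.rpow_add_of_nonneg _ _ hF (by positivity)]
                _ ≤ _ := by
                    refine ENNReal.rpow_le_rpow_of_exponent_le hQ1 ?_
                    have : (0 : ℝ) ≤ D := by positivity
                    linarith
  have hfin := lintegral_rpow_tsum_le (P.prod ν) (p := 1 + κ) (by linarith) hq0
    (fun J z => maximalTerm (B z.1) μ z.2 J) (fun J => measurable_maximalTerm hB.measurable J) hterm
  rw [lintegral_prod _ ((Measurable.tsum fun J =>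
    measurable_maximalTerm hB.measurable J).pow_const _).aemeasurable] at hfin
  refine le_trans (lintegral_mono fun ω => lintegral_mono fun y => ?_)
    (hfin.trans (le_of_eq ?_))
  · exact ENNReal.rpow_le_rpow (maximalDensity_le_tsum (hBω ω) μ y) (by positivity)
  · rw [hK]; ring

end MaximalEstimate

/-! ### Random rotations with a Gaussian radius. -/

section RandomRotation

open ProbabilityTheory

variable {E : Type*} [NormedAddCommGroup E] [InnerProductSpace ℝ E] [FiniteDimensional ℝ E]
  [MeasurableSpace E] [BorelSpace E]
  {W : Type*} [NormedAddCommGroup W] [InnerProductSpace ℝ W] [FiniteDimensional ℝ W]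
  [MeasurableSpace W] [BorelSpace W]
  {G : Type*} [TopologicalSpace G] [SecondCountableTopology G] [MeasurableSpace G] [BorelSpace G]

/-- A random rotation of `E` whose law on each orbit does not depend on the starting point. -/
structure IsRandomRotation (lam : Measure G) (act : G → E ≃ₗᵢ[ℝ] E) : Prop where
  continuous : Continuous fun p : G × E => act p.1 p.2
  lintegral_eq : ∀ (F : E → ℝ≥0∞) (u v : E), ‖u‖ = ‖v‖ →
    ∫⁻ g, F (act g u) ∂lam = ∫⁻ g, F (act g v) ∂lam

variable {lam : Measure G} [IsProbabilityMeasure lam] {act : G → E ≃ₗᵢ[ℝ] E}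

theorem IsRandomRotation.measurable_norm_smul (h : IsRandomRotation lam act) (x : E) :
    Measurable fun ω : G × E => ‖ω.2‖ • act ω.1 x := by
  have h1 : Continuous fun ω : G × E => (ω.1, x) := continuous_fst.prodMk continuous_const
  exact (continuous_snd.norm.smul (h.continuous.comp h1)).measurable

/-- For fixed `z` the vectors `‖z‖ • x` and `‖x‖ • z` have the same norm, hence the same rotation
average. In the second form the rotation acts on `z` and disappears by invariance of the standard
Gaussian. -/
theorem IsRandomRotation.lintegral_norm_smul (h : IsRandomRotation lam act) {f : E → ℝ≥0∞}
    (hf : Measurable f) (x : E) :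
    ∫⁻ ω : G × E, f (‖ω.2‖ • act ω.1 x) ∂(lam.prod (stdGaussian E)) =
      ∫⁻ z, f (‖x‖ • z) ∂(stdGaussian E) := by
  have hm1 : Measurable fun ω : G × E => f (‖ω.2‖ • act ω.1 x) :=
    hf.comp (h.measurable_norm_smul x)
  have hm2 : Measurable fun ω : G × E => f (‖x‖ • act ω.1 ω.2) :=
    hf.comp (h.continuous.const_smul ‖x‖).measurable
  rw [lintegral_prod_symm _ hm1.aemeasurable]
  calc ∫⁻ z, ∫⁻ g, f (‖z‖ • act g x) ∂lam ∂(stdGaussian E)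
      = ∫⁻ z, ∫⁻ g, f (‖x‖ • act g z) ∂lam ∂(stdGaussian E) := by
        refine lintegral_congr fun z => ?_
        simp_rw [← map_smul]
        exact h.lintegral_eq f _ _ (by rw [norm_smul, norm_smul, norm_norm, norm_norm, mul_comm])
    _ = ∫⁻ g, ∫⁻ z, f (‖x‖ • act g z) ∂(stdGaussian E) ∂lam := by
        rw [← lintegral_prod_symm _ hm2.aemeasurable, lintegral_prod _ hm2.aemeasurable]
    _ = ∫⁻ _, ∫⁻ z, f (‖x‖ • z) ∂(stdGaussian E) ∂lam := by
        refine lintegral_congr fun g => ?_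
        have h2 : Measurable fun z : E => f (‖x‖ • z) := hf.comp (measurable_const_smul _)
        conv_rhs => rw [← stdGaussian_map (act g)]
        rw [lintegral_map h2 (act g).continuous.measurable]
    _ = _ := by simp

theorem IsRandomRotation.map_norm_smul (h : IsRandomRotation lam act) (x : E) :
    (lam.prod (stdGaussian E)).map (fun ω : G × E => ‖ω.2‖ • act ω.1 x) =
      (stdGaussian E).map (fun z => ‖x‖ • z) := by
  refine Measure.ext_of_lintegral _ fun f hf => ?_
  rw [lintegral_map hf (h.measurable_norm_smul x), lintegral_map hf (measurable_const_smul _)]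
  exact h.lintegral_norm_smul hf x

/-- The random map `x ↦ |z| J^* (g x)` from `E` to `W`. -/
def rotGaussMap (act : G → E ≃ₗᵢ[ℝ] E) (J : W →ₗᵢ[ℝ] E) (ω : G × E) (x : E) : W :=
  ‖ω.2‖ • J.toContinuousLinearMap.adjoint (act ω.1 x)

theorem IsRandomRotation.continuous_rotGaussMap (h : IsRandomRotation lam act)
    (J : W →ₗᵢ[ℝ] E) : Continuous fun p : (G × E) × E => rotGaussMap act J p.1 p.2 := by
  have h1 : Continuous fun p : (G × E) × E => (p.1.1, p.2) := by fun_prop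
  have h2 : Continuous fun p : (G × E) × E => act p.1.1 p.2 := h.continuous.comp h1
  have h3 : Continuous fun p : (G × E) × E => ‖p.1.2‖ := by fun_prop
  exact h3.smul (J.toContinuousLinearMap.adjoint.continuous.comp h2)

theorem rotGaussMap_sub (J : W →ₗᵢ[ℝ] E) (ω : G × E) (x y : E) :
    rotGaussMap act J ω (x - y) = rotGaussMap act J ω x - rotGaussMap act J ω y := by
  simp [rotGaussMap, smul_sub]

theorem IsRandomRotation.integral_exp_inner (h : IsRandomRotation lam act) (J : W →ₗᵢ[ℝ] E)
    (x : E) (ξ : W) :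
    ∫ ω, Complex.exp (((inner ℝ ξ (rotGaussMap act J ω x) : ℝ) : ℂ) * Complex.I)
      ∂(lam.prod (stdGaussian E)) = Complex.exp (-((‖x‖ ^ 2 * ‖ξ‖ ^ 2 / 2 : ℝ) : ℂ)) := by
  have hc : Continuous fun v : E => Complex.exp (((inner ℝ v (J ξ) : ℝ) : ℂ) * Complex.I) := by
    fun_prop
  have e0 : ∀ ω : G × E, inner ℝ ξ (rotGaussMap act J ω x) =
      inner ℝ (‖ω.2‖ • act ω.1 x) (J ξ) := by
    intro ω
    rw [rotGaussMap, ← map_smul, ContinuousLinearMap.adjoint_inner_right, real_inner_comm]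
    rfl
  simp_rw [e0]
  have e1 := integral_map (μ := lam.prod (stdGaussian E))
    (h.measurable_norm_smul x).aemeasurable hc.aestronglyMeasurable
  have e2 := integral_map (μ := stdGaussian E)
    (measurable_const_smul ‖x‖).aemeasurable hc.aestronglyMeasurable
  rw [h.map_norm_smul] at e1
  rw [← e1, e2]
  have e3 := charFun_stdGaussian (‖x‖ • J ξ)
  rw [charFun_apply] at e3
  simp only [real_inner_smul_left, real_inner_smul_right] at e3 ⊢
  rw [e3, norm_smul, norm_norm, LinearIsometry.norm_map]
  congr 1
  push_cast
  ring

end RandomRotation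

section RandomRotations

open ProbabilityTheory

variable {ι : Type*} [Fintype ι] {E : ι → Type*} [∀ i, NormedAddCommGroup (E i)]
  [∀ i, InnerProductSpace ℝ (E i)] [∀ i, FiniteDimensional ℝ (E i)]
  [∀ i, MeasurableSpace (E i)] [∀ i, BorelSpace (E i)]
  {W : ι → Type*} [∀ i, NormedAddCommGroup (W i)] [∀ i, InnerProductSpace ℝ (W i)]
  [∀ i, FiniteDimensional ℝ (W i)] [∀ i, MeasurableSpace (W i)] [∀ i, BorelSpace (W i)]
  {G : ι → Type*} [∀ i, TopologicalSpace (G i)] [∀ i, SecondCountableTopology (G i)]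
  [∀ i, MeasurableSpace (G i)] [∀ i, BorelSpace (G i)]
  {lam : ∀ i, Measure (G i)} [∀ i, IsProbabilityMeasure (lam i)]
  {act : ∀ i, G i → E i ≃ₗᵢ[ℝ] E i}

/-- Independence of the blocks factorises the characteristic function, and each factor is given by
`integral_exp_inner`. Nothing is needed about joint laws at several points. -/
theorem isGaussianFamily_rotGaussMap (h : ∀ i, IsRandomRotation (lam i) (act i))
    (J : ∀ i, W i →ₗᵢ[ℝ] E i) :
    IsGaussianFamily ((Measure.pi lam).prod (Measure.pi fun i => stdGaussian (E i)))
      (fun ω x i => rotGaussMap (act i) (J i) (ω.1 i, ω.2 i) (x i)) where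
  measurable := by
    refine measurable_pi_lambda _ fun i => ?_
    have h1 := ((h i).continuous_rotGaussMap (J i)).measurable
    have h2 : Measurable fun p : ((∀ i, G i) × (∀ i, E i)) × (∀ i, E i) =>
        ((p.1.1 i, p.1.2 i), p.2 i) :=
      (((measurable_pi_apply i).comp (measurable_fst.comp measurable_fst)).prodMk
        ((measurable_pi_apply i).comp (measurable_snd.comp measurable_fst))).prodMk
        ((measurable_pi_apply i).comp measurable_snd)
    exact Measurable.comp h1 h2
  map_sub ω x y := by
    funext i
    exact rotGaussMap_sub _ _ _ _
  integral_phase x ξ := by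
    set f : ∀ i, G i × E i → ℂ := fun i w => Complex.exp
      (((inner ℝ (ξ i) (rotGaussMap (act i) (J i) w (x i)) : ℝ) : ℂ) * Complex.I) with hf
    have hfm : ∀ i, Measurable (f i) := by
      intro i
      have h1 : Measurable fun w : G i × E i => rotGaussMap (act i) (J i) w (x i) :=
        ((h i).continuous_rotGaussMap (J i)).measurable.comp measurable_prodMk_right
      have h2 : Continuous fun v : W i =>
        Complex.exp (((inner ℝ (ξ i) v : ℝ) : ℂ) * Complex.I) := by fun_prop
      exact h2.measurable.comp h1
    have hf1 : ∀ i w, ‖f i w‖ = 1 := fun i w => Complex.norm_exp_ofReal_mul_I _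
    have h1 : ∀ ω : (∀ i, G i) × (∀ i, E i),
        phase ξ (fun i => rotGaussMap (act i) (J i) (ω.1 i, ω.2 i) (x i)) =
          ∏ i, f i (ω.1 i, ω.2 i) := by
      intro ω
      rw [phase, Complex.ofReal_sum, Finset.sum_mul, Complex.exp_sum]
    simp_rw [h1]
    rw [integral_prod]
    · have h2 : ∀ g : ∀ i, G i, ∫ z : ∀ i, E i, ∏ i, f i (g i, z i)
          ∂(Measure.pi fun i => stdGaussian (E i)) =
          ∏ i, ∫ z, f i (g i, z) ∂(stdGaussian (E i)) := fun g =>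
        integral_fintype_prod_eq_prod fun i z => f i (g i, z)
      simp_rw [h2]
      rw [integral_fintype_prod_eq_prod fun i g => ∫ z, f i (g, z) ∂(stdGaussian (E i))]
      have h3 : ∀ i, ∫ g, ∫ z, f i (g, z) ∂(stdGaussian (E i)) ∂(lam i) =
          Complex.exp (-((‖x i‖ ^ 2 * ‖ξ i‖ ^ 2 / 2 : ℝ) : ℂ)) := by
        intro i
        rw [← (h i).integral_exp_inner (J i) (x i) (ξ i), integral_prod]
        exact Integrable.mono' (integrable_const 1) (hfm i).aestronglyMeasurable
          (ae_of_all _ fun w => (hf1 i w).le)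
      simp_rw [h3]
      rw [← Complex.exp_sum, twistSq, Finset.sum_neg_distrib, Complex.ofReal_exp]
      congr 1
      push_cast
      rw [Finset.sum_div]
    · refine Integrable.mono' (integrable_const 1) (Measurable.aestronglyMeasurable ?_)
        (ae_of_all _ fun w => ?_)
      · refine Finset.measurable_prod _ fun i _ => (hfm i).comp ?_
        exact ((measurable_pi_apply i).comp measurable_fst).prodMk
          ((measurable_pi_apply i).comp measurable_snd)
      · rw [norm_prod]
        simp only [hf1]
        simp

end RandomRotations

/-! ### Haar measure on the orthogonal group as a random rotation. -/

section OrthogonalGroup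

variable {n : ℕ}

instance OrthGroup.instSecondCountableTopology : SecondCountableTopology (OrthGroup n) := by
  have : ProperSpace (EuclideanSpace ℝ (Fin n) →L[ℝ] EuclideanSpace ℝ (Fin n)) :=
    FiniteDimensional.proper ℝ _
  exact TopologicalSpace.Subtype.secondCountableTopology _

instance orthHaar.instIsProbabilityMeasure : IsProbabilityMeasure (orthHaar n) :=
  ⟨by simpa [orthHaar] using
    Measure.haarMeasure_self (K₀ := (⊤ : TopologicalSpace.PositiveCompacts (OrthGroup n)))⟩

instance orthHaar.instIsMulLeftInvariant : (orthHaar n).IsMulLeftInvariant := by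
  unfold orthHaar; infer_instance

/-- The action `x ↦ g⁻¹ x` of the orthogonal group. -/
def OrthGroup.invAct (g : OrthGroup n) :
    EuclideanSpace ℝ (Fin n) ≃ₗᵢ[ℝ] EuclideanSpace ℝ (Fin n) :=
  (Unitary.linearIsometryEquiv g).symm

theorem OrthGroup.continuous_invAct :
    Continuous fun p : OrthGroup n × EuclideanSpace ℝ (Fin n) => p.1.invAct p.2 := by
  have h : Continuous fun p : OrthGroup n × EuclideanSpace ℝ (Fin n) =>
      (star (p.1 : EuclideanSpace ℝ (Fin n) →L[ℝ] EuclideanSpace ℝ (Fin n))) p.2 := by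
    fun_prop
  exact h

theorem OrthGroup.invAct_mul (h g : OrthGroup n) (x : EuclideanSpace ℝ (Fin n)) :
    (h * g).invAct x = g.invAct (h.invAct x) := by
  simp only [invAct, map_mul]
  rfl

/-- The reflection in the hyperplane orthogonal to `u - v` exchanges vectors of equal norm. -/
theorem OrthGroup.exists_invAct_eq {u v : EuclideanSpace ℝ (Fin n)} (h : ‖u‖ = ‖v‖) :
    ∃ g : OrthGroup n, g.invAct u = v := by
  refine ⟨Unitary.linearIsometryEquiv.symm ((ℝ ∙ (u - v))ᗮ.reflection).symm, ?_⟩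
  simp only [invAct, MulEquiv.apply_symm_apply, LinearIsometryEquiv.symm_symm]
  exact Submodule.reflection_sub h

/-- For the inverse action left invariance suffices: replacing `g` by `h * g` turns `g⁻¹ u` into
`g⁻¹ (h⁻¹ u)`, and `h` is chosen with `h⁻¹ u = v`. -/
theorem isRandomRotation_invAct : IsRandomRotation (orthHaar n) OrthGroup.invAct where
  continuous := OrthGroup.continuous_invAct
  lintegral_eq F u v huv := by
    obtain ⟨h, hh⟩ := OrthGroup.exists_invAct_eq huv
    rw [← lintegral_mul_left_eq_self (fun g : OrthGroup n => F (g.invAct u)) h]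
    simp_rw [OrthGroup.invAct_mul, hh]

end OrthogonalGroup

/-! ### From Gaussian averages to rotation averages. -/

section RotationAverage

open ProbabilityTheory

theorem stdGaussian_closedBall_pos {E : Type*} [NormedAddCommGroup E] [InnerProductSpace ℝ E]
    [FiniteDimensional ℝ E] [MeasurableSpace E] [BorelSpace E] {r : ℝ} (hr : 0 < r) :
    0 < stdGaussian E (closedBall 0 r) := by
  have hv : (1 : ℝ≥0) ≠ 0 := one_ne_zero
  have : (gaussianReal 0 1).IsOpenPosMeasure :=
    (gaussianReal_absolutelyContinuous' 0 hv).isOpenPosMeasure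
  refine lt_of_lt_of_le ?_ (measure_mono ball_subset_closedBall)
  have hc : Continuous fun x : Fin (Module.finrank ℝ E) → ℝ =>
      ∑ i, x i • stdOrthonormalBasis ℝ E i := by fun_prop
  rw [stdGaussian, Measure.map_apply hc.measurable measurableSet_ball]
  refine (isOpen_ball.preimage hc).measure_pos _ ⟨0, ?_⟩
  simp [hr]

variable {ι : Type*} [Fintype ι] {E : ι → Type*} [∀ i, NormedAddCommGroup (E i)]
  [∀ i, InnerProductSpace ℝ (E i)] [∀ i, FiniteDimensional ℝ (E i)]
  [∀ i, MeasurableSpace (E i)] [∀ i, BorelSpace (E i)]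
  {W : ι → Type*} [∀ i, NormedAddCommGroup (W i)] [∀ i, InnerProductSpace ℝ (W i)]
  [∀ i, FiniteDimensional ℝ (W i)] [∀ i, MeasurableSpace (W i)] [∀ i, BorelSpace (W i)]
  {G : ι → Type*} [∀ i, TopologicalSpace (G i)] [∀ i, SecondCountableTopology (G i)]
  [∀ i, MeasurableSpace (G i)] [∀ i, BorelSpace (G i)]
  {lam : ∀ i, Measure (G i)} [∀ i, IsProbabilityMeasure (lam i)]
  {act : ∀ i, G i → E i ≃ₗᵢ[ℝ] E i}

theorem gaussKer_anti {t : ℝ} (ht : 0 < t) {z w : ∀ i, W i} (h : ∀ i, ‖z i‖ ≤ ‖w i‖) :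
    gaussKer t w ≤ gaussKer t z := by
  unfold gaussKer
  have : sqNorm z ≤ sqNorm w := Finset.sum_le_sum fun i _ => by
    have := h i; gcongr
  gcongr

/-- Gaussian kernels decrease with distance. This allows a radial factor of size at most `1` to be
dropped. -/
theorem maximalDensity_mono {X : Type*} [MeasurableSpace X] {b b' : X → ∀ i, W i} {μ : Measure X}
    {y : X} (h : ∀ x i, ‖b' x i - b' y i‖ ≤ ‖b x i - b y i‖) :
    maximalDensity b μ y ≤ maximalDensity b' μ y :=
  iSup_mono fun J => lintegral_mono fun x => ENNReal.ofReal_le_ofReal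
    (gaussKer_anti (by positivity) (h x))

/-- On the event that every `‖z i‖ ≤ 1`, of probability `Γ > 0` independent of the rotations, the
Gaussian map contracts the distances of the rotated projection, so its maximal density is larger.
Hence `Γ` times the rotation average is at most the Gaussian average. The constants are chosen
before `J`, because `J` will vary with the direction on the sphere. -/
theorem exists_lintegral_rotation_maximalDensity_le [Nonempty ι]
    (h : ∀ i, IsRandomRotation (lam i) (act i))
    (hW : ∀ i, 1 ≤ Module.finrank ℝ (W i))
    (hWE : ∀ i, Module.finrank ℝ (W i) < Module.finrank ℝ (E i)) {α β M : ℝ}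
    (hM : ∀ i, (Module.finrank ℝ (∀ i, E i) : ℝ) - Module.finrank ℝ (E i) +
      Module.finrank ℝ (W i) ≤ M)
    (hα : M < α) (hαβ : 2 * M - α < β) (hβ : ∀ i, M - Module.finrank ℝ (W i) < β) :
    ∃ (p : ℝ) (c : ℝ≥0∞) (F : ℝ), 1 < p ∧ c ≠ ∞ ∧ 0 ≤ F ∧
      ∀ (J : ∀ i, W i →ₗᵢ[ℝ] E i) (R : ℝ) (Cμ Cν : ℝ≥0), 1 ≤ R →
      ∀ (μ ν : Measure (∀ i, E i)) [IsFiniteMeasure μ] [IsFiniteMeasure ν],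
      (∀ x r, 0 < r → μ (ball x r) ≤ Cμ * ENNReal.ofReal (r ^ α)) →
      (∀ x r, 0 < r → ν (ball x r) ≤ Cν * ENNReal.ofReal (r ^ β)) →
      (∀ᵐ y ∂μ, ∀ᵐ x ∂μ, ∀ i, ‖x i - y i‖ ≤ R) →
      (∀ᵐ y ∂ν, ∀ᵐ x ∂ν, ∀ i, ‖x i - y i‖ ≤ R) →
      ∫⁻ g, ∫⁻ y, maximalDensity
          (fun x i => (J i).toContinuousLinearMap.adjoint (act i (g i) (x i))) μ y ^ p ∂ν
          ∂(Measure.pi lam) ≤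
        c * ENNReal.ofReal (2 * R) ^ F * (Cμ : ℝ≥0∞) ^ p * Cν := by
  obtain ⟨p, c, F, hp, hc, hF, hmain⟩ := exists_lintegral_maximalDensity_le
    ((Measure.pi lam).prod (Measure.pi fun i => stdGaussian (E i))) hW hWE hM hα hαβ hβ
  set Z : Set (∀ i, E i) := Set.univ.pi fun _ => closedBall 0 1
  set Γ : ℝ≥0∞ := (Measure.pi fun i => stdGaussian (E i)) Z with hΓ
  have hΓ0 : Γ ≠ 0 := by
    rw [hΓ, Measure.pi_pi]
    exact Finset.prod_ne_zero_iff.2 fun i _ => (stdGaussian_closedBall_pos one_pos).ne'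
  have hΓt : Γ ≠ ∞ := measure_ne_top _ _
  refine ⟨p, Γ⁻¹ * c, F, hp, ENNReal.mul_ne_top (ENNReal.inv_ne_top.2 hΓ0) hc, hF, ?_⟩
  intro J R Cμ Cν hR μ ν _ _ hμ hν hμR hνR
  have hB := isGaussianFamily_rotGaussMap h J
  have h1 := hmain _ hB R Cμ Cν hR μ ν hμ hν hμR hνR
  have hm : Measurable fun ω : (∀ i, G i) × (∀ i, E i) => ∫⁻ y, maximalDensity
      (fun x i => rotGaussMap (act i) (J i) (ω.1 i, ω.2 i) (x i)) μ y ^ p ∂ν :=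
    ((measurable_maximalDensity hB.measurable).pow_const p).lintegral_prod_right'
  rw [lintegral_prod _ hm.aemeasurable] at h1
  have h2 : Γ * ∫⁻ g, ∫⁻ y, maximalDensity
      (fun x i => (J i).toContinuousLinearMap.adjoint (act i (g i) (x i))) μ y ^ p ∂ν
      ∂(Measure.pi lam) ≤ c * ENNReal.ofReal (2 * R) ^ F * (Cμ : ℝ≥0∞) ^ p * Cν := by
    rw [← lintegral_const_mul' _ _ hΓt]
    refine le_trans (lintegral_mono fun g => ?_) h1
    rw [mul_comm, ← setLIntegral_const]
    refine le_trans (setLIntegral_mono' (MeasurableSet.univ_pi fun _ => measurableSet_closedBall)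
      fun z hz => ?_) (setLIntegral_le_lintegral Z _)
    refine lintegral_mono fun y => ENNReal.rpow_le_rpow (maximalDensity_mono fun x i => ?_)
      (by linarith)
    have hzi : ‖z i‖ ≤ 1 := by simpa using hz i (Set.mem_univ i)
    simp only [rotGaussMap]
    rw [← smul_sub, norm_smul, norm_norm]
    exact mul_le_of_le_one_left (norm_nonneg _) hzi
  calc _ = Γ⁻¹ * (Γ * ∫⁻ g, ∫⁻ y, maximalDensity
      (fun x i => (J i).toContinuousLinearMap.adjoint (act i (g i) (x i))) μ y ^ p ∂ν
      ∂(Measure.pi lam)) := by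
        rw [← mul_assoc, ENNReal.inv_mul_cancel hΓ0 hΓt, one_mul]
    _ ≤ Γ⁻¹ * (c * ENNReal.ofReal (2 * R) ^ F * (Cμ : ℝ≥0∞) ^ p * Cν) := by gcongr
    _ = _ := by ring

end RotationAverage

/-! ### Surface measure of spherical caps. -/

section Caps

open scoped Pointwise

/-- A constant such that the caps of radius `r ≤ 1` of a `(k - 1)`-dimensional unit sphere have
surface measure at least `capConst k * r ^ (k - 1)`. -/
def capConst (k : ℕ) : ℝ :=
  k * ((1 / 2) * (1 / 8) ^ k * (Real.sqrt Real.pi ^ k / Real.Gamma (k / 2 + 1)))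

theorem capConst_pos {k : ℕ} (hk : 1 ≤ k) : 0 < capConst k := by
  have : (0 : ℝ) < k := by exact_mod_cast hk
  have : 0 < Real.Gamma ((k : ℝ) / 2 + 1) := Real.Gamma_pos_of_pos (by positivity)
  unfold capConst
  positivity

variable {F : Type*} [NormedAddCommGroup F] [InnerProductSpace ℝ F] [FiniteDimensional ℝ F]
  [MeasurableSpace F] [BorelSpace F]

/-- The norm of `y` is within `r / 8` of `s`, so `y` is within `r / 4` of `‖y‖ • e`. Dividing by
`‖y‖ ≥ 3 / 8` gives a distance below `r` on the sphere. -/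
theorem ball_subset_Ioo_smul_cap (e : sphere (0 : F) 1) {r s : ℝ} (hr : 0 < r) (hr1 : r ≤ 1)
    (hs : 1 / 2 ≤ s) (hs' : s ≤ 3 / 4) :
    ball (s • (e : F)) (r / 8) ⊆ Set.Ioo (0 : ℝ) 1 • (Subtype.val '' ball e r) := by
  intro y hy
  rw [mem_ball, dist_eq_norm] at hy
  have he : ‖(e : F)‖ = 1 := by simp
  have hse : ‖s • (e : F)‖ = s := by rw [norm_smul, he, mul_one, Real.norm_of_nonneg (by linarith)]
  have h1 : |‖y‖ - s| < r / 8 := by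
    have := abs_norm_sub_norm_le y (s • (e : F))
    rw [hse] at this
    exact this.trans_lt hy
  rw [abs_lt] at h1
  have hy0 : 3 / 8 ≤ ‖y‖ := by linarith
  have hy1 : ‖y‖ < 1 := by linarith
  have hyp : 0 < ‖y‖ := by linarith
  refine Set.mem_smul.2 ⟨‖y‖, ⟨hyp, hy1⟩, ‖y‖⁻¹ • y, ⟨⟨‖y‖⁻¹ • y, ?_⟩, ?_, rfl⟩, ?_⟩
  · rw [mem_sphere_zero_iff_norm, norm_smul, norm_inv, norm_norm, inv_mul_cancel₀ hyp.ne']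
  · rw [mem_ball, Subtype.dist_eq, dist_eq_norm]
    have e1 : ‖y‖⁻¹ • y - (e : F) = ‖y‖⁻¹ • (y - ‖y‖ • (e : F)) := by
      rw [smul_sub, smul_smul, inv_mul_cancel₀ hyp.ne', one_smul]
    have e2 : ‖y - ‖y‖ • (e : F)‖ < r / 4 := by
      have : y - ‖y‖ • (e : F) = (y - s • (e : F)) + (s - ‖y‖) • (e : F) := by
        rw [sub_smul]; abel
      rw [this]
      refine (norm_add_le _ _).trans_lt ?_
      rw [norm_smul, he, mul_one, Real.norm_eq_abs]
      have : |s - ‖y‖| < r / 8 := by rw [abs_lt]; constructor <;> linarith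
      linarith
    rw [e1, norm_smul, norm_inv, norm_norm, inv_mul_lt_iff₀ hyp]
    nlinarith
  · rw [smul_smul, mul_inv_cancel₀ hyp.ne', one_smul]

theorem capConst_mul_le_toSphere [Nontrivial F] (e : sphere (0 : F) 1) {r : ℝ} (hr : 0 < r)
    (hr1 : r ≤ 1) :
    ENNReal.ofReal (capConst (Module.finrank ℝ F) * r ^ (Module.finrank ℝ F - 1)) ≤
      (volume : Measure F).toSphere (ball e r) := by
  set k := Module.finrank ℝ F with hk
  have hk1 : 1 ≤ k := Module.finrank_pos
  have he : ‖(e : F)‖ = 1 := by simp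
  -- The cone over the cap contains `N` disjoint balls of radius `r / 8`, with centres at spacing `r
  -- / 4` on the segment from `e / 2` to `3 e / 4`. The number `N ≥ 1 / (2r)` turns the volume `r ^
  -- k` of one ball into `r ^ (k - 1)`.
  set N := ⌊1 / r⌋₊ with hN
  have hN1 : 1 / (2 * r) ≤ N := by
    have h1 : 1 ≤ 1 / r := by rw [le_div_iff₀ hr]; linarith
    have h2 := Nat.lt_floor_add_one (1 / r)
    have h3 : 1 ≤ N := Nat.le_floor (by simpa using h1)
    have h4 : (1 : ℝ) ≤ N := by exact_mod_cast h3
    have h5 : 1 / (2 * r) = (1 / r) / 2 := by field_simp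
    rw [h5]; linarith
  have hN2 : (N : ℝ) * r ≤ 1 := by
    have := Nat.floor_le (by positivity : 0 ≤ 1 / r)
    rwa [le_div_iff₀ hr] at this
  set a : ℕ → F := fun j => (1 / 2 + j * (r / 4)) • (e : F) with ha
  have hsub : (⋃ j ∈ Finset.range N, ball (a j) (r / 8)) ⊆
      Set.Ioo (0 : ℝ) 1 • (Subtype.val '' ball e r) := by
    refine Set.iUnion₂_subset fun j hj => ball_subset_Ioo_smul_cap e hr hr1 ?_ ?_
    · have : 0 ≤ (j : ℝ) * (r / 4) := by positivity
      linarith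
    · have : (j : ℝ) ≤ N := by exact_mod_cast (Finset.mem_range.1 hj).le
      nlinarith
  have hdisj : (Finset.range N : Set ℕ).PairwiseDisjoint fun j => ball (a j) (r / 8) := by
    intro i _ j _ hij
    refine ball_disjoint_ball ?_
    rw [dist_eq_norm, ← sub_smul, norm_smul, he, mul_one, Real.norm_eq_abs,
      show 1 / 2 + (i : ℝ) * (r / 4) - (1 / 2 + j * (r / 4)) = ((i : ℤ) - (j : ℤ) : ℤ) * (r / 4) by
        push_cast; ring, abs_mul, abs_of_pos (by positivity : 0 < r / 4)]
    have : (1 : ℝ) ≤ |(((i : ℤ) - (j : ℤ) : ℤ) : ℝ)| := by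
      have h1 : (i : ℤ) - (j : ℤ) ≠ 0 := sub_ne_zero.2 (Nat.cast_injective.ne hij)
      have h2 := Int.one_le_abs h1
      rw [← Int.cast_abs]
      exact Int.cast_one (R := ℝ) ▸ Int.cast_le.2 h2
    nlinarith
  rw [Measure.toSphere_apply' _ measurableSet_ball, ← hk]
  refine le_trans ?_ (mul_le_mul_right (measure_mono hsub) _)
  rw [measure_biUnion_finset hdisj fun _ _ => measurableSet_ball]
  simp_rw [InnerProductSpace.volume_ball]
  rw [Finset.sum_const, Finset.card_range, nsmul_eq_mul, ← hk,
    ← ENNReal.ofReal_pow (by positivity), ← ENNReal.ofReal_natCast N, ← ENNReal.ofReal_natCast k]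
  have hG : 0 < Real.Gamma ((k : ℝ) / 2 + 1) := Real.Gamma_pos_of_pos (by positivity)
  rw [← ENNReal.ofReal_mul (by positivity), ← ENNReal.ofReal_mul (by positivity),
    ← ENNReal.ofReal_mul (by positivity)]
  refine ENNReal.ofReal_le_ofReal ?_
  set v := Real.sqrt Real.pi ^ k / Real.Gamma (k / 2 + 1) with hv
  have hv0 : 0 ≤ v := by positivity
  calc capConst k * r ^ (k - 1) = k * (1 / (2 * r) * ((r / 8) ^ k * v)) := by
        have : r ^ k = r ^ (k - 1) * r := by rw [← pow_succ, Nat.sub_add_cancel hk1]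
        rw [capConst, ← hv, div_pow, div_pow, one_pow, this]
        field_simp
    _ ≤ k * (N * ((r / 8) ^ k * v)) := by gcongr

theorem LinearIsometryEquiv.measurePreserving_sphere {F' : Type*} [NormedAddCommGroup F']
    [InnerProductSpace ℝ F'] [FiniteDimensional ℝ F'] [MeasurableSpace F'] [BorelSpace F']
    (φ : F ≃ₗᵢ[ℝ] F') :
    MeasurePreserving (fun e : sphere (0 : F) 1 =>
        (⟨φ e, by simp⟩ : sphere (0 : F') 1))
      (volume : Measure F).toSphere (volume : Measure F').toSphere := by
  have hc : Continuous fun e : sphere (0 : F) 1 => (⟨φ e, by simp⟩ : sphere (0 : F') 1) := by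
    fun_prop
  refine ⟨hc.measurable, Measure.ext fun s hs => ?_⟩
  rw [Measure.map_apply hc.measurable hs, Measure.toSphere_apply' _ hs,
    Measure.toSphere_apply' _ (hc.measurable hs), φ.toLinearEquiv.finrank_eq,
    ← φ.measurePreserving.measure_preimage_emb φ.toHomeomorph.measurableEmbedding]
  congr 2
  ext y
  simp only [Set.mem_smul, Set.mem_image, Set.mem_preimage, Subtype.exists, exists_and_right,
    exists_eq_right]
  constructor
  · rintro ⟨t, ht, z, ⟨hz, hzs⟩, rfl⟩
    exact ⟨t, ht, φ z, ⟨by simpa using hz, hzs⟩, by simp⟩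
  · rintro ⟨t, ht, z, ⟨hz, hzs⟩, hy⟩
    refine ⟨t, ht, φ.symm z, ⟨by simpa using hz, by simpa using hzs⟩, ?_⟩
    apply φ.injective
    simp [hy]

end Caps

/-! ### Projection along a direction. -/

section OrthogonalComplement

/-- The projection along a unit vector is given by the adjoint of an isometry from `ℝ^m`. -/
theorem exists_linearIsometry_norm_adjoint_eq {F : Type*} [NormedAddCommGroup F]
    [InnerProductSpace ℝ F] [FiniteDimensional ℝ F] {m : ℕ} (hm : Module.finrank ℝ F = m + 1)
    {θ : F} (hθ : ‖θ‖ = 1) :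
    ∃ K : EuclideanSpace ℝ (Fin m) →ₗᵢ[ℝ] F, ∀ q : F,
      ‖K.toContinuousLinearMap.adjoint q‖ = ‖q - inner ℝ θ q • θ‖ := by
  have hfact : Fact (Module.finrank ℝ F = m + 1) := ⟨hm⟩
  have hθ0 : θ ≠ 0 := by
    rintro rfl
    simp at hθ
  have hfin : Module.finrank ℝ (ℝ ∙ θ)ᗮ = m := Submodule.finrank_orthogonal_span_singleton hθ0
  let b := (stdOrthonormalBasis ℝ (ℝ ∙ θ)ᗮ).reindex (finCongr hfin)
  let K : EuclideanSpace ℝ (Fin m) →ₗᵢ[ℝ] F := (ℝ ∙ θ)ᗮ.subtypeₗᵢ.comp b.repr.symm.toLinearIsometry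
  have hKθ : ∀ a, inner ℝ θ (K a) = 0 := fun a =>
    Submodule.mem_orthogonal_singleton_iff_inner_right.1 (b.repr.symm a).2
  refine ⟨K, fun q => ?_⟩
  have hmem : q - inner ℝ θ q • θ ∈ (ℝ ∙ θ)ᗮ := by
    rw [Submodule.mem_orthogonal_singleton_iff_inner_right, inner_sub_right, inner_smul_right,
      real_inner_self_eq_norm_sq, hθ]
    ring
  have hK : K (b.repr ⟨_, hmem⟩) = q - inner ℝ θ q • θ := by
    simp [K]
  rw [← hK, LinearIsometry.norm_map]
  congr 1
  refine ext_inner_left ℝ fun a => ?_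
  rw [ContinuousLinearMap.adjoint_inner_right, ← K.inner_map_map, hK, inner_sub_right,
    inner_smul_right, real_inner_comm θ (K a), hKθ, mul_zero, sub_zero]
  rfl

end OrthogonalComplement

/-! ### Domination of radial projections by mollified densities. -/

section RadialDensity

open Filter

variable {ι : Type*} [Fintype ι] {F : ι → Type*}
  [∀ i, NormedAddCommGroup (F i)] [∀ i, InnerProductSpace ℝ (F i)]
  [∀ i, FiniteDimensional ℝ (F i)] [∀ i, MeasurableSpace (F i)] [∀ i, BorelSpace (F i)]

variable (F) in
/-- The dimension of the product of the unit spheres of the spaces `F i`. -/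
def sphereDim : ℝ := ∑ i, ((Module.finrank ℝ (F i) - 1 : ℕ) : ℝ)

/-- The Gaussian kernel of scale `√t` concentrated around the directions `± e i`. -/
def coneKer (t : ℝ) (u : ∀ i, F i) (e : ∀ i, sphere (0 : F i) 1) : ℝ :=
  (2 * Real.pi / t) ^ (sphereDim F / 2) *
    Real.exp (-((∑ i, ‖u i - inner ℝ (e i : F i) (u i) • (e i : F i)‖ ^ 2) / (2 * t)))

/-- The supremum of the mollified densities of the radial projection of `μ` centred at `w`. -/
def coneDensity (w : ∀ i, F i) (μ : Measure (∀ i, F i)) (e : ∀ i, sphere (0 : F i) 1) : ℝ≥0∞ :=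
  ⨆ J : ℕ, ∫⁻ z, ENNReal.ofReal (coneKer ((1 / 2) ^ J) (z - w) e) ∂μ

variable (F) in
/-- The constant comparing radial projections with their mollified densities. -/
def radialConst : ℝ :=
  ((∏ i, capConst (Module.finrank ℝ (F i))) * (2 * Real.pi) ^ (sphereDim F / 2) *
    Real.exp (-(Fintype.card ι / 2)))⁻¹

theorem radialConst_pos [∀ i, Nontrivial (F i)] : 0 < radialConst F := by
  have : 0 < ∏ i, capConst (Module.finrank ℝ (F i)) :=
    Finset.prod_pos fun i _ => capConst_pos Module.finrank_pos
  unfold radialConst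
  positivity

theorem continuous_coneKer (t : ℝ) :
    Continuous fun p : (∀ i, F i) × (∀ i, sphere (0 : F i) 1) => coneKer t p.1 p.2 := by
  unfold coneKer
  fun_prop

theorem norm_sub_inner_smul_le {E : Type*} [NormedAddCommGroup E] [InnerProductSpace ℝ E]
    {e : E} (he : ‖e‖ = 1) (u : E) (c : ℝ) : ‖u - inner ℝ e u • e‖ ≤ ‖u - c • e‖ := by
  refine (sq_le_sq₀ (norm_nonneg _) (norm_nonneg _)).1 ?_
  rw [@norm_sub_sq_real, @norm_sub_sq_real, norm_smul, norm_smul, he, inner_smul_right,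
    inner_smul_right, real_inner_comm e u, Real.norm_eq_abs, Real.norm_eq_abs, mul_one, mul_one,
    sq_abs, sq_abs]
  nlinarith [sq_nonneg (c - inner ℝ e u)]

/-- The distance from `u = z i - w i` to the line spanned by `e i` is at most `‖u - ‖u‖ • e i‖`,
which is `‖u‖ ≤ R` times the distance between `e i` and the direction of `u`. So it is at most `√t`,
and each block costs at most a factor `exp (-1 / 2)`. -/
theorem coneKer_ge {t R : ℝ} (ht : 0 < t) (hR : 0 < R) {w : ∀ i, F i}
    (z : {z : ∀ i, F i // ∀ i, z i ≠ w i}) (hz : ∀ i, ‖z.1 i - w i‖ ≤ R)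
    {e : ∀ i, sphere (0 : F i) 1} (he : e ∈ ball (radialProj w z) (Real.sqrt t / R)) :
    (2 * Real.pi / t) ^ (sphereDim F / 2) * Real.exp (-(Fintype.card ι / 2)) ≤
      coneKer t (z.1 - w) e := by
  rw [mem_ball, dist_pi_lt_iff (by positivity)] at he
  have h1 : ∀ i, ‖(z.1 - w) i - inner ℝ (e i : F i) ((z.1 - w) i) • (e i : F i)‖ ^ 2 ≤ t := by
    intro i
    have hei : ‖(e i : F i)‖ = 1 := by simp
    have h2 := norm_sub_inner_smul_le hei ((z.1 - w) i) ‖z.1 i - w i‖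
    have hpos : 0 < ‖z.1 i - w i‖ := norm_pos_iff.2 (sub_ne_zero.2 (z.2 i))
    have h3 : (z.1 - w) i - ‖z.1 i - w i‖ • (e i : F i) =
        ‖z.1 i - w i‖ • ((radialProj w z i : F i) - (e i : F i)) := by
      simp only [radialProj, Pi.sub_apply]
      rw [smul_sub, smul_smul, mul_inv_cancel₀ hpos.ne', one_smul]
    have h4 : ‖(radialProj w z i : F i) - (e i : F i)‖ ≤ Real.sqrt t / R := by
      have := he i
      rw [dist_comm, Subtype.dist_eq, dist_eq_norm] at this
      exact this.le
    rw [h3, norm_smul, norm_norm] at h2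
    have h5 : ‖z.1 i - w i‖ * ‖(radialProj w z i : F i) - (e i : F i)‖ ≤ Real.sqrt t := by
      calc _ ≤ R * (Real.sqrt t / R) := by
            have := hz i
            gcongr
        _ = _ := by field_simp
    calc _ ≤ Real.sqrt t ^ 2 := by
          have := h2.trans h5
          gcongr
      _ = t := Real.sq_sqrt ht.le
  unfold coneKer
  refine mul_le_mul_of_nonneg_left (Real.exp_le_exp.2 (neg_le_neg ?_)) (by positivity)
  rw [div_le_div_iff₀ (by positivity) (by positivity)]
  have := Finset.sum_le_sum fun i (_ : i ∈ Finset.univ) => h1 i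
  simp only [Finset.sum_const, Finset.card_univ, nsmul_eq_mul] at this
  nlinarith

theorem prodSurface_ball_ge [∀ i, Nontrivial (F i)] (e : ∀ i, sphere (0 : F i) 1) {r : ℝ}
    (hr : 0 < r) (hr1 : r ≤ 1) :
    ENNReal.ofReal ((∏ i, capConst (Module.finrank ℝ (F i))) * r ^ sphereDim F) ≤
      prodSurface F (ball e r) := by
  rw [ball_pi _ hr, prodSurface, Measure.pi_pi, sphereDim, Real.rpow_sum_of_pos hr,
    ← Finset.prod_mul_distrib, ENNReal.ofReal_prod_of_nonneg]
  · refine Finset.prod_le_prod' fun i _ => ?_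
    rw [Real.rpow_natCast]
    exact capConst_mul_le_toSphere (e i) hr hr1
  · intro i _
    have := (capConst_pos (Module.finrank_pos (R := ℝ) (M := F i))).le
    positivity

instance prodSurface.instIsFiniteMeasure : IsFiniteMeasure (prodSurface F) := by
  unfold prodSurface; infer_instance

/-- The kernel has size at least of order `t ^ (-sphereDim / 2)` on a cap of radius `√t / R`, whose
measure is at least of order `(√t / R) ^ sphereDim`. The powers of `t` cancel and only that of `R`
survives. -/
theorem one_le_setLIntegral_coneKer [∀ i, Nontrivial (F i)] {t R : ℝ} (ht : 0 < t) (ht1 : t ≤ 1)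
    (hR : 1 ≤ R) {w : ∀ i, F i} (z : {z : ∀ i, F i // ∀ i, z i ≠ w i})
    (hz : ∀ i, ‖z.1 i - w i‖ ≤ R) {U : Set (∀ i, sphere (0 : F i) 1)}
    (hU : ball (radialProj w z) (Real.sqrt t / R) ⊆ U) :
    1 ≤ ENNReal.ofReal (radialConst F * R ^ sphereDim F) *
      ∫⁻ e in U, ENNReal.ofReal (coneKer t (z.1 - w) e) ∂(prodSurface F) := by
  have hR0 : 0 < R := by linarith
  have hC := radialConst_pos (F := F)
  have hr1 : Real.sqrt t / R ≤ 1 := by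
    rw [div_le_one hR0]
    exact (Real.sqrt_le_one.2 ht1).trans hR
  have hst : 0 < Real.sqrt t := Real.sqrt_pos.2 ht
  have hcap := prodSurface_ball_ge (radialProj w z) (r := Real.sqrt t / R) (by positivity) hr1
  have h1 : ENNReal.ofReal ((2 * Real.pi / t) ^ (sphereDim F / 2) *
        Real.exp (-(Fintype.card ι / 2))) *
        prodSurface F (ball (radialProj w z) (Real.sqrt t / R)) ≤
      ∫⁻ e in U, ENNReal.ofReal (coneKer t (z.1 - w) e) ∂(prodSurface F) := by
    rw [← setLIntegral_const]
    refine (setLIntegral_mono' measurableSet_ball fun e he => ?_).trans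
      (lintegral_mono_set hU)
    exact ENNReal.ofReal_le_ofReal (coneKer_ge ht hR0 z hz he)
  have hcp : 0 < ∏ i, capConst (Module.finrank ℝ (F i)) :=
    Finset.prod_pos fun i _ => capConst_pos Module.finrank_pos
  calc (1 : ℝ≥0∞) = ENNReal.ofReal (radialConst F * R ^ sphereDim F) *
        (ENNReal.ofReal ((2 * Real.pi / t) ^ (sphereDim F / 2) *
        Real.exp (-(Fintype.card ι / 2))) * ENNReal.ofReal
          ((∏ i, capConst (Module.finrank ℝ (F i))) * (Real.sqrt t / R) ^ sphereDim F)) := by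
        rw [← ENNReal.ofReal_mul (by positivity), ← ENNReal.ofReal_mul (by positivity),
          ← ENNReal.ofReal_one]
        congr 1
        have e1 : Real.sqrt t ^ sphereDim F = t ^ (sphereDim F / 2) := by
          rw [Real.sqrt_eq_rpow, ← Real.rpow_mul ht.le]
          ring_nf
        rw [radialConst, Real.div_rpow hst.le hR0.le, e1, Real.div_rpow (by positivity) ht.le]
        have := (Real.rpow_pos_of_pos ht (sphereDim F / 2)).ne'
        have := (Real.rpow_pos_of_pos hR0 (sphereDim F)).ne'
        have := hcp.ne'
        have : (2 * Real.pi) ^ (sphereDim F / 2) ≠ 0 :=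
          (Real.rpow_pos_of_pos (by positivity) _).ne'
        field_simp
    _ ≤ _ := by gcongr; exact (mul_le_mul_right hcap _).trans h1

theorem measurable_coneDensity (w : ∀ i, F i) (μ : Measure (∀ i, F i)) [SFinite μ] :
    Measurable (coneDensity w μ) := by
  refine Measurable.iSup fun J => ?_
  have h1 : Continuous fun p : (∀ i, sphere (0 : F i) 1) × (∀ i, F i) =>
      coneKer ((1 / 2) ^ J) (p.2 - w) p.1 := by
    have h2 : Continuous fun p : (∀ i, sphere (0 : F i) 1) × (∀ i, F i) => (p.2 - w, p.1) := by
      fun_prop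
    simpa only [Function.comp_def] using Continuous.comp (continuous_coneKer ((1 / 2) ^ J)) h2
  exact h1.measurable.ennreal_ofReal.lintegral_prod_right'

theorem measurable_radialProj (w : ∀ i, F i) : Measurable (radialProj w) := by
  refine measurable_pi_lambda _ fun i => Measurable.subtype_mk ?_
  have h : Measurable fun z : {z : ∀ i, F i // ∀ i, z i ≠ w i} => z.1 i - w i :=
    ((measurable_pi_apply i).comp measurable_subtype_coe).sub_const _
  exact h.norm.inv.smul h

/-- A small cap about a direction in the open set `U` stays inside `U`, so the indicator of `U`
along the projection is at most the liminf of its smoothed versions as the scale tends to `0`. Fatou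
and Tonelli then bring in the densities, each at most their supremum `coneDensity`. -/
theorem radialPush_isOpen_le [∀ i, Nontrivial (F i)] {w : ∀ i, F i} {μ : Measure (∀ i, F i)}
    [IsFiniteMeasure μ] {R : ℝ} (hR : 1 ≤ R) (hμ : ∀ᵐ z ∂μ, ∀ i, ‖z i - w i‖ ≤ R)
    {U : Set (∀ i, sphere (0 : F i) 1)} (hU : IsOpen U) :
    radialPush w μ U ≤ ENNReal.ofReal (radialConst F * R ^ sphereDim F) *
      ∫⁻ e in U, coneDensity w μ e ∂(prodSurface F) := by
  set K := ENNReal.ofReal (radialConst F * R ^ sphereDim F) with hK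
  set Φ : ℕ → (∀ i, F i) → ℝ≥0∞ := fun J z =>
    K * ∫⁻ e in U, ENNReal.ofReal (coneKer ((1 / 2) ^ J) (z - w) e) ∂(prodSurface F) with hΦ
  have hker : ∀ J : ℕ, Measurable fun p : (∀ i, F i) × (∀ i, sphere (0 : F i) 1) =>
      ENNReal.ofReal (coneKer ((1 / 2) ^ J) (p.1 - w) p.2) := by
    intro J
    have h2 : Continuous fun p : (∀ i, F i) × (∀ i, sphere (0 : F i) 1) => (p.1 - w, p.2) := by
      fun_prop
    exact ((continuous_coneKer _).comp h2).measurable.ennreal_ofReal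
  have hΦm : ∀ J, Measurable (Φ J) := fun J => (hker J).lintegral_prod_right'.const_mul K
  have hS : MeasurableSet {z : ∀ i, F i | ∀ i, z i ≠ w i} := by
    rw [Set.ofPred_forall]
    exact MeasurableSet.iInter fun i => (measurableSet_singleton (w i)).compl.preimage
      (measurable_pi_apply i)
  have hemb : MeasurableEmbedding
      (Subtype.val : {z : ∀ i, F i // ∀ i, z i ≠ w i} → ∀ i, F i) :=
    MeasurableEmbedding.subtype_coe hS
  have hμ' : ∀ᵐ z ∂(μ.comap (Subtype.val : {z : ∀ i, F i // ∀ i, z i ≠ w i} → ∀ i, F i)),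
      ∀ i, ‖z.1 i - w i‖ ≤ R := by
    have h1 : ∀ᵐ z ∂((μ.comap (Subtype.val : {z : ∀ i, F i // ∀ i, z i ≠ w i} → ∀ i, F i)).map
        Subtype.val), ∀ i, ‖z i - w i‖ ≤ R := by
      rw [hemb.map_comap]
      exact ae_restrict_of_ae hμ
    exact ae_of_ae_map hemb.measurable.aemeasurable h1
  have hlim : ∀ z : {z : ∀ i, F i // ∀ i, z i ≠ w i}, (∀ i, ‖z.1 i - w i‖ ≤ R) →
      U.indicator 1 (radialProj w z) ≤ liminf (fun J => Φ J z.1) atTop := by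
    intro z hz
    by_cases hzU : radialProj w z ∈ U
    · rw [Set.indicator_of_mem hzU, Pi.one_apply]
      obtain ⟨ε, hε, hεU⟩ := Metric.isOpen_iff.1 hU _ hzU
      refine le_liminf_of_le (by isBoundedDefault) ?_
      have ht : Tendsto (fun J : ℕ => Real.sqrt ((1 / 2) ^ J) / R) atTop (nhds 0) := by
        have h0 : Tendsto (fun J : ℕ => ((1 : ℝ) / 2) ^ J) atTop (nhds 0) :=
          tendsto_pow_atTop_nhds_zero_of_lt_one (by norm_num) (by norm_num)
        have h1 := (Real.continuous_sqrt.tendsto 0).comp h0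
        rw [Real.sqrt_zero] at h1
        simpa using h1.div_const R
      filter_upwards [ht.eventually (gt_mem_nhds hε)] with J hJ
      exact one_le_setLIntegral_coneKer (by positivity)
        (pow_le_one₀ (by norm_num) (by norm_num)) hR z hz ((ball_subset_ball hJ.le).trans hεU)
    · rw [Set.indicator_of_notMem hzU]
      exact zero_le
  have hmono : ∀ J, ∫⁻ z, Φ J z ∂μ ≤ K * ∫⁻ e in U, coneDensity w μ e ∂(prodSurface F) := by
    intro J
    rw [hΦ, lintegral_const_mul _ (hker J).lintegral_prod_right',
      lintegral_lintegral_swap (hker J).aemeasurable]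
    gcongr with e
    exact le_iSup (fun J : ℕ => ∫⁻ z, ENNReal.ofReal (coneKer ((1 / 2) ^ J) (z - w) e) ∂μ) J
  calc radialPush w μ U
      = ∫⁻ z, U.indicator 1 (radialProj w z) ∂(μ.comap Subtype.val) := by
        rw [radialPush, ← lintegral_indicator_one hU.measurableSet,
          lintegral_map (measurable_one.indicator hU.measurableSet) (measurable_radialProj w)]
    _ ≤ ∫⁻ z : {z : ∀ i, F i // ∀ i, z i ≠ w i}, liminf (fun J => Φ J z.1) atTop
          ∂(μ.comap Subtype.val) := by
        refine lintegral_mono_ae ?_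
        filter_upwards [hμ'] with z hz using hlim z hz
    _ = ∫⁻ z, liminf (fun J => Φ J z) atTop
          ∂((μ.comap (Subtype.val : {z : ∀ i, F i // ∀ i, z i ≠ w i} → ∀ i, F i)).map
            Subtype.val) := by
        rw [hemb.lintegral_map]
    _ ≤ ∫⁻ z, liminf (fun J => Φ J z) atTop ∂μ := by
        rw [hemb.map_comap]
        exact setLIntegral_le_lintegral _ _
    _ ≤ liminf (fun J => ∫⁻ z, Φ J z ∂μ) atTop := lintegral_liminf_le hΦm
    _ ≤ liminf (fun _ : ℕ => K * ∫⁻ e in U, coneDensity w μ e ∂(prodSurface F)) atTop :=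
        liminf_le_liminf (Eventually.of_forall hmono)
    _ = _ := liminf_const _

end RadialDensity

/-! ### From domination on open sets to `L^p` norms. -/

section DensityBound

/-- A measure dominated on open sets by `f σ` has `L^p` norm at most that of `f`. -/
theorem measureLpNorm_rpow_le {Y : Type*} [MeasurableSpace Y] [TopologicalSpace Y]
    [TopologicalSpace.PseudoMetrizableSpace Y] [BorelSpace Y]
    {p : ℝ} (hp : 1 < p) {ρ σ : Measure Y} [IsFiniteMeasure ρ] [IsFiniteMeasure σ]
    {f : Y → ℝ≥0∞}
    (h : ∀ U, IsOpen U → ρ U ≤ ∫⁻ y in U, f y ∂σ) :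
    measureLpNorm p ρ σ ^ p ≤ ∫⁻ y, f y ^ p ∂σ := by
  rcases eq_or_ne (∫⁻ y, f y ^ p ∂σ) ∞ with htop | htop
  · rw [htop]; exact le_top
  -- The inequality `f ≤ 1 + f ^ p` makes `f σ` finite, hence outer regular, which extends the
  -- domination from open sets to all sets.
  have hint : ∫⁻ y, f y ∂σ ≠ ∞ := by
    have h1 : ∫⁻ y, f y ∂σ ≤ ∫⁻ y, (1 + f y ^ p) ∂σ := by
      refine lintegral_mono fun y => ?_
      rcases le_total (f y) 1 with h1 | h1
      · exact h1.trans le_self_add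
      · exact (ENNReal.le_rpow_self_of_one_le h1 hp.le).trans le_add_self
    rw [lintegral_add_left measurable_const] at h1
    refine ne_top_of_le_ne_top (ENNReal.add_ne_top.2 ⟨?_, htop⟩) h1
    simp
  have : IsFiniteMeasure (σ.withDensity f) := isFiniteMeasure_withDensity hint
  have hle : ρ ≤ σ.withDensity f := by
    refine Measure.le_iff.2 fun s _ => le_of_forall_gt fun r hr => ?_
    obtain ⟨U, hsU, hU, hUr⟩ := s.exists_isOpen_lt_of_lt r hr
    calc ρ s ≤ ρ U := measure_mono hsU
      _ ≤ σ.withDensity f U := by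
        rw [withDensity_apply _ hU.measurableSet]; exact h U hU
      _ < r := hUr
  have hac : ρ ≪ σ := (Measure.absolutelyContinuous_of_le hle).trans
    (withDensity_absolutelyContinuous σ f)
  have hrn : ρ.rnDeriv σ ≤ᵐ[σ] f := by
    refine ae_le_of_forall_setLIntegral_le_of_sigmaFinite
      (Measure.measurable_rnDeriv ρ σ) fun s hs _ => ?_
    rw [Measure.setLIntegral_rnDeriv hac, ← withDensity_apply _ hs]
    exact hle s
  rw [measureLpNorm, if_pos hac, ← ENNReal.rpow_mul, one_div_mul_cancel (by linarith),
    ENNReal.rpow_one]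
  refine lintegral_mono_ae ?_
  filter_upwards [hrn] with y hy
  exact ENNReal.rpow_le_rpow hy (by linarith)

end DensityBound

section RadialNorm

variable {ι : Type*} [Fintype ι] {F : ι → Type*}
  [∀ i, NormedAddCommGroup (F i)] [∀ i, InnerProductSpace ℝ (F i)]
  [∀ i, FiniteDimensional ℝ (F i)] [∀ i, MeasurableSpace (F i)] [∀ i, BorelSpace (F i)]

theorem measureLpNorm_radialPush_rpow_le [∀ i, Nontrivial (F i)] {p : ℝ} (hp : 1 < p)
    {w : ∀ i, F i} {μ : Measure (∀ i, F i)} [IsFiniteMeasure μ] {R : ℝ} (hR : 1 ≤ R)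
    (hμ : ∀ᵐ z ∂μ, ∀ i, ‖z i - w i‖ ≤ R) :
    measureLpNorm p (radialPush w μ) (prodSurface F) ^ p ≤
      ENNReal.ofReal (radialConst F * R ^ sphereDim F) ^ p *
        ∫⁻ e, coneDensity w μ e ^ p ∂(prodSurface F) := by
  have hm := measurable_coneDensity w μ
  have : IsFiniteMeasure (radialPush w μ) := by
    unfold radialPush; infer_instance
  refine (measureLpNorm_rpow_le hp (σ := prodSurface F)
    (f := fun θ => ENNReal.ofReal (radialConst F * R ^ sphereDim F) * coneDensity w μ θ)
    fun U hU => ?_).trans (le_of_eq ?_)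
  · rw [lintegral_const_mul _ hm]
    exact radialPush_isOpen_le hR hμ hU
  · rw [← lintegral_const_mul _ (hm.pow_const p)]
    refine lintegral_congr fun e => ?_
    rw [ENNReal.mul_rpow_of_nonneg _ _ (by linarith)]

end RadialNorm

/-! ### Averaging the mollified radial densities over rotations. -/

section ConeDensityAverage

variable {ι : Type*} [Fintype ι] {E : ι → Type*} [∀ i, NormedAddCommGroup (E i)]
  [∀ i, InnerProductSpace ℝ (E i)] [∀ i, FiniteDimensional ℝ (E i)]
  [∀ i, MeasurableSpace (E i)] [∀ i, BorelSpace (E i)]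
  {F : ι → Type*} [∀ i, NormedAddCommGroup (F i)] [∀ i, InnerProductSpace ℝ (F i)]
  [∀ i, FiniteDimensional ℝ (F i)] [∀ i, MeasurableSpace (F i)] [∀ i, BorelSpace (F i)]
  {G : ι → Type*} [∀ i, TopologicalSpace (G i)] [∀ i, SecondCountableTopology (G i)]
  [∀ i, MeasurableSpace (G i)] [∀ i, BorelSpace (G i)]
  {lam : ∀ i, Measure (G i)} [∀ i, IsProbabilityMeasure (lam i)]
  {act : ∀ i, G i → E i ≃ₗᵢ[ℝ] E i}

/-- The projection `x ↦ (I i^* (g i) (x i))_i`. -/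
def rotProj (act : ∀ i, G i → E i ≃ₗᵢ[ℝ] E i) (I : ∀ i, F i →ₗᵢ[ℝ] E i) (g : ∀ i, G i)
    (x : ∀ i, E i) (i : ι) : F i :=
  (I i).toContinuousLinearMap.adjoint (act i (g i) (x i))

theorem continuous_rotProj (h : ∀ i, IsRandomRotation (lam i) (act i))
    (I : ∀ i, F i →ₗᵢ[ℝ] E i) :
    Continuous fun p : (∀ i, G i) × (∀ i, E i) => rotProj act I p.1 p.2 := by
  refine continuous_pi fun i => (I i).toContinuousLinearMap.adjoint.continuous.comp ?_
  have h1 : Continuous fun p : (∀ i, G i) × (∀ i, E i) => (p.1 i, p.2 i) := by fun_prop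
  simpa only [Function.comp_def] using (h i).continuous.comp h1

theorem continuous_rotProj_right (I : ∀ i, F i →ₗᵢ[ℝ] E i) (g : ∀ i, G i) :
    Continuous (rotProj act I g) :=
  continuous_pi fun i => (I i).toContinuousLinearMap.adjoint.continuous.comp
    ((act i (g i)).continuous.comp (continuous_apply i))

theorem coneDensity_map {μ : Measure (∀ i, E i)} {b : (∀ i, E i) → ∀ i, F i} (hb : Measurable b)
    (w : ∀ i, F i) (θ : ∀ i, sphere (0 : F i) 1) :
    coneDensity w (μ.map b) θ =
      ⨆ J : ℕ, ∫⁻ x, ENNReal.ofReal (coneKer ((1 / 2) ^ J) (b x - w) θ) ∂μ := by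
  unfold coneDensity
  congr 1
  funext J
  rw [lintegral_map _ hb]
  have h1 : Continuous fun z : ∀ i, F i => (z - w, θ) := by fun_prop
  have h2 : Continuous fun z : ∀ i, F i => coneKer ((1 / 2) ^ J) (z - w) θ := by
    simpa only [Function.comp_def] using Continuous.comp (continuous_coneKer ((1 / 2) ^ J)) h1
  exact h2.measurable.ennreal_ofReal

theorem measurable_coneDensity_rotProj (h : ∀ i, IsRandomRotation (lam i) (act i))
    (I : ∀ i, F i →ₗᵢ[ℝ] E i) (μ : Measure (∀ i, E i)) [SFinite μ] :
    Measurable fun q : ((∀ i, G i) × (∀ i, E i)) × (∀ i, sphere (0 : F i) 1) =>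
      coneDensity (rotProj act I q.1.1 q.1.2) (μ.map (rotProj act I q.1.1)) q.2 := by
  simp_rw [fun g => coneDensity_map (μ := μ)
    (continuous_rotProj_right (act := act) I g).measurable]
  refine Measurable.iSup fun J => ?_
  have h1 : Continuous fun r : (((∀ i, G i) × (∀ i, E i)) × (∀ i, sphere (0 : F i) 1)) ×
      (∀ i, E i) => (r.1.1.1, r.2) := by fun_prop
  have h2 : Continuous fun r : (((∀ i, G i) × (∀ i, E i)) × (∀ i, sphere (0 : F i) 1)) ×
      (∀ i, E i) => (r.1.1.1, r.1.1.2) := by fun_prop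
  have h3 : Continuous fun r : (((∀ i, G i) × (∀ i, E i)) × (∀ i, sphere (0 : F i) 1)) ×
      (∀ i, E i) => (rotProj act I r.1.1.1 r.2 - rotProj act I r.1.1.1 r.1.1.2, r.1.2) :=
    (((continuous_rotProj h I).comp h1).sub ((continuous_rotProj h I).comp h2)).prodMk
      (by fun_prop)
  have h4 : Continuous fun r : (((∀ i, G i) × (∀ i, E i)) × (∀ i, sphere (0 : F i) 1)) ×
      (∀ i, E i) => coneKer ((1 / 2) ^ J)
        (rotProj act I r.1.1.1 r.2 - rotProj act I r.1.1.1 r.1.1.2) r.1.2 := by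
    simpa only [Function.comp_def] using Continuous.comp (continuous_coneKer ((1 / 2) ^ J)) h3
  exact h4.measurable.ennreal_ofReal.lintegral_prod_right'

/-- Removing the `θ i` component of a vector amounts, in norm, to projecting onto the hyperplane
orthogonal to `θ i`, and two successive projections compose to the adjoint of one isometric
embedding. Radial projections in dimension `k` thus become linear projections of rank `k - 1`. -/
theorem exists_coneDensity_eq_maximalDensity (hF : ∀ i, 1 ≤ Module.finrank ℝ (F i))
    (I : ∀ i, F i →ₗᵢ[ℝ] E i) (θ : ∀ i, sphere (0 : F i) 1) :
    ∃ J : ∀ i, EuclideanSpace ℝ (Fin (Module.finrank ℝ (F i) - 1)) →ₗᵢ[ℝ] E i,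
      ∀ (g : ∀ i, G i) (μ : Measure (∀ i, E i)) (y : ∀ i, E i),
      coneDensity (rotProj act I g y) (μ.map (rotProj act I g)) θ =
        maximalDensity (rotProj act J g) μ y := by
  have hK : ∀ i, ∃ K : EuclideanSpace ℝ (Fin (Module.finrank ℝ (F i) - 1)) →ₗᵢ[ℝ] F i, ∀ q : F i,
      ‖K.toContinuousLinearMap.adjoint q‖ = ‖q - inner ℝ (θ i : F i) q • (θ i : F i)‖ := fun i =>
    exists_linearIsometry_norm_adjoint_eq (Nat.sub_add_cancel (hF i)).symm (by simp)
  choose K hK using hK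
  refine ⟨fun i => (I i).comp (K i), fun g μ y => ?_⟩
  rw [coneDensity_map (continuous_rotProj_right (act := act) I g).measurable]
  unfold maximalDensity mollified
  congr 1
  funext J
  refine lintegral_congr fun x => ?_
  congr 1
  unfold coneKer gaussKer
  have e1 : ∀ (x : ∀ i, E i) i, rotProj act (fun i => (I i).comp (K i)) g x i =
      (K i).toContinuousLinearMap.adjoint (rotProj act I g x i) := by
    intro x i
    refine ext_inner_left ℝ fun a => ?_
    rw [rotProj, rotProj, ContinuousLinearMap.adjoint_inner_right,
      ContinuousLinearMap.adjoint_inner_right, ContinuousLinearMap.adjoint_inner_right]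
    rfl
  have e2 : sqNorm (rotProj act (fun i => (I i).comp (K i)) g x -
      rotProj act (fun i => (I i).comp (K i)) g y) =
      ∑ i, ‖(rotProj act I g x - rotProj act I g y) i -
        inner ℝ (θ i : F i) ((rotProj act I g x - rotProj act I g y) i) • (θ i : F i)‖ ^ 2 := by
    refine Finset.sum_congr rfl fun i _ => ?_
    rw [← hK, Pi.sub_apply, Pi.sub_apply, e1, e1, map_sub]
  rw [e2, sphereDim]
  simp only [finrank_euclideanSpace_fin]

/-- The integral over `θ` is moved outermost. For each fixed `θ` the estimate for rank `dim (F i) -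
1` applies with constants independent of the embedding, and the spheres have finite measure. The
lost dimension accounts for the `- 1` in the condition on `M`. -/
theorem exists_lintegral_coneDensity_le [Nonempty ι]
    (h : ∀ i, IsRandomRotation (lam i) (act i))
    (hF : ∀ i, 2 ≤ Module.finrank ℝ (F i))
    (hFE : ∀ i, Module.finrank ℝ (F i) ≤ Module.finrank ℝ (E i)) {α β M : ℝ}
    (hM : ∀ i, (Module.finrank ℝ (∀ i, E i) : ℝ) - Module.finrank ℝ (E i) +
      Module.finrank ℝ (F i) - 1 ≤ M)
    (hα : M < α) (hαβ : 2 * M - α < β) (hβ : ∀ i, M - ((Module.finrank ℝ (F i) : ℝ) - 1) < β)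
    (I : ∀ i, F i →ₗᵢ[ℝ] E i) :
    ∃ (p : ℝ) (c : ℝ≥0∞) (N : ℝ), 1 < p ∧ c ≠ ∞ ∧ 0 ≤ N ∧
      ∀ (R : ℝ) (Cμ Cν : ℝ≥0), 1 ≤ R →
      ∀ (μ ν : Measure (∀ i, E i)) [IsFiniteMeasure μ] [IsFiniteMeasure ν],
      (∀ x r, 0 < r → μ (ball x r) ≤ Cμ * ENNReal.ofReal (r ^ α)) →
      (∀ x r, 0 < r → ν (ball x r) ≤ Cν * ENNReal.ofReal (r ^ β)) →
      (∀ᵐ y ∂μ, ∀ᵐ x ∂μ, ∀ i, ‖x i - y i‖ ≤ R) →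
      (∀ᵐ y ∂ν, ∀ᵐ x ∂ν, ∀ i, ‖x i - y i‖ ≤ R) →
      ∫⁻ g, ∫⁻ y, ∫⁻ θ, coneDensity (rotProj act I g y) (μ.map (rotProj act I g)) θ ^ p
          ∂(prodSurface F) ∂ν ∂(Measure.pi lam) ≤
        c * ENNReal.ofReal (2 * R) ^ N * (Cμ : ℝ≥0∞) ^ p * Cν := by
  have hcast : ∀ i, ((Module.finrank ℝ (F i) - 1 : ℕ) : ℝ) = Module.finrank ℝ (F i) - 1 :=
    fun i => by rw [Nat.cast_sub (by have := hF i; omega)]; simp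
  obtain ⟨p, c, N, hp, hc, hN, hmain⟩ := exists_lintegral_rotation_maximalDensity_le
    (W := fun i => EuclideanSpace ℝ (Fin (Module.finrank ℝ (F i) - 1))) h
    (fun i => by rw [finrank_euclideanSpace_fin]; have := hF i; omega)
    (fun i => by rw [finrank_euclideanSpace_fin]; have := hF i; have := hFE i; omega)
    (α := α) (β := β) (M := M)
    (fun i => by rw [finrank_euclideanSpace_fin, hcast]; have := hM i; linarith) hα hαβ
    (fun i => by rw [finrank_euclideanSpace_fin, hcast]; exact hβ i)
  refine ⟨p, prodSurface F Set.univ * c, N, hp, ENNReal.mul_ne_top (measure_ne_top _ _) hc, hN, ?_⟩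
  intro R Cμ Cν hR μ ν _ _ hμ hν hμR hνR
  have hm := (measurable_coneDensity_rotProj h I μ).pow_const p
  have e1 : ∫⁻ g, ∫⁻ y, ∫⁻ θ, coneDensity (rotProj act I g y) (μ.map (rotProj act I g)) θ ^ p
          ∂(prodSurface F) ∂ν ∂(Measure.pi lam) =
      ∫⁻ θ, ∫⁻ g, ∫⁻ y, coneDensity (rotProj act I g y) (μ.map (rotProj act I g)) θ ^ p
          ∂ν ∂(Measure.pi lam) ∂(prodSurface F) := by
    rw [← lintegral_prod (μ := Measure.pi lam) (ν := ν) (fun q =>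
      ∫⁻ θ, coneDensity (rotProj act I q.1 q.2) (μ.map (rotProj act I q.1)) θ ^ p ∂(prodSurface F))
      hm.lintegral_prod_right'.aemeasurable, lintegral_lintegral_swap hm.aemeasurable]
    refine lintegral_congr fun θ => ?_
    exact lintegral_prod _ (hm.comp measurable_prodMk_right).aemeasurable
  rw [e1]
  calc _ ≤ ∫⁻ _ : ∀ i, sphere (0 : F i) 1,
        c * ENNReal.ofReal (2 * R) ^ N * (Cμ : ℝ≥0∞) ^ p * Cν ∂(prodSurface F) := by
        refine lintegral_mono fun θ => ?_
        obtain ⟨J, hJ⟩ := exists_coneDensity_eq_maximalDensity (act := act)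
          (fun i => by have := hF i; omega) I θ
        simp_rw [hJ]
        exact hmain J R Cμ Cν hR μ ν hμ hν hμR hνR
    _ = _ := by rw [lintegral_const]; ring

end ConeDensityAverage

/-! ### Interpolation with the total mass. -/

section Interpolation

theorem lintegral_rpow_le_of_isFiniteMeasure {Y : Type*} [MeasurableSpace Y] (ν : Measure Y)
    {τ : ℝ} (hτ0 : 0 ≤ τ) (hτ1 : τ ≤ 1) {f : Y → ℝ≥0∞} (hf : AEMeasurable f ν) :
    ∫⁻ y, f y ^ τ ∂ν ≤ (∫⁻ y, f y ∂ν) ^ τ * ν Set.univ ^ (1 - τ) := by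
  have := ENNReal.lintegral_mul_norm_pow_le (μ := ν) hf (aemeasurable_const (b := (1 : ℝ≥0∞)))
    hτ0 (by linarith : 0 ≤ 1 - τ) (by ring)
  simpa using this

/-- Interpolation between the total mass and an `L^q` norm of a measure. -/
theorem measureLpNorm_rpow_le_mul {Y : Type*} [MeasurableSpace Y] {ρ σ : Measure Y}
    [IsFiniteMeasure ρ] [IsFiniteMeasure σ] {p q τ : ℝ} (hq : 1 < q) (hτ0 : 0 < τ) (hτ1 : τ < 1)
    (hp : p = (1 - τ) + q * τ) :
    measureLpNorm p ρ σ ^ p ≤ ρ Set.univ ^ (1 - τ) * (measureLpNorm q ρ σ ^ q) ^ τ := by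
  have hp0 : 0 < p := by rw [hp]; nlinarith
  by_cases hac : ρ ≪ σ
  · rw [measureLpNorm, measureLpNorm, if_pos hac, if_pos hac, ← ENNReal.rpow_mul,
      ← ENNReal.rpow_mul _ _ q, one_div_mul_cancel hp0.ne', one_div_mul_cancel (by linarith),
      ENNReal.rpow_one, ENNReal.rpow_one]
    have hm := Measure.measurable_rnDeriv ρ σ
    calc ∫⁻ y, ρ.rnDeriv σ y ^ p ∂σ
        = ∫⁻ y, ρ.rnDeriv σ y ^ (1 - τ) * (ρ.rnDeriv σ y ^ q) ^ τ ∂σ := by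
          refine lintegral_congr fun y => ?_
          rw [← ENNReal.rpow_mul, ← ENNReal.rpow_add_of_nonneg _ _ (by linarith) (by positivity),
            hp]
      _ ≤ (∫⁻ y, ρ.rnDeriv σ y ∂σ) ^ (1 - τ) * (∫⁻ y, ρ.rnDeriv σ y ^ q ∂σ) ^ τ :=
          ENNReal.lintegral_mul_norm_pow_le hm.aemeasurable (hm.pow_const q).aemeasurable
            (by linarith) hτ0.le (by ring)
      _ ≤ _ := by
          gcongr
          exact Measure.lintegral_rnDeriv_le
  -- A measure that is not absolutely continuous is nonzero, so the right side is infinite in this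
  -- case.
  · have h0 : ρ Set.univ ≠ 0 := by
      intro h0
      rw [Measure.measure_univ_eq_zero] at h0
      exact hac (h0 ▸ Measure.AbsolutelyContinuous.zero σ)
    have h1 : ρ Set.univ ^ (1 - τ) ≠ 0 := by
      rw [ne_eq, ENNReal.rpow_eq_zero_iff]
      simp [h0]
    rw [measureLpNorm, measureLpNorm, if_neg hac, if_neg hac,
      ENNReal.top_rpow_of_pos (by linarith : 0 < q), ENNReal.top_rpow_of_pos hτ0,
      ENNReal.mul_top h1]
    exact le_top

/-- Hölder against constants is used twice: in `y` with exponent `τ`, then in `ω` with exponent `τ /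
p ≤ 1`, where `P` has mass one. -/
theorem lintegral_lintegral_rpow_le {Ω Y : Type*} [MeasurableSpace Ω] [MeasurableSpace Y]
    (P : Measure Ω) [IsProbabilityMeasure P] (ν : Measure Y) [SFinite ν] {p τ : ℝ} (hp : 1 ≤ p)
    (hτ0 : 0 < τ) (hτ1 : τ < 1) {m : ℝ≥0∞} {A : Ω × Y → ℝ≥0∞} (hA : Measurable A)
    {N : Ω → Y → ℝ≥0∞} (hN : ∀ ω, ∀ᵐ y ∂ν, N ω y ≤ m ^ (1 - τ) * A (ω, y) ^ τ) :
    ∫⁻ ω, (∫⁻ y, N ω y ∂ν) ^ (1 / p) ∂P ≤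
      (m ^ (1 - τ) * ν Set.univ ^ (1 - τ)) ^ (1 / p) *
        (∫⁻ ω, ∫⁻ y, A (ω, y) ∂ν ∂P) ^ (τ / p) := by
  have hp0 : 0 < p := by linarith
  have hAω : ∀ ω, Measurable fun y => A (ω, y) := fun ω => hA.comp measurable_prodMk_left
  have hAm : Measurable fun ω => ∫⁻ y, A (ω, y) ∂ν := hA.lintegral_prod_right'
  have hτp0 : 0 < τ / p := by positivity
  have hτp1 : τ / p ≤ 1 := by rw [div_le_one hp0]; linarith
  have h1 : ∀ ω, (∫⁻ y, N ω y ∂ν) ^ (1 / p) ≤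
      (m ^ (1 - τ) * ν Set.univ ^ (1 - τ)) ^ (1 / p) * (∫⁻ y, A (ω, y) ∂ν) ^ (τ / p) := by
    intro ω
    have h2 : ∫⁻ y, N ω y ∂ν ≤
        (m ^ (1 - τ) * ν Set.univ ^ (1 - τ)) * (∫⁻ y, A (ω, y) ∂ν) ^ τ := by
      calc ∫⁻ y, N ω y ∂ν ≤ ∫⁻ y, m ^ (1 - τ) * A (ω, y) ^ τ ∂ν := lintegral_mono_ae (hN ω)
        _ = m ^ (1 - τ) * ∫⁻ y, A (ω, y) ^ τ ∂ν :=
            lintegral_const_mul _ ((hAω ω).pow_const τ)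
        _ ≤ m ^ (1 - τ) * ((∫⁻ y, A (ω, y) ∂ν) ^ τ * ν Set.univ ^ (1 - τ)) := by
            gcongr
            exact lintegral_rpow_le_of_isFiniteMeasure ν hτ0.le hτ1.le (hAω ω).aemeasurable
        _ = _ := by ring
    refine (ENNReal.rpow_le_rpow h2 (by positivity)).trans (le_of_eq ?_)
    rw [ENNReal.mul_rpow_of_nonneg _ _ (by positivity), ← ENNReal.rpow_mul, mul_one_div]
  calc _ ≤ ∫⁻ ω, (m ^ (1 - τ) * ν Set.univ ^ (1 - τ)) ^ (1 / p) *
        (∫⁻ y, A (ω, y) ∂ν) ^ (τ / p) ∂P := lintegral_mono h1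
    _ = (m ^ (1 - τ) * ν Set.univ ^ (1 - τ)) ^ (1 / p) *
        ∫⁻ ω, (∫⁻ y, A (ω, y) ∂ν) ^ (τ / p) ∂P :=
        lintegral_const_mul _ (hAm.pow_const _)
    _ ≤ _ := by
        gcongr
        have := lintegral_rpow_le_of_isFiniteMeasure P hτp0.le hτp1 hAm.aemeasurable
        simpa using this

end Interpolation

/-! ### Transport to varying target spaces. -/

section IsometricTransport

variable {ι : Type*} [Fintype ι] {F : ι → Type*}
  [∀ i, NormedAddCommGroup (F i)] [∀ i, InnerProductSpace ℝ (F i)]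
  [∀ i, FiniteDimensional ℝ (F i)] [∀ i, MeasurableSpace (F i)] [∀ i, BorelSpace (F i)]
  {F' : ι → Type*}
  [∀ i, NormedAddCommGroup (F' i)] [∀ i, InnerProductSpace ℝ (F' i)]
  [∀ i, FiniteDimensional ℝ (F' i)] [∀ i, MeasurableSpace (F' i)] [∀ i, BorelSpace (F' i)]

theorem sphereDim_eq (φ : ∀ i, F i ≃ₗᵢ[ℝ] F' i) : sphereDim F' = sphereDim F := by
  simp only [sphereDim, fun i => (φ i).toLinearEquiv.finrank_eq]

theorem radialConst_eq (φ : ∀ i, F i ≃ₗᵢ[ℝ] F' i) : radialConst F' = radialConst F := by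
  simp only [radialConst, sphereDim_eq φ, fun i => (φ i).toLinearEquiv.finrank_eq]

theorem coneKer_map (φ : ∀ i, F i ≃ₗᵢ[ℝ] F' i) (t : ℝ) (u : ∀ i, F i)
    (e : ∀ i, sphere (0 : F i) 1) :
    coneKer t (fun i => φ i (u i)) (fun i => ⟨φ i (e i), by simp⟩) = coneKer t u e := by
  unfold coneKer
  simp only [sphereDim_eq φ, LinearIsometryEquiv.inner_map_map]
  have h : ∀ i, ‖φ i (u i) - inner ℝ (e i : F i) (u i) • φ i (e i)‖ =
      ‖u i - inner ℝ (e i : F i) (u i) • (e i : F i)‖ := fun i => by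
    rw [← map_smul, ← map_sub, LinearIsometryEquiv.norm_map]
  simp only [h]

theorem lintegral_coneDensity_map (φ : ∀ i, F i ≃ₗᵢ[ℝ] F' i) (w : ∀ i, F i)
    (μ : Measure (∀ i, F i)) [IsFiniteMeasure μ] (p : ℝ) :
    ∫⁻ e, coneDensity (fun i => φ i (w i)) (μ.map fun z i => φ i (z i)) e ^ p ∂(prodSurface F') =
      ∫⁻ e, coneDensity w μ e ^ p ∂(prodSurface F) := by
  have hφ : Measurable fun (z : ∀ i, F i) i => φ i (z i) :=
    measurable_pi_lambda _ fun i => (φ i).continuous.measurable.comp (measurable_pi_apply i)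
  have hmp : MeasurePreserving (fun (e : ∀ i, sphere (0 : F i) 1) i =>
      (⟨φ i (e i), by simp⟩ : sphere (0 : F' i) 1)) (prodSurface F) (prodSurface F') :=
    measurePreserving_pi _ _ fun i => (φ i).measurePreserving_sphere
  rw [← hmp.lintegral_comp ((measurable_coneDensity _ _).pow_const p)]
  refine lintegral_congr fun e => ?_
  rw [coneDensity_map hφ, coneDensity]
  congr 2
  funext J
  refine lintegral_congr fun z => ?_
  rw [← coneKer_map φ]
  congr 3
  funext i
  simp

/-- The target spaces `F'` will vary with the rotation. Isometry invariance expresses the bound on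
the fixed model `F`, independently of `φ`, where it can be integrated over the rotations. -/
theorem measureLpNorm_radialPush_map_rpow_le [∀ i, Nontrivial (F' i)]
    (φ : ∀ i, F i ≃ₗᵢ[ℝ] F' i) {p : ℝ} (hp : 1 < p)
    {w : ∀ i, F i} {μ : Measure (∀ i, F i)} [IsFiniteMeasure μ] {R : ℝ} (hR : 1 ≤ R)
    (hμ : ∀ᵐ z ∂μ, ∀ i, ‖z i - w i‖ ≤ R) :
    measureLpNorm p (radialPush (fun i => φ i (w i)) (μ.map fun z i => φ i (z i)))
        (prodSurface F') ^ p ≤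
      ENNReal.ofReal (radialConst F * R ^ sphereDim F) ^ p *
        ∫⁻ e, coneDensity w μ e ^ p ∂(prodSurface F) := by
  have hφ : Continuous fun (z : ∀ i, F i) i => φ i (z i) :=
    continuous_pi fun i => (φ i).continuous.comp (continuous_apply i)
  have hμ' : ∀ᵐ z ∂(μ.map fun z i => φ i (z i)), ∀ i, ‖z i - φ i (w i)‖ ≤ R := by
    have hS : MeasurableSet {z : ∀ i, F' i | ∀ i, ‖z i - φ i (w i)‖ ≤ R} := by
      rw [Set.ofPred_forall]
      exact MeasurableSet.iInter fun i => measurableSet_le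
        ((measurable_pi_apply i).sub_const _).norm measurable_const
    rw [ae_map_iff hφ.measurable.aemeasurable hS]
    filter_upwards [hμ] with z hz i
    rw [← map_sub, LinearIsometryEquiv.norm_map]
    exact hz i
  have h := measureLpNorm_radialPush_rpow_le hp hR hμ'
  rwa [radialConst_eq φ, sphereDim_eq φ, lintegral_coneDensity_map] at h

theorem radialPush_univ_le (w : ∀ i, F i) (μ : Measure (∀ i, F i)) :
    radialPush w μ Set.univ ≤ μ Set.univ := by
  have hS : MeasurableSet {z : ∀ i, F i | ∀ i, z i ≠ w i} := by
    rw [Set.ofPred_forall]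
    exact MeasurableSet.iInter fun i => (measurableSet_singleton (w i)).compl.preimage
      (measurable_pi_apply i)
  have hemb : MeasurableEmbedding
      (Subtype.val : {z : ∀ i, F i // ∀ i, z i ≠ w i} → ∀ i, F i) :=
    MeasurableEmbedding.subtype_coe hS
  rw [radialPush, Measure.map_apply (measurable_radialProj w) MeasurableSet.univ,
    hemb.comap_apply]
  exact measure_mono (Set.subset_univ _)

theorem isFiniteMeasure_radialPush (w : ∀ i, F i) (μ : Measure (∀ i, F i)) [IsFiniteMeasure μ] :
    IsFiniteMeasure (radialPush w μ) :=
  ⟨(radialPush_univ_le w μ).trans_lt (measure_lt_top μ _)⟩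

end IsometricTransport

/-! ### Bookkeeping of constants. -/

section Constants

/-- Homogeneity fixes the exponents: `a` receives `(1 - τ) / p + q τ / p = 1` and `b` receives `1 /
p`. The power of `Q` is `L τ / p ≤ 1`, so the size of `L` no longer shows. -/
theorem rpow_mul_rpow_interpolation_le {m n A a b Q S : ℝ≥0∞} {p q τ L : ℝ} (hq : 1 < q)
    (hτ0 : 0 < τ) (hτ1 : τ < 1) (hp : p = (1 - τ) + q * τ) (hL : L * τ ≤ 1)
    (hA : 1 ≤ A) (hQ : 1 ≤ Q) (hm : m ≤ a * A) (hn : n ≤ b * A) (hS : S ≤ Q ^ L * a ^ q * b) :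
    (m ^ (1 - τ) * n ^ (1 - τ)) ^ (1 / p) * S ^ (τ / p) ≤ Q * A ^ 2 * a * b ^ (1 / p) := by
  have hp1 : 1 < p := by rw [hp]; nlinarith
  have hp0 : 0 < p := by linarith
  have h1τ : 0 ≤ 1 - τ := by linarith
  have hs : 0 ≤ (1 - τ) / p := by positivity
  have ht : 0 ≤ τ / p := by positivity
  have ht1 : τ / p ≤ τ := div_le_self hτ0.le hp1.le
  have hs1 : (1 - τ) / p ≤ 1 := by rw [div_le_one hp0]; linarith
  have ea : a ^ ((1 - τ) / p) * a ^ (q * (τ / p)) = a := by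
    rw [← ENNReal.rpow_add_of_nonneg _ _ hs (by positivity),
      show (1 - τ) / p + q * (τ / p) = p / p by rw [hp]; ring, div_self hp0.ne', ENNReal.rpow_one]
  have eb : b ^ ((1 - τ) / p) * b ^ (τ / p) = b ^ (1 / p) := by
    rw [← ENNReal.rpow_add_of_nonneg _ _ hs ht]
    congr 1
    ring
  have eQ : Q ^ (L * (τ / p)) ≤ Q := by
    calc Q ^ (L * (τ / p)) ≤ Q ^ (1 : ℝ) := by
          refine ENNReal.rpow_le_rpow_of_exponent_le hQ ?_
          nlinarith
      _ = Q := ENNReal.rpow_one Q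
  have eA : A ^ ((1 - τ) / p) ≤ A := by
    calc A ^ ((1 - τ) / p) ≤ A ^ (1 : ℝ) := ENNReal.rpow_le_rpow_of_exponent_le hA hs1
      _ = A := ENNReal.rpow_one A
  calc (m ^ (1 - τ) * n ^ (1 - τ)) ^ (1 / p) * S ^ (τ / p)
      ≤ ((a * A) ^ (1 - τ) * (b * A) ^ (1 - τ)) ^ (1 / p) * (Q ^ L * a ^ q * b) ^ (τ / p) := by
        gcongr
    _ = (Q ^ (L * (τ / p))) * (A ^ ((1 - τ) / p) * A ^ ((1 - τ) / p)) *
          (a ^ ((1 - τ) / p) * a ^ (q * (τ / p))) * (b ^ ((1 - τ) / p) * b ^ (τ / p)) := by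
        rw [ENNReal.mul_rpow_of_nonneg _ _ (by positivity : 0 ≤ 1 / p), ← ENNReal.rpow_mul,
          ← ENNReal.rpow_mul, mul_one_div, ENNReal.mul_rpow_of_nonneg _ _ hs,
          ENNReal.mul_rpow_of_nonneg _ _ hs, ENNReal.mul_rpow_of_nonneg _ _ ht,
          ENNReal.mul_rpow_of_nonneg _ _ ht, ← ENNReal.rpow_mul, ← ENNReal.rpow_mul]
        ring
    _ ≤ Q * (A * A) * a * b ^ (1 / p) := by
        rw [ea, eb]
        gcongr
    _ = _ := by ring

theorem exists_le_two_pow_of_ne_top {B : ℝ≥0∞} (hB : B ≠ ∞) : ∃ n : ℕ, B ≤ 2 ^ n := by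
  obtain ⟨n, hn⟩ := pow_unbounded_of_one_lt B.toReal (one_lt_two : (1 : ℝ) < 2)
  refine ⟨n, ?_⟩
  rw [← ENNReal.ofReal_toReal hB]
  refine (ENNReal.ofReal_le_ofReal hn.le).trans (le_of_eq ?_)
  rw [ENNReal.ofReal_pow (by norm_num)]
  simp

end Constants

/-! ### The radial estimate averaged over rotations. -/

section RotationGeneral

variable {ι : Type*} [Fintype ι] {E : ι → Type*} [∀ i, NormedAddCommGroup (E i)]
  [∀ i, InnerProductSpace ℝ (E i)] [∀ i, FiniteDimensional ℝ (E i)]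
  [∀ i, MeasurableSpace (E i)] [∀ i, BorelSpace (E i)]
  {F : ι → Type*} [∀ i, NormedAddCommGroup (F i)] [∀ i, InnerProductSpace ℝ (F i)]
  [∀ i, FiniteDimensional ℝ (F i)] [∀ i, MeasurableSpace (F i)] [∀ i, BorelSpace (F i)]
  {G : ι → Type*} [∀ i, TopologicalSpace (G i)] [∀ i, SecondCountableTopology (G i)]
  [∀ i, MeasurableSpace (G i)] [∀ i, BorelSpace (G i)]
  {lam : ∀ i, Measure (G i)} [∀ i, IsProbabilityMeasure (lam i)]
  {act : ∀ i, G i → E i ≃ₗᵢ[ℝ] E i}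

theorem norm_rotProj_sub_le (I : ∀ i, F i →ₗᵢ[ℝ] E i) (g : ∀ i, G i) (x y : ∀ i, E i) (i : ι) :
    ‖rotProj act I g x i - rotProj act I g y i‖ ≤ ‖x i - y i‖ := by
  rw [rotProj, rotProj, ← map_sub, ← map_sub]
  refine (ContinuousLinearMap.le_opNorm _ _).trans ?_
  rw [LinearIsometryEquiv.map_sub, ← LinearIsometryEquiv.map_sub, LinearIsometryEquiv.norm_map,
    LinearIsometryEquiv.norm_map]
  exact mul_le_of_le_one_left (norm_nonneg _) (LinearIsometry.norm_toContinuousLinearMap_le _)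

theorem exists_lintegral_measureLpNorm_rotProj_le [Nonempty ι]
    (h : ∀ i, IsRandomRotation (lam i) (act i))
    (hF : ∀ i, 2 ≤ Module.finrank ℝ (F i))
    (hFE : ∀ i, Module.finrank ℝ (F i) ≤ Module.finrank ℝ (E i)) {α β M : ℝ}
    (hM : ∀ i, (Module.finrank ℝ (∀ i, E i) : ℝ) - Module.finrank ℝ (E i) +
      Module.finrank ℝ (F i) - 1 ≤ M)
    (hα : M < α) (hαβ : 2 * M - α < β) (hβ : ∀ i, M - ((Module.finrank ℝ (F i) : ℝ) - 1) < β)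
    (I : ∀ i, F i →ₗᵢ[ℝ] E i) (k : ℝ≥0) {F' : (∀ i, G i) → ι → Type*}
    [∀ g i, NormedAddCommGroup (F' g i)] [∀ g i, InnerProductSpace ℝ (F' g i)]
    [∀ g i, FiniteDimensional ℝ (F' g i)] [∀ g i, MeasurableSpace (F' g i)]
    [∀ g i, BorelSpace (F' g i)] (φ : ∀ g i, F i ≃ₗᵢ[ℝ] F' g i) :
    ∃ p : ℝ, 1 < p ∧
      ∀ (R : ℝ) (Cμ Cν : ℝ≥0) (A : ℝ≥0∞), 1 ≤ R → 1 ≤ A →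
      ∀ (μ ν : Measure (∀ i, E i)) [IsFiniteMeasure μ] [IsFiniteMeasure ν],
      (∀ x r, 0 < r → μ (ball x r) ≤ (k * Cμ : ℝ≥0) * ENNReal.ofReal (r ^ α)) →
      (∀ x r, 0 < r → ν (ball x r) ≤ (k * Cν : ℝ≥0) * ENNReal.ofReal (r ^ β)) →
      (∀ᵐ y ∂μ, ∀ᵐ x ∂μ, ∀ i, ‖x i - y i‖ ≤ R) →
      (∀ᵐ y ∂ν, ∀ᵐ x ∂ν, ∀ i, ‖x i - y i‖ ≤ R) →
      (∀ᵐ y ∂ν, ∀ᵐ x ∂μ, ∀ i, ‖x i - y i‖ ≤ R) →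
      μ Set.univ ≤ Cμ * A → ν Set.univ ≤ Cν * A →
      ∫⁻ g, (∫⁻ y, measureLpNorm p
          (radialPush (fun i => φ g i (rotProj act I g y i))
            (μ.map fun x i => φ g i (rotProj act I g x i)))
          (prodSurface (F' g)) ^ p ∂ν) ^ (1 / p) ∂(Measure.pi lam) ≤
        ENNReal.ofReal (2 * R) * A ^ 2 * Cμ * (Cν : ℝ≥0∞) ^ (1 / p) := by
  obtain ⟨q, c, N, hq, hc, hN, hmain⟩ := exists_lintegral_coneDensity_le h hF hFE hM hα hαβ hβ I
  have hnt : ∀ i, Nontrivial (F i) := fun i =>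
    Module.nontrivial_of_finrank_pos (R := ℝ) (by have := hF i; omega)
  have hnt' : ∀ g i, Nontrivial (F' g i) := fun g i => (φ g i).symm.toEquiv.nontrivial
  have hrc := radialConst_pos (F := F)
  have hsd : 0 ≤ sphereDim F := Finset.sum_nonneg fun _ _ => by positivity
  set B : ℝ≥0∞ := ENNReal.ofReal (radialConst F) ^ q * c * (k : ℝ≥0∞) ^ q * k with hB
  have hBt : B ≠ ∞ := by
    refine ENNReal.mul_ne_top (ENNReal.mul_ne_top (ENNReal.mul_ne_top ?_ hc) ?_)
      ENNReal.coe_ne_top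
    · exact ENNReal.rpow_ne_top_of_nonneg (by linarith) ENNReal.ofReal_ne_top
    · exact ENNReal.rpow_ne_top_of_nonneg (by linarith) ENNReal.coe_ne_top
  -- The constant `B` depends on `α`, `β` and the dimensions. Since `2R ≥ 2`, it is at most `(2R) ^
  -- n` and joins the powers of `2R`.
  obtain ⟨n, hn⟩ := exists_le_two_pow_of_ne_top hBt
  set L : ℝ := n + (sphereDim F * q + N) with hL
  have hL0 : 0 ≤ L := by positivity
  -- Small enough that `(2R) ^ L` enters with total power at most one; the price is an exponent `p`
  -- close to `1`.
  set τ : ℝ := 1 / (L + 2) with hτ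
  have hτ0 : 0 < τ := by positivity
  have hτ1 : τ < 1 := by rw [hτ, div_lt_one (by positivity)]; linarith
  have hLτ : L * τ ≤ 1 := by rw [hτ, mul_one_div, div_le_one (by positivity)]; linarith
  set p : ℝ := (1 - τ) + q * τ with hp
  have hp1 : 1 < p := by rw [hp]; nlinarith
  refine ⟨p, hp1, ?_⟩
  intro R Cμ Cν A hR hA μ ν _ _ hμ hν hμR hνR hR' hμA hνA
  set Q := ENNReal.ofReal (2 * R) with hQ
  have hQ1 : 1 ≤ Q := by rw [hQ, ENNReal.one_le_ofReal]; linarith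
  set K := ENNReal.ofReal (radialConst F * R ^ sphereDim F) with hK
  set D : (∀ i, G i) × (∀ i, E i) → ℝ≥0∞ := fun z => K ^ q * ∫⁻ θ,
    coneDensity (rotProj act I z.1 z.2) (μ.map (rotProj act I z.1)) θ ^ q ∂(prodSurface F) with hD
  have hDm : Measurable D :=
    (((measurable_coneDensity_rotProj h I μ).pow_const q).lintegral_prod_right').const_mul _
  have hrot : ∀ g, Continuous (rotProj act I g) := continuous_rotProj_right I
  have hΦ : ∀ g, Continuous fun (z : ∀ i, F i) i => φ g i (z i) := fun g =>
    continuous_pi fun i => (φ g i).continuous.comp (continuous_apply i)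
  have hpt : ∀ g, ∀ᵐ y ∂ν, measureLpNorm p
      (radialPush (fun i => φ g i (rotProj act I g y i))
        (μ.map fun x i => φ g i (rotProj act I g x i)))
      (prodSurface (F' g)) ^ p ≤ μ Set.univ ^ (1 - τ) * D (g, y) ^ τ := by
    intro g
    filter_upwards [hR'] with y hy
    have e1 : (μ.map fun x i => φ g i (rotProj act I g x i)) =
        (μ.map (rotProj act I g)).map fun z i => φ g i (z i) := by
      rw [Measure.map_map (hΦ g).measurable (hrot g).measurable]
      rfl
    have hy' : ∀ᵐ z ∂(μ.map (rotProj act I g)), ∀ i, ‖z i - rotProj act I g y i‖ ≤ R := by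
      have hS : MeasurableSet {z : ∀ i, F i | ∀ i, ‖z i - rotProj act I g y i‖ ≤ R} := by
        rw [Set.ofPred_forall]
        exact MeasurableSet.iInter fun i => measurableSet_le
          ((measurable_pi_apply i).sub_const _).norm measurable_const
      rw [ae_map_iff (hrot g).measurable.aemeasurable hS]
      filter_upwards [hy] with x hx i
      exact (norm_rotProj_sub_le I g x y i).trans (hx i)
    have h2 := measureLpNorm_radialPush_map_rpow_le (φ g) hq (w := rotProj act I g y)
      (μ := μ.map (rotProj act I g)) hR hy'
    rw [← e1] at h2
    have hfin := isFiniteMeasure_radialPush (fun i => φ g i (rotProj act I g y i))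
      (μ.map fun x i => φ g i (rotProj act I g x i))
    have hmass : radialPush (fun i => φ g i (rotProj act I g y i))
        (μ.map fun x i => φ g i (rotProj act I g x i)) Set.univ ≤ μ Set.univ := by
      refine (radialPush_univ_le _ _).trans (le_of_eq ?_)
      have hcm : Measurable fun x i => φ g i (rotProj act I g x i) :=
        ((hΦ g).comp (hrot g)).measurable
      rw [Measure.map_apply hcm MeasurableSet.univ, Set.preimage_univ]
    refine (measureLpNorm_rpow_le_mul hq hτ0 hτ1 hp).trans ?_
    have : 0 ≤ 1 - τ := by linarith
    gcongr
  refine (lintegral_lintegral_rpow_le (Measure.pi lam) ν hp1.le hτ0 hτ1 hDm hpt).trans ?_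
  refine rpow_mul_rpow_interpolation_le hq hτ0 hτ1 hp hLτ hA hQ1 hμA hνA ?_
  have hKt : K ^ q ≠ ∞ := ENNReal.rpow_ne_top_of_nonneg (by linarith) ENNReal.ofReal_ne_top
  have hKQ : K ^ q ≤ ENNReal.ofReal (radialConst F) ^ q * Q ^ (sphereDim F * q) := by
    rw [hK, ENNReal.ofReal_mul hrc.le, ENNReal.mul_rpow_of_nonneg _ _ (by linarith),
      ENNReal.rpow_mul]
    gcongr
    rw [hQ, ENNReal.ofReal_rpow_of_nonneg (by linarith) hsd]
    gcongr
    linarith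
  have h2Q : (2 : ℝ≥0∞) ^ n ≤ Q ^ (n : ℝ) := by
    rw [ENNReal.rpow_natCast]
    gcongr
    rw [hQ, ← ENNReal.ofReal_ofNat 2]
    gcongr
    linarith
  calc ∫⁻ g, ∫⁻ y, D (g, y) ∂ν ∂(Measure.pi lam)
      = K ^ q * ∫⁻ g, ∫⁻ y, ∫⁻ θ, coneDensity (rotProj act I g y)
          (μ.map (rotProj act I g)) θ ^ q ∂(prodSurface F) ∂ν ∂(Measure.pi lam) := by
        simp_rw [hD, lintegral_const_mul' _ _ hKt]
    _ ≤ (ENNReal.ofReal (radialConst F) ^ q * Q ^ (sphereDim F * q)) *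
          (c * Q ^ N * ((k * Cμ : ℝ≥0) : ℝ≥0∞) ^ q * (k * Cν : ℝ≥0)) := by
        gcongr
        exact hmain R _ _ hR μ ν hμ hν hμR hνR
    _ = B * (Q ^ (sphereDim F * q) * Q ^ N) * (Cμ : ℝ≥0∞) ^ q * Cν := by
        rw [hB, ENNReal.coe_mul, ENNReal.coe_mul, ENNReal.mul_rpow_of_nonneg _ _ (by linarith)]
        ring
    _ ≤ Q ^ (n : ℝ) * (Q ^ (sphereDim F * q) * Q ^ N) * (Cμ : ℝ≥0∞) ^ q * Cν := by
        gcongr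
        exact hn.trans h2Q
    _ = _ := by
        rw [hL, ENNReal.rpow_add_of_nonneg n _ (by positivity) (by positivity),
          ENNReal.rpow_add_of_nonneg (sphereDim F * q) N (by positivity) hN]

end RotationGeneral

/-! ### Rotated subspaces and their projections. -/

section GrassmannianRotation

variable {n k : ℕ}

/-- An isometric parametrization of a subspace. -/
def RealGrassmannian.param (V : RealGrassmannian n k) : EuclideanSpace ℝ (Fin k) ≃ₗᵢ[ℝ] V.1 :=
  ((stdOrthonormalBasis ℝ V.1).reindex (finCongr V.2)).repr.symm

/-- The isometric embedding of `ℝ^k` onto a subspace. -/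
def RealGrassmannian.embed (V : RealGrassmannian n k) :
    EuclideanSpace ℝ (Fin k) →ₗᵢ[ℝ] EuclideanSpace ℝ (Fin n) :=
  V.1.subtypeₗᵢ.comp V.param.toLinearIsometry

/-- The isometric parametrization of a rotated subspace. -/
def RealGrassmannian.rotateParam (V : RealGrassmannian n k) (g : OrthGroup n) :
    EuclideanSpace ℝ (Fin k) ≃ₗᵢ[ℝ] (V.rotate g).1 :=
  V.param.trans ((Unitary.linearIsometryEquiv g).submoduleMap V.1)

theorem RealGrassmannian.coe_rotateParam (V : RealGrassmannian n k) (g : OrthGroup n)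
    (q : EuclideanSpace ℝ (Fin k)) :
    (V.rotateParam g q : EuclideanSpace ℝ (Fin n)) = Unitary.linearIsometryEquiv g (V.embed q) :=
  rfl

/-- The orthogonal projection onto `g V` is that onto `V` conjugated by `g`. This is why the random
rotation acts by `g⁻¹`. -/
theorem RealGrassmannian.rotateParam_adjoint (V : RealGrassmannian n k) (g : OrthGroup n)
    (x : EuclideanSpace ℝ (Fin n)) :
    V.rotateParam g (V.embed.toContinuousLinearMap.adjoint (g.invAct x)) =
      (V.rotate g).1.orthogonalProjectionOnto x := by
  obtain ⟨q, hq⟩ := (V.rotateParam g).surjective ((V.rotate g).1.orthogonalProjectionOnto x)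
  rw [← hq]
  congr 1
  refine ext_inner_left ℝ fun a => ?_
  rw [ContinuousLinearMap.adjoint_inner_right, ← (V.rotateParam g).inner_map_map, hq,
    Submodule.inner_orthogonalProjectionOnto_eq_of_mem_left, V.coe_rotateParam,
    ← (Unitary.linearIsometryEquiv g).inner_map_map (V.embed.toContinuousLinearMap a)]
  simp [OrthGroup.invAct]

end GrassmannianRotation

/-! ### Euclidean versus supremum norm, and supports. -/

section ProductSpace

variable {ι : Type*} [Fintype ι] {E : ι → Type*} [∀ i, NormedAddCommGroup (E i)]

theorem preimage_ofLp_ball_subset [Nonempty ι] (x : ∀ i, E i) {r : ℝ} (hr : 0 < r) :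
    (WithLp.ofLp : PiLp 2 E → ∀ i, E i) ⁻¹' ball x r ⊆
      ball (WithLp.toLp 2 x) (Fintype.card ι * r) := by
  intro y hy
  rw [Set.mem_preimage, mem_ball, dist_pi_lt_iff hr] at hy
  have hc : (1 : ℝ) ≤ Fintype.card ι := by exact_mod_cast Fintype.card_pos (α := ι)
  rw [mem_ball, dist_eq_norm]
  refine lt_of_pow_lt_pow_left₀ 2 (by positivity) ?_
  rw [PiLp.norm_sq_eq_of_L2]
  have h1 : ∀ i ∈ Finset.univ, ‖(y - WithLp.toLp 2 x).ofLp i‖ ^ 2 < r ^ 2 := by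
    intro i _
    have h2 : ‖(y - WithLp.toLp 2 x).ofLp i‖ < r := by
      have := hy i
      rwa [dist_eq_norm] at this
    gcongr
  have h2 := Finset.sum_lt_sum_of_nonempty (Finset.univ_nonempty (α := ι)) h1
  simp only [Finset.sum_const, Finset.card_univ, nsmul_eq_mul] at h2
  have : (Fintype.card ι : ℝ) * r ^ 2 ≤ (Fintype.card ι * r) ^ 2 := by
    rw [mul_pow]
    gcongr
    nlinarith
  linarith

theorem isFiniteMeasure_of_isCompact_support {X : Type*} [TopologicalSpace X]
    [HereditarilyLindelofSpace X] [MeasurableSpace X] (μ : Measure X)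
    [IsFiniteMeasureOnCompacts μ] (h : IsCompact μ.support) : IsFiniteMeasure μ :=
  ⟨by
    rw [← Set.union_compl_self μ.support]
    refine (measure_union_le _ _).trans_lt ?_
    rw [Measure.measure_compl_support, add_zero]
    exact h.measure_lt_top⟩

end ProductSpace

section MultiSpaceMeasures

variable {ℓ : ℕ} {dv : Fin ℓ → ℕ}

theorem ae_map_ofLp_mem_support (μ : Measure (MultiSpace dv)) :
    ∀ᵐ x ∂(μ.map WithLp.ofLp), WithLp.toLp 2 x ∈ μ.support := by
  have hS : MeasurableSet {x : ∀ i, EuclideanSpace ℝ (Fin (dv i)) |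
      (WithLp.toLp 2 x : MultiSpace dv) ∈ μ.support} :=
    (Measure.isClosed_support (μ := μ)).measurableSet.preimage (WithLp.measurable_toLp 2 _)
  rw [ae_map_iff (WithLp.measurable_ofLp 2 _).aemeasurable hS]
  exact Measure.support_mem_ae

theorem map_ofLp_ball_le [NeZero ℓ] {μ : Measure (MultiSpace dv)} {C k : ℝ≥0} {α : ℝ}
    (hμ : ∀ (x : MultiSpace dv) (r : ℝ), 0 < r → μ (ball x r) ≤ C * ENNReal.ofReal (r ^ α))
    (hk : (ℓ : ℝ≥0) ^ α ≤ k) (x : ∀ i, EuclideanSpace ℝ (Fin (dv i))) (r : ℝ) (hr : 0 < r) :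
    μ.map WithLp.ofLp (ball x r) ≤ (k * C : ℝ≥0) * ENNReal.ofReal (r ^ α) := by
  have hℓ : (0 : ℝ) < ℓ := by exact_mod_cast Nat.pos_of_neZero ℓ
  rw [Measure.map_apply (WithLp.measurable_ofLp 2 _) measurableSet_ball]
  refine (measure_mono (preimage_ofLp_ball_subset x hr)).trans ?_
  rw [Fintype.card_fin]
  refine (hμ _ _ (by positivity)).trans ?_
  rw [Real.mul_rpow hℓ.le hr.le, ENNReal.ofReal_mul (by positivity), ENNReal.coe_mul,
    ← mul_assoc, mul_comm (k : ℝ≥0∞)]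
  gcongr
  have : ENNReal.ofReal ((ℓ : ℝ) ^ α) = ((ℓ : ℝ≥0) ^ α : ℝ≥0) := by
    rw [← ENNReal.ofReal_coe_nnreal]
    simp
  rw [this]
  exact_mod_cast hk

theorem ae_ae_norm_sub_le (μ ν : Measure (MultiSpace dv)) {s : Set (MultiSpace dv)}
    (hs : Bornology.IsBounded s) (hμ : μ.support ⊆ s) (hν : ν.support ⊆ s) {R : ℝ}
    (hR : diam s ≤ R) :
    ∀ᵐ y ∂(ν.map WithLp.ofLp), ∀ᵐ x ∂(μ.map WithLp.ofLp), ∀ i, ‖x i - y i‖ ≤ R := by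
  filter_upwards [ae_map_ofLp_mem_support ν] with y hy
  filter_upwards [ae_map_ofLp_mem_support μ] with x hx i
  calc ‖x i - y i‖ = ‖(WithLp.toLp 2 x - WithLp.toLp 2 y : MultiSpace dv) i‖ := rfl
    _ ≤ ‖(WithLp.toLp 2 x - WithLp.toLp 2 y : MultiSpace dv)‖ := PiLp.norm_apply_le _ i
    _ = dist (WithLp.toLp 2 x : MultiSpace dv) (WithLp.toLp 2 y) := (dist_eq_norm _ _).symm
    _ ≤ diam s := dist_le_diam_of_mem hs (hμ hx) (hν hy)
    _ ≤ R := hR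

/-- A supremum ball of radius `1 / (d + 1)` lies in a Euclidean ball of radius `1` because `ℓ ≤ d`,
and at radius `1` the Frostman condition does not see `α`. Covering at this scale gives a mass bound
in terms of `C`, `d` and `R` only. -/
theorem map_ofLp_univ_le [NeZero ℓ] {μ : Measure (MultiSpace dv)} [IsFiniteMeasure μ] {C : ℝ≥0}
    {α R : ℝ} {d : ℕ} (hd : ∑ i, dv i = d) (hℓ : ℓ ≤ d) (hR0 : 0 ≤ R)
    (hμ : ∀ (x : MultiSpace dv) (r : ℝ), 0 < r → μ (ball x r) ≤ C * ENNReal.ofReal (r ^ α))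
    (hR : ∀ᵐ y ∂(μ.map WithLp.ofLp), ∀ᵐ x ∂(μ.map WithLp.ofLp), ∀ i, ‖x i - y i‖ ≤ R) :
    μ.map WithLp.ofLp Set.univ ≤ C * ENNReal.ofReal ((R * (d + 1) + 1) ^ d) := by
  rcases eq_or_ne (μ.map WithLp.ofLp) 0 with h0 | h0
  · rw [h0]; simp
  have : NeZero (μ.map WithLp.ofLp) := ⟨h0⟩
  obtain ⟨y, hy⟩ := hR.exists
  have hr : (0 : ℝ) < 1 / (d + 1) := by positivity
  have hball : ∀ x, μ.map WithLp.ofLp (ball x (1 / ((d : ℝ) + 1))) ≤ C := by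
    intro x
    rw [Measure.map_apply (WithLp.measurable_ofLp 2 _) measurableSet_ball]
    have h1 : Fintype.card (Fin ℓ) * (1 / ((d : ℝ) + 1)) ≤ 1 := by
      rw [Fintype.card_fin, mul_one_div, div_le_one (by positivity)]
      have : (ℓ : ℝ) ≤ d := by exact_mod_cast hℓ
      linarith
    refine (measure_mono ((preimage_ofLp_ball_subset x hr).trans
      (ball_subset_ball h1))).trans ((hμ _ 1 one_pos).trans ?_)
    simp
  have h := measure_univ_le_of_ball_le (μ.map WithLp.ofLp) hr hR0 hball y hy
  refine h.trans (le_of_eq ?_)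
  have e : (R + 1 / ((d : ℝ) + 1)) / (1 / (d + 1)) = R * (d + 1) + 1 := by
    field_simp
  rw [e, Module.finrank_pi_fintype]
  simp only [finrank_euclideanSpace_fin, hd]

end MultiSpaceMeasures

/-! ### Integration over the Grassmannians. -/

section GrassmannianIntegral

variable {ℓ : ℕ} {dv kv : Fin ℓ → ℕ}

/-- The product of the `grassmannMeasure`s is the image of the product of Haar measures. An
inequality holds for every `f`, so no measurability of the integrand in `V` has to be established.
-/
theorem lintegral_pi_grassmannMeasure_le (hkd : ∀ i, kv i ≤ dv i)
    (f : MultiGrassmannian dv kv → ℝ≥0∞) :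
    ∫⁻ V, f V ∂(Measure.pi fun i => grassmannMeasure (hkd i)) ≤
      ∫⁻ g, f (fun i => (RealGrassmannian.std (hkd i)).rotate (g i))
        ∂(Measure.pi fun i => orthHaar (dv i)) := by
  have hσ : ∀ i, SigmaFinite ((orthHaar (dv i)).map (RealGrassmannian.std (hkd i)).rotate) :=
    fun i => by
      have : IsProbabilityMeasure ((orthHaar (dv i)).map (RealGrassmannian.std (hkd i)).rotate) :=
        grassmannMeasure.instIsProbabilityMeasure (hkd i)
      infer_instance
  have h : (Measure.pi fun i => orthHaar (dv i)).map
      (fun g i => (RealGrassmannian.std (hkd i)).rotate (g i)) =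
      Measure.pi fun i => grassmannMeasure (hkd i) :=
    Measure.pi_map_pi fun i =>
      (RealGrassmannian.std (hkd i)).continuous_rotate.measurable.aemeasurable
  rw [← h]
  exact lintegral_map_le _ _

/-- The orthogonal projections onto the rotations of the standard subspaces. -/
def stdRotProj (hkd : ∀ i, kv i ≤ dv i) (g : ∀ i, OrthGroup (dv i))
    (x : ∀ i, EuclideanSpace ℝ (Fin (dv i))) (i : Fin ℓ) :
    ((RealGrassmannian.std (hkd i)).rotate (g i)).1 :=
  (RealGrassmannian.std (hkd i)).rotateParam (g i)
    (rotProj (fun _ => OrthGroup.invAct) (fun i => (RealGrassmannian.std (hkd i)).embed) g x i)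

theorem continuous_stdRotProj (hkd : ∀ i, kv i ≤ dv i) (g : ∀ i, OrthGroup (dv i)) :
    Continuous (stdRotProj hkd g) := by
  refine continuous_pi fun i => ?_
  have h1 : Continuous fun x : ∀ i, EuclideanSpace ℝ (Fin (dv i)) =>
      rotProj (fun _ => OrthGroup.invAct) (fun i => (RealGrassmannian.std (hkd i)).embed) g x i :=
    continuous_pi_iff.1 (continuous_rotProj_right (act := fun _ => OrthGroup.invAct)
      (fun i => (RealGrassmannian.std (hkd i)).embed) g) i
  have h2 := ((RealGrassmannian.std (hkd i)).rotateParam (g i)).continuous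
  unfold stdRotProj
  generalize (RealGrassmannian.std (hkd i)).rotateParam (g i) = φ at h2 ⊢
  simpa only [Function.comp_def] using Continuous.comp h2 h1

theorem map_multiProj_rotate (hkd : ∀ i, kv i ≤ dv i) (g : ∀ i, OrthGroup (dv i))
    (ϖ : Measure (MultiSpace dv)) :
    ϖ.map (multiProj fun i => (RealGrassmannian.std (hkd i)).rotate (g i)) =
      (ϖ.map WithLp.ofLp).map (stdRotProj hkd g) := by
  have h : multiProj (fun i => (RealGrassmannian.std (hkd i)).rotate (g i)) =
      stdRotProj hkd g ∘ WithLp.ofLp := by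
    funext x i
    exact ((RealGrassmannian.std (hkd i)).rotateParam_adjoint (g i) (x i)).symm
  rw [h, Measure.map_map (continuous_stdRotProj hkd g).measurable (WithLp.measurable_ofLp 2 _)]

theorem exists_lintegral_measureLpNorm_stdRotProj_le [NeZero ℓ] {d : ℕ} (hd : ∑ i, dv i = d)
    (hk : ∀ i, 2 ≤ kv i) (hkd : ∀ i, kv i ≤ dv i) {M α β : ℝ}
    (hM : ∀ i, (d : ℝ) - dv i + kv i - 1 ≤ M)
    (hα : M < α) (hαβ : 2 * M - α < β) (hβ : ∀ i, M - ((kv i : ℝ) - 1) < β) (k : ℝ≥0) :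
    ∃ p : ℝ, 1 < p ∧
      ∀ (R : ℝ) (Cμ Cν : ℝ≥0) (A : ℝ≥0∞), 1 ≤ R → 1 ≤ A →
      ∀ (μ ν : Measure (∀ i, EuclideanSpace ℝ (Fin (dv i)))) [IsFiniteMeasure μ]
        [IsFiniteMeasure ν],
      (∀ x r, 0 < r → μ (ball x r) ≤ (k * Cμ : ℝ≥0) * ENNReal.ofReal (r ^ α)) →
      (∀ x r, 0 < r → ν (ball x r) ≤ (k * Cν : ℝ≥0) * ENNReal.ofReal (r ^ β)) →
      (∀ᵐ y ∂μ, ∀ᵐ x ∂μ, ∀ i, ‖x i - y i‖ ≤ R) →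
      (∀ᵐ y ∂ν, ∀ᵐ x ∂ν, ∀ i, ‖x i - y i‖ ≤ R) →
      (∀ᵐ y ∂ν, ∀ᵐ x ∂μ, ∀ i, ‖x i - y i‖ ≤ R) →
      μ Set.univ ≤ Cμ * A → ν Set.univ ≤ Cν * A →
      ∫⁻ g, (∫⁻ y, measureLpNorm p (radialPush (stdRotProj hkd g y) (μ.map (stdRotProj hkd g)))
          (prodSurface fun i => ((RealGrassmannian.std (hkd i)).rotate (g i)).1) ^ p ∂ν) ^ (1 / p)
          ∂(Measure.pi fun i => orthHaar (dv i)) ≤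
        ENNReal.ofReal (2 * R) * A ^ 2 * Cμ * (Cν : ℝ≥0∞) ^ (1 / p) :=
  exists_lintegral_measureLpNorm_rotProj_le
    (E := fun i => EuclideanSpace ℝ (Fin (dv i))) (F := fun i => EuclideanSpace ℝ (Fin (kv i)))
    (lam := fun i => orthHaar (dv i)) (act := fun _ => OrthGroup.invAct)
    (fun i => isRandomRotation_invAct) (fun i => by rw [finrank_euclideanSpace_fin]; exact hk i)
    (fun i => by rw [finrank_euclideanSpace_fin, finrank_euclideanSpace_fin]; exact hkd i)
    (α := α) (β := β) (M := M)
    (fun i => by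
      rw [Module.finrank_pi_fintype]
      simp only [finrank_euclideanSpace_fin, hd]
      exact hM i) hα hαβ
    (fun i => by rw [finrank_euclideanSpace_fin]; exact hβ i)
    (fun i => (RealGrassmannian.std (hkd i)).embed) k
    (F' := fun g i => ((RealGrassmannian.std (hkd i)).rotate (g i)).1)
    (fun g i => (RealGrassmannian.std (hkd i)).rotateParam (g i))

theorem lintegral_measureLpNorm_multiProj_le (hkd : ∀ i, kv i ≤ dv i) {p : ℝ} (hp : 0 < p)
    (μ ν : Measure (MultiSpace dv)) (S : Set (MultiGrassmannian dv kv)) :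
    ∫⁻ V in S, (∫⁻ w, measureLpNorm p (radialPush w (μ.map (multiProj V)))
        (prodSurface fun i => (V i).1) ^ p ∂(ν.map (multiProj V))) ^ (1 / p)
        ∂(Measure.pi fun i => grassmannMeasure (hkd i)) ≤
      ∫⁻ g, (∫⁻ y, measureLpNorm p (radialPush (stdRotProj hkd g y)
          ((μ.map WithLp.ofLp).map (stdRotProj hkd g)))
          (prodSurface fun i => ((RealGrassmannian.std (hkd i)).rotate (g i)).1) ^ p
          ∂(ν.map WithLp.ofLp)) ^ (1 / p) ∂(Measure.pi fun i => orthHaar (dv i)) := by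
  refine (setLIntegral_le_lintegral _ _).trans
    ((lintegral_pi_grassmannMeasure_le hkd _).trans (lintegral_mono fun g => ?_))
  rw [map_multiProj_rotate, map_multiProj_rotate]
  exact ENNReal.rpow_le_rpow (lintegral_map_le _ _) (by positivity)

end GrassmannianIntegral

end

/-! ### The multiparameter radial projection theorem. -/

theorem mainTheorem4 (d : ℕ) :
    ∃ C : ℝ → ℝ≥0, ∀ (ℓ : ℕ) (_ : 1 ≤ ℓ) (dv kv : Fin ℓ → ℕ) (_ : ∑ i, dv i = d)
      (_ : ∀ i, 2 ≤ kv i) (hkd : ∀ i, kv i ≤ dv i) (M α β : ℝ)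
      (_ : IsGreatest (Set.range fun i => (d : ℝ) - dv i + kv i - 1) M)
      (_ : M < α) (_ : 2 * M - α < β) (_ : ∀ i, M - ((kv i : ℝ) - 1) < β),
      ∃ p : ℝ, 1 < p ∧
        ∀ (μ ν : Measure (MultiSpace dv)) [IsLocallyFiniteMeasure μ] [IsLocallyFiniteMeasure ν]
          (_ : IsCompact μ.support) (_ : IsCompact ν.support)
          (_ : ∀ i, Disjoint ((fun x => x i) '' μ.support) ((fun x => x i) '' ν.support))
          (Cμ Cν : ℝ≥0)
          (_ : ∀ (x : MultiSpace dv) (r : ℝ), 0 < r →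
            μ (ball x r) ≤ Cμ * ENNReal.ofReal (r ^ α))
          (_ : ∀ (x : MultiSpace dv) (r : ℝ), 0 < r →
            ν (ball x r) ≤ Cν * ENNReal.ofReal (r ^ β)),
          ∫⁻ V in separatingSubspaces kv μ.support ν.support,
              (∫⁻ w, measureLpNorm p (radialPush w (μ.map (multiProj V)))
                  (prodSurface fun i => (V i).1) ^ p ∂(ν.map (multiProj V))) ^ (1 / p)
              ∂(Measure.pi fun i => grassmannMeasure (hkd i)) ≤
            C (diam (μ.support ∪ ν.support)) * Cμ * (Cν : ℝ≥0∞) ^ (1 / p) := by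
  -- With `R = D + 1 ≥ 1` this is `2R * A ^ 2`, where `A = (R (d + 1) + 1) ^ d` is the mass constant
  -- of `map_ofLp_univ_le`.
  refine ⟨fun D => (2 * (D + 1)).toNNReal * ((((D + 1) * (d + 1) + 1) ^ d).toNNReal) ^ 2, ?_⟩
  intro ℓ hℓ dv kv hd hk hkd M α β hM hα hαβ hβ
  have : NeZero ℓ := ⟨by omega⟩
  have hℓd : ℓ ≤ d := by
    rw [← hd]
    calc ℓ = ∑ _ : Fin ℓ, 1 := by simp
      _ ≤ ∑ i, dv i := Finset.sum_le_sum fun i _ => by have := hk i; have := hkd i; omega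
  -- Passing from Euclidean balls to supremum balls multiplies the Frostman constants by at most `ℓ
  -- ^ α` and `ℓ ^ β`. This loss is given to the parameter `k`, which affects `p` but not the
  -- constant.
  obtain ⟨p, hp, hmain⟩ := exists_lintegral_measureLpNorm_stdRotProj_le hd hk hkd
    (fun i => hM.2 ⟨i, rfl⟩) hα hαβ hβ (max ((ℓ : ℝ≥0) ^ α) ((ℓ : ℝ≥0) ^ β))
  refine ⟨p, hp, ?_⟩
  intro μ ν _ _ hμc hνc _ Cμ Cν hμ hν
  have hμf := isFiniteMeasure_of_isCompact_support μ hμc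
  have hνf := isFiniteMeasure_of_isCompact_support ν hνc
  set D := diam (μ.support ∪ ν.support) with hD
  have hD0 : 0 ≤ D := diam_nonneg
  have hbdd : Bornology.IsBounded (μ.support ∪ ν.support) := (hμc.union hνc).isBounded
  have hsub := fun (μ₁ ν₁ : Measure (MultiSpace dv)) h₁ h₂ =>
    ae_ae_norm_sub_le μ₁ ν₁ hbdd h₁ h₂ (by linarith : D ≤ D + 1)
  have hμR := hsub μ μ Set.subset_union_left Set.subset_union_left
  have hνR := hsub ν ν Set.subset_union_right Set.subset_union_right
  have hA1 : (1 : ℝ) ≤ ((D + 1) * (d + 1) + 1) ^ d := one_le_pow₀ (by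
    have : 0 ≤ (D + 1) * ((d : ℝ) + 1) := by positivity
    linarith)
  have key := hmain (D + 1) Cμ Cν (ENNReal.ofReal (((D + 1) * (d + 1) + 1) ^ d))
    (by linarith) (ENNReal.one_le_ofReal.2 hA1) (μ.map WithLp.ofLp) (ν.map WithLp.ofLp)
    (map_ofLp_ball_le hμ (le_max_left _ _)) (map_ofLp_ball_le hν (le_max_right _ _)) hμR hνR
    (hsub μ ν Set.subset_union_left Set.subset_union_right)
    (map_ofLp_univ_le hd hℓd (by linarith) hμ hμR) (map_ofLp_univ_le hd hℓd (by linarith) hν hνR)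
  have hC : ((((2 * (D + 1)).toNNReal * ((((D + 1) * (d + 1) + 1) ^ d).toNNReal) ^ 2 : ℝ≥0)) :
      ℝ≥0∞) = ENNReal.ofReal (2 * (D + 1)) * ENNReal.ofReal (((D + 1) * (d + 1) + 1) ^ d) ^ 2 := by
    rw [ENNReal.coe_mul, ENNReal.coe_pow]
    rfl
  rw [hC]
  exact (lintegral_measureLpNorm_multiProj_le hkd (by linarith) μ ν _).trans key
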